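/- Let $G$ be a group, $\mathbf{S}$ a symmetric monoidal category and $\mathbf{B}$ a braided monoidal category. Let $\mathbb{D}\otimes\mathbb{P}\otimes\mathbb{G}$ be the PROP whose objects are the natural numbers, and whose morphisms $n\to m$ are the pairs $(\varphi,j)$ of an order-preserving map $\varphi\colon\{1,\dots,n\}\to\{1,\dots,m\}$ and an element $j\in G^n\rtimes\Sigma_n$, thought of as $\varphi\circ j$. Composition is $(\varphi,i)\circ(\psi,j)=(\varphi\circ i_\star(\psi),\ \psi^\star(i)\,j)$, where $i\circ\psi=i_\star(\psi)\circ\psi^\star(i)$ is the crossed simplicial group structure: for a permutation $i$, $i_\star(\psi)$ is order-preserving and $\psi^\star(i)$ is the permutation that preserves the order on the fibres of $\psi$; labels in $G$ are copied along the fibres. The tensor product is addition (juxtaposition), and the symmetry is given by block permutations. The PROB $\mathbb{D}\otimes\mathbb{B}\otimes\mathbb{G}$ is defined in the same way with Artin's braid groups $B_n$ in place of $\Sigma_n$, where $i_\star(\psi)$ is computed from the underlying permutation of $i$, the braid $\psi^\star(i)$ is obtained from $i$ by replacing its $k$-th strand by $|\psi^{-1}(k)|$ parallel strands, and the braiding is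 given by block crossings. For a PROP $\mathbf{P}$ (respectively a PROB $\mathbf{Q}$), or the opposite of one, let $\mathbf{Alg}(\mathbf{P},\mathbf{S})$ (respectively $\mathbf{Alg}(\mathbf{Q},\mathbf{B})$) be the category of symmetric (respectively braided) strong monoidal functors and monoidal natural transformations. Let $\mathbf{GMon}(\mathbf{C})=\mathrm{Fun}(G,\mathbf{Mon}(\mathbf{C}))$ and $\mathbf{GComon}(\mathbf{C})=\mathrm{Fun}(G,\mathbf{Comon}(\mathbf{C}))$, where $G$ is regarded as a category with one object. Then there are equivalences of categories 1. $\mathbf{Alg}(\mathbb{D}\otimes\mathbb{P}\otimes\mathbb{G},\mathbf{S})\simeq\mathbf{GMon}(\mathbf{S})$; 2. $\mathbf{Alg}(\mathbb{D}\otimes\mathbb{B}\otimes\mathbb{G},\mathbf{B})\simeq\mathbf{GMon}(\mathbf{B})$; 3. $\mathbf{Alg}((\mathbb{D}\otimes\mathbb{P}\otimes\mathbb{G})^{op},\mathbf{S})\simeq\mathbf{GComon}(\mathbf{S})$; 4. $\mathbf{Alg}((\mathbb{D}\otimes\mathbb{B}\otimes\mathbb{G})^{op},\mathbf{B})\simeq\mathbf{GComon}(\mathbf{B})$.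 If $\mathbf{S}$ is strict, (1) and (3) also hold with $\mathbf{Alg}$ replaced by its full subcategory of strict monoidal functors; if $\mathbf{B}$ is strict, the same holds for (2) and (4). -/

import Mathlib

open CategoryTheory MonoidalCategory

namespace EquivariantPROP

/-- The set of order-preserving maps from `{0, …, n - 1}` to `{0, …, m - 1}`: the morphisms of
the PRO `𝔻`. -/
abbrev OrdMap (n m : ℕ) := Fin n →o Fin m

/-- The isomorphism of `𝔻` given by an equality of natural numbers. -/
def OrdMap.cast {n m : ℕ} (h : n = m) : OrdMap n m where
  toFun := Fin.cast h
  monotone' := fun _ _ hxy => hxy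

/-- The tensor product (disjoint union) of order-preserving maps. -/
def OrdMap.sum {a b c d : ℕ} (φ : OrdMap a c) (ψ : OrdMap b d) : OrdMap (a + b) (c + d) where
  toFun := Fin.addCases (fun i => Fin.castAdd d (φ i)) (fun j => Fin.natAdd c (ψ j))
  monotone' := by
    intro x y
    induction x using Fin.addCases <;> induction y using Fin.addCases <;>
      intro h <;> simp only [Fin.addCases_left, Fin.addCases_right]
    · rename_i i j
      have h' : i ≤ j := h
      have h2 : φ i ≤ φ j := φ.monotone h'
      exact h2
    · rename_i i j
      rw [Fin.le_def, Fin.val_castAdd, Fin.val_natAdd]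
      have := (φ i).isLt
      omega
    · rename_i i j
      rw [Fin.le_def, Fin.val_castAdd, Fin.val_natAdd] at h
      have := j.isLt
      omega
    · rename_i i j
      have h' : i ≤ j := Nat.le_of_add_le_add_left h
      have h2 : ψ i ≤ ψ j := ψ.monotone h'
      exact Nat.add_le_add_left h2 c

@[simp] theorem OrdMap.sum_castAdd {a b c d : ℕ} (φ : OrdMap a c) (ψ : OrdMap b d) (i : Fin a) :
    φ.sum ψ (Fin.castAdd b i) = Fin.castAdd d (φ i) :=
  Fin.addCases_left (motive := fun _ => Fin (c + d)) (left := fun i => Fin.castAdd d (φ i))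
    (right := fun j => Fin.natAdd c (ψ j)) i

@[simp] theorem OrdMap.sum_natAdd {a b c d : ℕ} (φ : OrdMap a c) (ψ : OrdMap b d) (j : Fin b) :
    φ.sum ψ (Fin.natAdd a j) = Fin.natAdd c (ψ j) :=
  Fin.addCases_right (motive := fun _ => Fin (c + d)) (left := fun i => Fin.castAdd d (φ i))
    (right := fun j => Fin.natAdd c (ψ j)) j

@[simp] theorem OrdMap.val_cast {n m : ℕ} (h : n = m) (i : Fin n) :
    (OrdMap.cast h i : ℕ) = i := rfl

/-- Juxtaposition of permutations. -/
def permSum {a b : ℕ} (σ : Equiv.Perm (Fin a)) (τ : Equiv.Perm (Fin b)) :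
    Equiv.Perm (Fin (a + b)) :=
  finSumFinEquiv.permCongr (Equiv.Perm.sumCongr σ τ)

@[simp] theorem permSum_castAdd {a b : ℕ} (σ : Equiv.Perm (Fin a)) (τ : Equiv.Perm (Fin b))
    (i : Fin a) : permSum σ τ (Fin.castAdd b i) = Fin.castAdd b (σ i) := by
  simp [permSum, Equiv.permCongr_apply]

@[simp] theorem permSum_natAdd {a b : ℕ} (σ : Equiv.Perm (Fin a)) (τ : Equiv.Perm (Fin b))
    (j : Fin b) : permSum σ τ (Fin.natAdd a j) = Fin.natAdd a (τ j) := by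
  simp [permSum, Equiv.permCongr_apply]

/-- The block transposition of `{0, …, a + b - 1}`, which moves the first `a` elements past the
last `b` elements and keeps the order inside the two blocks. -/
def permSwap (a b : ℕ) : Equiv.Perm (Fin (a + b)) :=
  finAddFlip.trans (finCongr (Nat.add_comm b a))

@[simp] theorem val_permSwap_castAdd {a b : ℕ} (i : Fin a) :
    (permSwap a b (Fin.castAdd b i) : ℕ) = b + i := by
  simp [permSwap, Nat.add_comm]

@[simp] theorem val_permSwap_natAdd {a b : ℕ} (j : Fin b) :
    (permSwap a b (Fin.natAdd a j) : ℕ) = j := by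
  simp [permSwap]

/-- The permutation `φ^⋆(σ)`: the unique permutation that preserves the order on the fibres of `φ`
and for which `σ ∘ φ ∘ φ^⋆(σ)⁻¹` is order-preserving. -/
def permPull {n m : ℕ} (φ : OrdMap n m) (σ : Equiv.Perm (Fin m)) : Equiv.Perm (Fin n) :=
  (Tuple.sort (σ ∘ φ))⁻¹

/-- The order-preserving map `σ_⋆(φ)`, determined by `σ ∘ φ = σ_⋆(φ) ∘ φ^⋆(σ)`. -/
def permPush {n m : ℕ} (σ : Equiv.Perm (Fin m)) (φ : OrdMap n m) : OrdMap n m where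
  toFun := (σ ∘ φ) ∘ Tuple.sort (σ ∘ φ)
  monotone' := Tuple.monotone_sort _

theorem permPush_permPull {n m : ℕ} (σ : Equiv.Perm (Fin m)) (φ : OrdMap n m) (x : Fin n) :
    permPush σ φ (permPull φ σ x) = σ (φ x) := by
  simp [permPush, permPull]

theorem permPull_lt {n m : ℕ} (σ : Equiv.Perm (Fin m)) (φ : OrdMap n m) {x y : Fin n}
    (hxy : x < y) (h : φ x = φ y) : permPull φ σ x < permPull φ σ y := by
  have := (Tuple.eq_sort_iff (f := σ ∘ φ) (σ := Tuple.sort (σ ∘ φ))).1 rfl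
  by_contra hlt
  have hne : permPull φ σ x ≠ permPull φ σ y := fun h' => hxy.ne ((permPull φ σ).injective h')
  have hlt' : permPull φ σ y < permPull φ σ x := lt_of_le_of_ne (not_lt.1 hlt) hne.symm
  have h2 := this.2 _ _ hlt' (by simp [permPull, h])
  simp only [permPull, Equiv.Perm.coe_inv, Equiv.apply_symm_apply] at h2
  exact absurd h2 (not_lt.2 hxy.le)

theorem perm_unique {n m : ℕ} {σ : Equiv.Perm (Fin m)} {φ : OrdMap n m} (ψ : OrdMap n m)
    (τ : Equiv.Perm (Fin n)) (h : ∀ x, ψ (τ x) = σ (φ x))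
    (hτ : ∀ x y, x < y → φ x = φ y → τ x < τ y) :
    permPush σ φ = ψ ∧ permPull φ σ = τ := by
  have hs : τ⁻¹ = Tuple.sort (σ ∘ φ) := by
    rw [Tuple.eq_sort_iff]
    constructor
    · have : (σ ∘ φ) ∘ ⇑τ⁻¹ = ψ := by
        funext x
        simp [← h]
      rw [this]
      exact ψ.monotone
    · intro i j hij hf
      by_contra hlt
      have hne : τ⁻¹ i ≠ τ⁻¹ j := fun h' => hij.ne (τ⁻¹.injective h')
      have hlt' := lt_of_le_of_ne (not_lt.1 hlt) hne.symm
      have := hτ _ _ hlt' (by simpa using hf.symm)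
      simp only [Equiv.Perm.coe_inv, Equiv.apply_symm_apply] at this
      exact absurd this (not_lt.2 hij.le)
  constructor
  · ext x
    simp [permPush, ← hs, ← h]
  · simp [permPull, ← hs]

/-- Comparison of the values of `permPull`. -/
theorem permPull_lt_iff {n m : ℕ} (σ : Equiv.Perm (Fin m)) (φ : OrdMap n m) (x y : Fin n) :
    permPull φ σ x < permPull φ σ y ↔ σ (φ x) < σ (φ y) ∨ (φ x = φ y ∧ x < y) := by
  have key : ∀ x y : Fin n, permPull φ σ x < permPull φ σ y → σ (φ x) ≤ σ (φ y) := by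
    intro x y h
    rw [← permPush_permPull, ← permPush_permPull]
    exact (permPush σ φ).monotone h.le
  constructor
  · intro h
    rcases (key x y h).lt_or_eq with h1 | h1
    · exact Or.inl h1
    · refine Or.inr ⟨σ.injective h1, ?_⟩
      by_contra hxy
      rcases (not_lt.1 hxy).lt_or_eq with h2 | h2
      · exact absurd (permPull_lt σ φ h2 (σ.injective h1).symm) (not_lt.2 h.le)
      · subst h2
        exact lt_irrefl _ h
  · rintro (h | ⟨h, hxy⟩)
    · by_contra hlt
      rcases (not_lt.1 hlt).lt_or_eq with h2 | h2
      · exact absurd h (not_lt.2 (key _ _ h2))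
      · rw [(permPull φ σ).injective h2] at h
        exact lt_irrefl _ h
    · exact permPull_lt σ φ hxy h

theorem permPull_id {n : ℕ} (σ : Equiv.Perm (Fin n)) : permPull OrderHom.id σ = σ :=
  (perm_unique (σ := σ) (φ := OrderHom.id) OrderHom.id σ (fun _ => rfl)
    (fun _ _ hxy h => absurd h hxy.ne)).2

theorem permPush_one {n m : ℕ} (φ : OrdMap n m) : permPush 1 φ = φ :=
  (perm_unique (σ := 1) φ 1 (fun _ => rfl) (fun _ _ hxy _ => hxy)).1

theorem permPull_one {n m : ℕ} (φ : OrdMap n m) : permPull φ 1 = 1 :=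
  (perm_unique (σ := 1) φ 1 (fun _ => rfl) (fun _ _ hxy _ => hxy)).2

theorem perm_mul_aux {n m : ℕ} (σ τ : Equiv.Perm (Fin m)) (φ : OrdMap n m) :
    permPush (σ * τ) φ = permPush σ (permPush τ φ) ∧
      permPull φ (σ * τ) = permPull (permPush τ φ) σ * permPull φ τ := by
  refine perm_unique _ _ (fun x => ?_) (fun x y hxy h => ?_)
  · simp [permPush_permPull]
  · rw [Equiv.Perm.mul_apply, Equiv.Perm.mul_apply]
    refine permPull_lt _ _ (permPull_lt _ _ hxy h) ?_
    rw [permPush_permPull, permPush_permPull, h]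

theorem permPush_mul {n m : ℕ} (σ τ : Equiv.Perm (Fin m)) (φ : OrdMap n m) :
    permPush (σ * τ) φ = permPush σ (permPush τ φ) := (perm_mul_aux σ τ φ).1

theorem permPull_mul {n m : ℕ} (σ τ : Equiv.Perm (Fin m)) (φ : OrdMap n m) :
    permPull φ (σ * τ) = permPull (permPush τ φ) σ * permPull φ τ := (perm_mul_aux σ τ φ).2

theorem perm_comp_aux {k n m : ℕ} (σ : Equiv.Perm (Fin m)) (φ : OrdMap n m) (ψ : OrdMap k n) :
    permPush σ (φ.comp ψ) = (permPush σ φ).comp (permPush (permPull φ σ) ψ) ∧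
      permPull (φ.comp ψ) σ = permPull ψ (permPull φ σ) := by
  refine perm_unique _ _ (fun x => ?_) (fun x y hxy h => ?_)
  · simp [permPush_permPull]
  · rw [permPull_lt_iff, permPull_lt_iff]
    rcases (ψ.monotone hxy.le).lt_or_eq with h1 | h1
    · exact Or.inl (Or.inr ⟨h, h1⟩)
    · exact Or.inr ⟨h1, hxy⟩

theorem permPush_comp {k n m : ℕ} (σ : Equiv.Perm (Fin m)) (φ : OrdMap n m) (ψ : OrdMap k n) :
    permPush σ (φ.comp ψ) = (permPush σ φ).comp (permPush (permPull φ σ) ψ) :=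
  (perm_comp_aux σ φ ψ).1

theorem permPull_comp {k n m : ℕ} (σ : Equiv.Perm (Fin m)) (φ : OrdMap n m) (ψ : OrdMap k n) :
    permPull (φ.comp ψ) σ = permPull ψ (permPull φ σ) := (perm_comp_aux σ φ ψ).2

theorem perm_sum_aux {a b c d : ℕ} (σ : Equiv.Perm (Fin c)) (τ : Equiv.Perm (Fin d))
    (φ : OrdMap a c) (ψ : OrdMap b d) :
    permPush (permSum σ τ) (φ.sum ψ) = (permPush σ φ).sum (permPush τ ψ) ∧
      permPull (φ.sum ψ) (permSum σ τ) = permSum (permPull φ σ) (permPull ψ τ) := by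
  refine perm_unique _ _ (fun x => ?_) (fun x y hxy h => ?_)
  · induction x using Fin.addCases <;> simp [permPush_permPull]
  · induction x using Fin.addCases <;> induction y using Fin.addCases
    · rename_i i j
      rw [permSum_castAdd, permSum_castAdd]
      rw [OrdMap.sum_castAdd, OrdMap.sum_castAdd] at h
      exact permPull_lt σ φ (x := i) (y := j) hxy (Fin.castAdd_injective _ _ h)
    · rename_i i j
      have := congrArg Fin.val h
      rw [OrdMap.sum_castAdd, OrdMap.sum_natAdd, Fin.val_castAdd, Fin.val_natAdd] at this
      have := (φ i).isLt
      omega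
    · rename_i i j
      have := congrArg Fin.val h
      rw [OrdMap.sum_castAdd, OrdMap.sum_natAdd, Fin.val_castAdd, Fin.val_natAdd] at this
      have := (φ j).isLt
      omega
    · rename_i i j
      rw [permSum_natAdd, permSum_natAdd]
      rw [OrdMap.sum_natAdd, OrdMap.sum_natAdd] at h
      have := permPull_lt τ ψ (x := i) (y := j) (Nat.lt_of_add_lt_add_left hxy)
        (Fin.natAdd_injective _ _ h)
      exact Nat.add_lt_add_left this a

theorem permPush_sum {a b c d : ℕ} (σ : Equiv.Perm (Fin c)) (τ : Equiv.Perm (Fin d))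
    (φ : OrdMap a c) (ψ : OrdMap b d) :
    permPush (permSum σ τ) (φ.sum ψ) = (permPush σ φ).sum (permPush τ ψ) :=
  (perm_sum_aux σ τ φ ψ).1

theorem permPull_sum {a b c d : ℕ} (σ : Equiv.Perm (Fin c)) (τ : Equiv.Perm (Fin d))
    (φ : OrdMap a c) (ψ : OrdMap b d) :
    permPull (φ.sum ψ) (permSum σ τ) = permSum (permPull φ σ) (permPull ψ τ) :=
  (perm_sum_aux σ τ φ ψ).2

theorem perm_cast_aux {n m : ℕ} (h : n = m) (σ : Equiv.Perm (Fin m)) :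
    permPush σ (OrdMap.cast h) = OrdMap.cast h ∧
      ∀ x, permPull (OrdMap.cast h) σ x = Fin.cast h.symm (σ (Fin.cast h x)) := by
  subst h
  have := perm_unique (σ := σ) (φ := OrdMap.cast rfl) (OrdMap.cast rfl) σ (fun _ => rfl)
    (fun _ _ hxy h => absurd h hxy.ne)
  refine ⟨this.1, fun x => ?_⟩
  rw [this.2]
  rfl

theorem permPush_cast {n m : ℕ} (h : n = m) (σ : Equiv.Perm (Fin m)) :
    permPush σ (OrdMap.cast h) = OrdMap.cast h := (perm_cast_aux h σ).1

@[simp] theorem permPull_cast_apply {n m : ℕ} (h : n = m) (σ : Equiv.Perm (Fin m)) (x : Fin n) :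
    permPull (OrdMap.cast h) σ x = Fin.cast h.symm (σ (Fin.cast h x)) := (perm_cast_aux h σ).2 x

theorem perm_swap_aux {a b c d : ℕ} (φ : OrdMap a c) (ψ : OrdMap b d) :
    permPush (permSwap c d) (φ.sum ψ) =
      (OrdMap.cast (Nat.add_comm d c)).comp
        ((ψ.sum φ).comp (OrdMap.cast (Nat.add_comm a b))) ∧
      permPull (φ.sum ψ) (permSwap c d) = permSwap a b := by
  refine perm_unique _ _ (fun x => ?_) (fun x y hxy h => ?_)
  · induction x using Fin.addCases with
    | left i =>
      have h1 : OrdMap.cast (Nat.add_comm a b) (permSwap a b (Fin.castAdd b i)) =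
          Fin.natAdd b i := Fin.ext (by simp)
      ext
      simp [h1]
    | right j =>
      have h1 : OrdMap.cast (Nat.add_comm a b) (permSwap a b (Fin.natAdd a j)) =
          Fin.castAdd a j := Fin.ext (by simp)
      ext
      simp [h1]
  · induction x using Fin.addCases <;> induction y using Fin.addCases
    · rename_i i j
      rw [Fin.lt_def, val_permSwap_castAdd, val_permSwap_castAdd]
      exact Nat.add_lt_add_left hxy b
    · rename_i i j
      have := congrArg Fin.val h
      rw [OrdMap.sum_castAdd, OrdMap.sum_natAdd, Fin.val_castAdd, Fin.val_natAdd] at this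
      have := (φ i).isLt
      omega
    · rename_i i j
      have := congrArg Fin.val h
      rw [OrdMap.sum_castAdd, OrdMap.sum_natAdd, Fin.val_castAdd, Fin.val_natAdd] at this
      have := (φ j).isLt
      omega
    · rename_i i j
      rw [Fin.lt_def, val_permSwap_natAdd, val_permSwap_natAdd]
      exact Nat.lt_of_add_lt_add_left hxy

theorem permSwap_mul_permSum {a b : ℕ} (σ : Equiv.Perm (Fin a)) (τ : Equiv.Perm (Fin b)) :
    permSwap a b * permSum σ τ =
      permPull (OrdMap.cast (Nat.add_comm a b)) (permSum τ σ) * permSwap a b := by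
  ext x
  induction x using Fin.addCases with
  | left i =>
    have h1 : Fin.cast (Nat.add_comm a b) (permSwap a b (Fin.castAdd b i)) =
        Fin.natAdd b i := Fin.ext (by simp)
    simp [h1, Nat.add_comm]
  | right j =>
    have h1 : Fin.cast (Nat.add_comm a b) (permSwap a b (Fin.natAdd a j)) =
        Fin.castAdd a j := Fin.ext (by simp)
    simp [h1]

theorem permSum_mul {a b : ℕ} (σ σ' : Equiv.Perm (Fin a)) (τ τ' : Equiv.Perm (Fin b)) :
    permSum (σ * σ') (τ * τ') = permSum σ τ * permSum σ' τ' := by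
  ext x
  induction x using Fin.addCases <;> simp

theorem permSum_assoc {a b c : ℕ} (σ : Equiv.Perm (Fin a)) (τ : Equiv.Perm (Fin b))
    (ρ : Equiv.Perm (Fin c)) :
    permPull (OrdMap.cast (Nat.add_assoc a b c)) (permSum σ (permSum τ ρ)) =
      permSum (permSum σ τ) ρ := by
  ext x
  induction x using Fin.addCases with
  | left x =>
    induction x using Fin.addCases with
    | left i =>
      have h1 : Fin.cast (Nat.add_assoc a b c) (Fin.castAdd c (Fin.castAdd b i)) =
        Fin.castAdd (b + c) i := rfl
      simp [h1]
    | right i =>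
      have h1 : Fin.cast (Nat.add_assoc a b c) (Fin.castAdd c (Fin.natAdd a i)) =
        Fin.natAdd a (Fin.castAdd c i) := rfl
      simp [h1]
  | right i =>
    have h1 : Fin.cast (Nat.add_assoc a b c) (Fin.natAdd (a + b) i) =
      Fin.natAdd a (Fin.natAdd b i) := Fin.ext (by simp [Nat.add_assoc])
    simp [h1, Nat.add_assoc]

theorem permSum_zero_left {n : ℕ} (σ : Equiv.Perm (Fin n)) :
    permSum (1 : Equiv.Perm (Fin 0)) σ = permPull (OrdMap.cast (Nat.zero_add n)) σ := by
  ext x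
  induction x using Fin.addCases with
  | left i => exact i.elim0
  | right i =>
    have h1 : Fin.cast (Nat.zero_add n) (Fin.natAdd 0 i) = i := Fin.ext (by simp)
    rw [permSum_natAdd, permPull_cast_apply, h1]
    simp

theorem permSum_zero_right {n : ℕ} (σ : Equiv.Perm (Fin n)) :
    permSum σ (1 : Equiv.Perm (Fin 0)) = permPull (OrdMap.cast (Nat.add_zero n)) σ := by
  ext x
  induction x using Fin.addCases with
  | left i =>
    have h1 : Fin.cast (Nat.add_zero n) (Fin.castAdd 0 i) = i := rfl
    rw [permSum_castAdd, permPull_cast_apply, h1]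
    rfl
  | right i => exact i.elim0

theorem permSwap_hexagon_forward (a b c : ℕ) :
    permPull (OrdMap.cast (Nat.add_assoc a b c)) (permSwap a (b + c)) =
      permPull (OrdMap.cast (by omega : a + b + c = b + (a + c)))
        (permSum (1 : Equiv.Perm (Fin b)) (permSwap a c)) *
      permSum (permSwap a b) (1 : Equiv.Perm (Fin c)) := by
  ext x
  induction x using Fin.addCases with
  | left x =>
    induction x using Fin.addCases with
    | left i =>
      have h1 : Fin.cast (Nat.add_assoc a b c) (Fin.castAdd c (Fin.castAdd b i)) =
        Fin.castAdd (b + c) i := rfl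
      have h2 : Fin.cast (by omega : a + b + c = b + (a + c))
        (Fin.castAdd c (permSwap a b (Fin.castAdd b i))) = Fin.natAdd b (Fin.castAdd c i) :=
        Fin.ext (by simp)
      simp [h1, h2, Nat.add_assoc]
    | right i =>
      have h1 : Fin.cast (Nat.add_assoc a b c) (Fin.castAdd c (Fin.natAdd a i)) =
        Fin.natAdd a (Fin.castAdd c i) := rfl
      have h2 : Fin.cast (by omega : a + b + c = b + (a + c))
        (Fin.castAdd c (permSwap a b (Fin.natAdd a i))) = Fin.castAdd (a + c) i :=
        Fin.ext (by simp)
      simp [h1, h2]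
  | right i =>
    have h1 : Fin.cast (Nat.add_assoc a b c) (Fin.natAdd (a + b) i) =
      Fin.natAdd a (Fin.natAdd b i) := Fin.ext (by simp [Nat.add_assoc])
    have h2 : Fin.cast (by omega : a + b + c = b + (a + c)) (Fin.natAdd (a + b) i) =
      Fin.natAdd b (Fin.natAdd a i) := Fin.ext (by simp; omega)
    simp [h1, h2]

theorem permSwap_hexagon_reverse (a b c : ℕ) :
    permSwap (a + b) c =
      permPull (OrdMap.cast (by omega : a + b + c = a + c + b))
        (permSum (permSwap a c) (1 : Equiv.Perm (Fin b))) *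
      permPull (OrdMap.cast (Nat.add_assoc a b c))
        (permSum (1 : Equiv.Perm (Fin a)) (permSwap b c)) := by
  ext x
  induction x using Fin.addCases with
  | left x =>
    induction x using Fin.addCases with
    | left i =>
      have h1 : Fin.cast (Nat.add_assoc a b c) (Fin.castAdd c (Fin.castAdd b i)) =
        Fin.castAdd (b + c) i := rfl
      have h2 : Fin.cast (by omega : a + b + c = a + c + b)
        (Fin.cast (Nat.add_assoc a b c).symm (Fin.castAdd (b + c) i)) =
        Fin.castAdd b (Fin.castAdd c i) := rfl
      simp only [Equiv.Perm.mul_apply, permPull_cast_apply, h1, permSum_castAdd,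
        Equiv.Perm.one_apply, h2, val_permSwap_castAdd, Fin.val_castAdd, Fin.val_cast]
    | right i =>
      have h1 : Fin.cast (Nat.add_assoc a b c) (Fin.castAdd c (Fin.natAdd a i)) =
        Fin.natAdd a (Fin.castAdd c i) := rfl
      have h2 : Fin.cast (by omega : a + b + c = a + c + b)
        (Fin.cast (Nat.add_assoc a b c).symm
          (Fin.natAdd a (permSwap b c (Fin.castAdd c i)))) =
        Fin.natAdd (a + c) i := Fin.ext (by simp [Nat.add_assoc])
      simp only [Equiv.Perm.mul_apply, permPull_cast_apply, h1, permSum_natAdd,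
        Equiv.Perm.one_apply, h2, val_permSwap_castAdd, Fin.val_natAdd, Fin.val_cast]
      omega
  | right i =>
    have h1 : Fin.cast (Nat.add_assoc a b c) (Fin.natAdd (a + b) i) =
      Fin.natAdd a (Fin.natAdd b i) := Fin.ext (by simp [Nat.add_assoc])
    have h2 : Fin.cast (by omega : a + b + c = a + c + b)
        (Fin.cast (Nat.add_assoc a b c).symm
          (Fin.natAdd a (permSwap b c (Fin.natAdd b i)))) =
        Fin.castAdd b (Fin.natAdd a i) := Fin.ext (by simp)
    simp only [Equiv.Perm.mul_apply, permPull_cast_apply, h1, permSum_natAdd, permSum_castAdd,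
        h2, val_permSwap_natAdd, Fin.val_castAdd, Fin.val_cast]

theorem permSwap_symm (a b : ℕ) :
    permPull (OrdMap.cast (Nat.add_comm a b)) (permSwap b a) * permSwap a b = 1 := by
  ext x
  induction x using Fin.addCases with
  | left i =>
    have h1 : Fin.cast (Nat.add_comm a b) (permSwap a b (Fin.castAdd b i)) =
        Fin.natAdd b i := Fin.ext (by simp)
    simp [h1]
  | right j =>
    have h1 : Fin.cast (Nat.add_comm a b) (permSwap a b (Fin.natAdd a j)) =
        Fin.castAdd a j := Fin.ext (by simp)
    simp [h1]

universe w v u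

/-- A family of groups `J n` over the symmetric groups with a distributive law over `𝔻`, a
juxtaposition and block crossings. An element `j : J m` and an order-preserving map
`φ : OrdMap n m` give the pair `(j_⋆(φ), φ^⋆(j))`, where `φ^⋆(j) = pull φ j` and
`j_⋆(φ) = permPush (perm m j) φ` depends on the underlying permutation of `j` only; the laws below
say that this is a distributive law (that is, a crossed simplicial group), compatible with the
monoidal structure and with the braiding. The two instances used below are the symmetric groups and
the braid groups. -/
structure CrossedGroups where
  /-- the groups -/
  J : ℕ → Type u
  /-- the group structures -/
  [group : ∀ n, Group (J n)]
  /-- the underlying permutation -/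
  perm : ∀ n, J n →* Equiv.Perm (Fin n)
  /-- the map `φ^⋆` -/
  pull : ∀ {n m : ℕ}, OrdMap n m → J m → J n
  /-- juxtaposition -/
  sum : ∀ {a b : ℕ}, J a → J b → J (a + b)
  /-- the crossing of a block of `a` strands with a block of `b` strands -/
  swap : ∀ a b : ℕ, J (a + b)
  perm_pull : ∀ {n m : ℕ} (φ : OrdMap n m) (j : J m), perm n (pull φ j) = permPull φ (perm m j)
  pull_id : ∀ {n : ℕ} (j : J n), pull OrderHom.id j = j
  pull_comp : ∀ {k n m : ℕ} (φ : OrdMap n m) (ψ : OrdMap k n) (j : J m),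
    pull (φ.comp ψ) j = pull ψ (pull φ j)
  pull_mul : ∀ {n m : ℕ} (φ : OrdMap n m) (i j : J m),
    pull φ (i * j) = pull (permPush (perm m j) φ) i * pull φ j
  perm_sum : ∀ {a b : ℕ} (i : J a) (j : J b),
    perm (a + b) (sum i j) = permSum (perm a i) (perm b j)
  sum_mul : ∀ {a b : ℕ} (i i' : J a) (j j' : J b), sum (i * i') (j * j') = sum i j * sum i' j'
  pull_sum : ∀ {a b c d : ℕ} (φ : OrdMap a c) (ψ : OrdMap b d) (i : J c) (j : J d),
    pull (φ.sum ψ) (sum i j) = sum (pull φ i) (pull ψ j)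
  sum_assoc : ∀ {a b c : ℕ} (i : J a) (j : J b) (k : J c),
    pull (OrdMap.cast (Nat.add_assoc a b c)) (sum i (sum j k)) = sum (sum i j) k
  sum_zero_left : ∀ {n : ℕ} (j : J n),
    sum (1 : J 0) j = pull (OrdMap.cast (Nat.zero_add n)) j
  sum_zero_right : ∀ {n : ℕ} (j : J n),
    sum j (1 : J 0) = pull (OrdMap.cast (Nat.add_zero n)) j
  perm_swap : ∀ a b : ℕ, perm (a + b) (swap a b) = permSwap a b
  pull_swap : ∀ {a b c d : ℕ} (φ : OrdMap a c) (ψ : OrdMap b d),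
    pull (φ.sum ψ) (swap c d) = swap a b
  swap_mul_sum : ∀ {a b : ℕ} (i : J a) (j : J b),
    swap a b * sum i j = pull (OrdMap.cast (Nat.add_comm a b)) (sum j i) * swap a b
  swap_hexagon_forward : ∀ a b c : ℕ,
    pull (OrdMap.cast (Nat.add_assoc a b c)) (swap a (b + c)) =
      pull (OrdMap.cast (by omega : a + b + c = b + (a + c))) (sum (1 : J b) (swap a c)) *
      sum (swap a b) (1 : J c)
  swap_hexagon_reverse : ∀ a b c : ℕ,
    swap (a + b) c =
      pull (OrdMap.cast (by omega : a + b + c = a + c + b)) (sum (swap a c) (1 : J b)) *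
      pull (OrdMap.cast (Nat.add_assoc a b c)) (sum (1 : J a) (swap b c))

attribute [instance] CrossedGroups.group

namespace CrossedGroups

variable (K : CrossedGroups.{u})

theorem pull_one {n m : ℕ} (φ : OrdMap n m) : K.pull φ (1 : K.J m) = 1 := by
  have h := K.pull_mul φ 1 1
  rw [mul_one, map_one, permPush_one] at h
  exact left_eq_mul.1 h

theorem sum_one {a b : ℕ} : K.sum (1 : K.J a) (1 : K.J b) = 1 := by
  have h := K.sum_mul (1 : K.J a) 1 (1 : K.J b) 1
  rw [mul_one, mul_one] at h
  exact left_eq_mul.1 h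

/-- The set of objects `n` of the category `𝔻 ⊗ 𝕁`. -/
@[ext]
structure Obj (K : CrossedGroups.{u}) where
  /-- the natural number `n` -/
  n : ℕ

/-- A morphism `n ⟶ m` of `𝔻 ⊗ 𝕁`: a pair `(φ, j)` of an order-preserving map from `n` to `m` and an
element of `J n`. It is thought of as `φ ∘ j`. -/
@[ext]
structure Hom (X Y : K.Obj) where
  /-- the order-preserving map -/
  map : OrdMap X.n Y.n
  /-- the group element -/
  elt : K.J X.n

/-- The category `𝔻 ⊗ 𝕁`. The composite `(φ, i) ∘ (ψ, j)` is `(φ ∘ i_⋆(ψ), ψ^⋆(i) j)`. -/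
instance : Category K.Obj where
  Hom := K.Hom
  id X := ⟨OrderHom.id, 1⟩
  comp f g := ⟨g.map.comp (permPush (K.perm _ g.elt) f.map), K.pull f.map g.elt * f.elt⟩
  id_comp f := by
    refine Hom.ext ?_ ?_
    · have h := permPush_cast (rfl : _ = _) (K.perm _ f.elt)
      exact congrArg (fun ψ => f.map.comp ψ) h
    · change K.pull _ _ * 1 = _
      rw [mul_one, K.pull_id]
  comp_id f := by
    refine Hom.ext ?_ ?_
    · change OrderHom.id.comp (permPush (K.perm _ 1) f.map) = _
      rw [map_one, permPush_one]
      rfl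
    · change K.pull _ 1 * _ = _
      rw [K.pull_one, one_mul]
  assoc f g h := by
    refine Hom.ext ?_ ?_
    · change h.map.comp (permPush (K.perm _ h.elt) (g.map.comp (permPush (K.perm _ g.elt) f.map)))
        = (h.map.comp (permPush (K.perm _ h.elt) g.map)).comp
          (permPush (K.perm _ (K.pull g.map h.elt * g.elt)) f.map)
      rw [permPush_comp, map_mul, permPush_mul, K.perm_pull]
      rfl
    · change K.pull (g.map.comp (permPush (K.perm _ g.elt) f.map)) h.elt *
        (K.pull f.map g.elt * f.elt) = K.pull f.map (K.pull g.map h.elt * g.elt) * f.elt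
      rw [K.pull_mul, K.pull_comp, mul_assoc]

variable {K}

theorem hom_ext {X Y : K.Obj} {f g : X ⟶ Y} (h₁ : f.map = g.map) (h₂ : f.elt = g.elt) : f = g :=
  Hom.ext h₁ h₂

@[simp] theorem id_map (X : K.Obj) : Hom.map (𝟙 X) = OrderHom.id := rfl

@[simp] theorem id_elt (X : K.Obj) : Hom.elt (𝟙 X) = 1 := rfl

@[simp] theorem comp_map {X Y Z : K.Obj} (f : X ⟶ Y) (g : Y ⟶ Z) :
    (f ≫ g).map = g.map.comp (permPush (K.perm _ g.elt) f.map) := rfl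

@[simp] theorem comp_elt {X Y Z : K.Obj} (f : X ⟶ Y) (g : Y ⟶ Z) :
    (f ≫ g).elt = K.pull f.map g.elt * f.elt := rfl

@[simp] theorem eqToHom_map {X Y : K.Obj} (h : X = Y) :
    Hom.map (eqToHom h) = OrdMap.cast (congrArg Obj.n h) := by
  subst h
  rfl

@[simp] theorem eqToHom_elt {X Y : K.Obj} (h : X = Y) : Hom.elt (eqToHom h) = 1 := by
  subst h
  rfl

/-- An element `j` of `J n` as an automorphism of the object `n`. -/
@[simps]
def autIso (n : ℕ) (j : K.J n) : (⟨n⟩ : K.Obj) ≅ ⟨n⟩ where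
  hom := ⟨OrderHom.id, j⟩
  inv := ⟨OrderHom.id, j⁻¹⟩
  hom_inv_id := by
    refine hom_ext ?_ ?_
    · exact permPush_cast (rfl : n = n) _
    · change K.pull _ _ * _ = 1
      rw [K.pull_id, inv_mul_cancel]
  inv_hom_id := by
    refine hom_ext ?_ ?_
    · exact permPush_cast (rfl : n = n) _
    · change K.pull _ _ * _ = 1
      rw [K.pull_id, mul_inv_cancel]

theorem permPush_id {n : ℕ} (σ : Equiv.Perm (Fin n)) :
    permPush σ (OrderHom.id : OrdMap n n) = OrderHom.id :=
  permPush_cast (rfl : n = n) σ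

theorem sum_id (a b : ℕ) : OrdMap.sum (OrderHom.id : OrdMap a a) (OrderHom.id : OrdMap b b) =
    OrderHom.id := by
  ext x
  induction x using Fin.addCases <;> simp

theorem sum_comp {a b c a' b' c' : ℕ} (φ : OrdMap b c) (ψ : OrdMap a b) (φ' : OrdMap b' c')
    (ψ' : OrdMap a' b') : OrdMap.sum (φ.comp ψ) (φ'.comp ψ') = (φ.sum φ').comp (ψ.sum ψ') := by
  ext x
  induction x using Fin.addCases <;> simp

/-- The data of the strict monoidal structure of `𝔻 ⊗ 𝕁`. -/
instance : MonoidalCategoryStruct K.Obj where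
  tensorObj X Y := ⟨X.n + Y.n⟩
  tensorUnit := ⟨0⟩
  tensorHom f g := ⟨f.map.sum g.map, K.sum f.elt g.elt⟩
  whiskerLeft X _ _ g := ⟨OrdMap.sum (OrderHom.id : OrdMap X.n X.n) g.map, K.sum 1 g.elt⟩
  whiskerRight f Y := ⟨f.map.sum (OrderHom.id : OrdMap Y.n Y.n), K.sum f.elt 1⟩
  associator X Y Z := eqToIso (Obj.ext (Nat.add_assoc X.n Y.n Z.n))
  leftUnitor X := eqToIso (Obj.ext (Nat.zero_add X.n))
  rightUnitor X := eqToIso (Obj.ext (Nat.add_zero X.n))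

@[simp] theorem tensorObj_n (X Y : K.Obj) : (X ⊗ Y).n = X.n + Y.n := rfl

@[simp] theorem tensorHom_map {X Y X' Y' : K.Obj} (f : X ⟶ Y) (g : X' ⟶ Y') :
    Hom.map (f ⊗ₘ g) = f.map.sum g.map := rfl

@[simp] theorem tensorHom_elt {X Y X' Y' : K.Obj} (f : X ⟶ Y) (g : X' ⟶ Y') :
    Hom.elt (f ⊗ₘ g) = K.sum f.elt g.elt := rfl

theorem associator_eq (X Y Z : K.Obj) :
    α_ X Y Z = eqToIso (Obj.ext (Nat.add_assoc X.n Y.n Z.n)) := rfl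

theorem leftUnitor_eq (X : K.Obj) : λ_ X = eqToIso (Obj.ext (Nat.zero_add X.n)) := rfl

theorem rightUnitor_eq (X : K.Obj) : ρ_ X = eqToIso (Obj.ext (Nat.add_zero X.n)) := rfl

theorem tensorHom_id_id (X Y : K.Obj) : (𝟙 X ⊗ₘ 𝟙 Y) = 𝟙 (X ⊗ Y) :=
  hom_ext (sum_id _ _) K.sum_one

theorem eqToHom_tensor_id {X Y : K.Obj} (h : X = Y) (Z : K.Obj) (h' : X ⊗ Z = Y ⊗ Z) :
    (eqToHom h ⊗ₘ 𝟙 Z) = eqToHom h' := by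
  subst h
  exact tensorHom_id_id _ _

theorem id_tensor_eqToHom {X Y : K.Obj} (h : X = Y) (Z : K.Obj) (h' : Z ⊗ X = Z ⊗ Y) :
    (𝟙 Z ⊗ₘ eqToHom h) = eqToHom h' := by
  subst h
  exact tensorHom_id_id _ _

/-- An equality of morphisms up to equalities of objects, from its components. -/
theorem comp_eqToHom_eq {X Y X' Y' : K.Obj} (f : X ⟶ Y) (g : X' ⟶ Y') (hX : X = X') (hY : Y = Y')
    (hmap : ∀ x, (f.map x : ℕ) = g.map (OrdMap.cast (congrArg Obj.n hX) x))
    (helt : K.pull (OrdMap.cast (congrArg Obj.n hX)) g.elt = f.elt) :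
    f ≫ eqToHom hY = eqToHom hX ≫ g := by
  subst hX hY
  rw [eqToHom_refl, eqToHom_refl, Category.comp_id, Category.id_comp]
  refine hom_ext ?_ ?_
  · ext x
    exact hmap x
  · rw [← helt]
    exact K.pull_id _

instance : MonoidalCategory K.Obj :=
  MonoidalCategory.ofTensorHom
    (id_tensorHom_id := tensorHom_id_id)
    (id_tensorHom := fun _ _ _ _ => rfl)
    (tensorHom_id := fun _ _ => rfl)
    (tensorHom_comp_tensorHom := fun f₁ f₂ g₁ g₂ => by
      refine hom_ext ?_ ?_
      · simp only [comp_map, tensorHom_map, tensorHom_elt]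
        rw [sum_comp, ← permPush_sum, ← K.perm_sum]
        rfl
      · simp only [comp_elt, tensorHom_map, tensorHom_elt]
        rw [K.sum_mul, ← K.pull_sum])
    (associator_naturality := fun {X₁ X₂ X₃ Y₁ Y₂ Y₃} f₁ f₂ f₃ => by
      refine comp_eqToHom_eq _ _ (Obj.ext (Nat.add_assoc _ _ _)) (Obj.ext (Nat.add_assoc _ _ _)) (fun x => ?_) (K.sum_assoc _ _ _)
      change Fin (X₁.n + X₂.n + X₃.n) at x
      induction x using Fin.addCases with
      | left x =>
        induction x using Fin.addCases with
        | left i =>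
          have h1 : OrdMap.cast (Nat.add_assoc _ _ _) (Fin.castAdd X₃.n (Fin.castAdd X₂.n i)) =
            Fin.castAdd (X₂.n + X₃.n) i := rfl
          erw [h1]
          simp
        | right i =>
          have h1 : OrdMap.cast (Nat.add_assoc _ _ _) (Fin.castAdd X₃.n (Fin.natAdd X₁.n i)) =
            Fin.natAdd X₁.n (Fin.castAdd X₃.n i) := rfl
          erw [h1]
          simp
      | right i =>
        have h1 : OrdMap.cast (Nat.add_assoc _ _ _) (Fin.natAdd (X₁.n + X₂.n) i) =
          Fin.natAdd X₁.n (Fin.natAdd X₂.n i) := Fin.ext (by simp [Nat.add_assoc])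
        erw [h1]
        simp [Nat.add_assoc])
    (leftUnitor_naturality := fun {X Y} f => by
      refine comp_eqToHom_eq _ _ (Obj.ext (Nat.zero_add _)) (Obj.ext (Nat.zero_add _)) (fun x => ?_) (K.sum_zero_left _).symm
      change Fin (0 + X.n) at x
      induction x using Fin.addCases with
      | left i => exact i.elim0
      | right i =>
        have h1 : OrdMap.cast (Nat.zero_add X.n) (Fin.natAdd 0 i) = i := Fin.ext (by simp)
        erw [h1, OrdMap.sum_natAdd]
        exact Nat.zero_add _)
    (rightUnitor_naturality := fun {X Y} f => by
      refine comp_eqToHom_eq _ _ (Obj.ext (Nat.add_zero _)) (Obj.ext (Nat.add_zero _)) (fun x => ?_) (K.sum_zero_right _).symm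
      change Fin (X.n + 0) at x
      induction x using Fin.addCases with
      | left i =>
        have h1 : OrdMap.cast (Nat.add_zero X.n) (Fin.castAdd 0 i) = i := rfl
        erw [h1, OrdMap.sum_castAdd]
        rfl
      | right i => exact i.elim0)
    (pentagon := fun W X Y Z => by
      simp only [associator_eq, eqToIso.hom]
      rw [eqToHom_tensor_id _ _ (by simp only [MonoidalCategoryStruct.tensorObj, Nat.add_assoc]),
        id_tensor_eqToHom _ _ (by simp only [MonoidalCategoryStruct.tensorObj, Nat.add_assoc])]
      simp only [eqToHom_trans])
    (triangle := fun X Y => by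
      simp only [associator_eq, leftUnitor_eq, rightUnitor_eq, eqToIso.hom]
      rw [eqToHom_tensor_id _ _ (by simp [MonoidalCategoryStruct.tensorObj]; rfl),
        id_tensor_eqToHom _ _ (by simp [MonoidalCategoryStruct.tensorObj]; rfl)]
      simp only [eqToHom_trans])

/-- The map of a morphism does not change the values. -/
def IsCast {n m : ℕ} (φ : OrdMap n m) : Prop := ∀ x, (φ x : ℕ) = x

theorem IsCast.eq {n m : ℕ} {φ ψ : OrdMap n m} (hφ : IsCast φ) (hψ : IsCast ψ) : φ = ψ := by
  ext x
  rw [hφ, hψ]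

theorem isCast_cast {n m : ℕ} (h : n = m) : IsCast (OrdMap.cast h) := fun _ => rfl

theorem IsCast.comp {k n m : ℕ} {φ : OrdMap n m} {ψ : OrdMap k n} (hφ : IsCast φ)
    (hψ : IsCast ψ) : IsCast (φ.comp ψ) := fun x => (hφ _).trans (hψ x)

theorem IsCast.sum {a b c d : ℕ} {φ : OrdMap a c} {ψ : OrdMap b d} (h : a = c) (hφ : IsCast φ)
    (hψ : IsCast ψ) : IsCast (φ.sum ψ) := by
  subst h
  intro x
  induction x using Fin.addCases <;> simp [hφ _, hψ _]

theorem IsCast.hcomp {X Y Z : K.Obj} {f : X ⟶ Y} {g : Y ⟶ Z} (h : X.n = Y.n) (hf : IsCast f.map)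
    (hg : IsCast g.map) : IsCast (f ≫ g).map := by
  refine hg.comp ?_
  rw [hf.eq (isCast_cast h), permPush_cast]
  exact isCast_cast h

theorem isCast_eqToHom {X Y : K.Obj} (h : X = Y) : IsCast (Hom.map (eqToHom h)) := by
  rw [eqToHom_map]
  exact isCast_cast _

/-- The braiding of `𝔻 ⊗ 𝕁`. -/
def braidingIso (X Y : K.Obj) : X ⊗ Y ≅ Y ⊗ X :=
  autIso (X.n + Y.n) (K.swap X.n Y.n) ≪≫ eqToIso (Obj.ext (Nat.add_comm X.n Y.n))

theorem braidingIso_map (X Y : K.Obj) :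
    (braidingIso X Y).hom.map = OrdMap.cast (Nat.add_comm X.n Y.n) :=
  IsCast.eq (IsCast.hcomp rfl (isCast_cast rfl)
    (isCast_eqToHom (Obj.ext (Nat.add_comm X.n Y.n)))) (isCast_cast _)

theorem braidingIso_elt (X Y : K.Obj) : (braidingIso X Y).hom.elt = K.swap X.n Y.n := by
  refine (comp_elt _ _).trans ?_
  rw [eqToIso.hom, eqToHom_elt, K.pull_one, one_mul]
  rfl

theorem braidingIso_naturality {X Y X' Y' : K.Obj} (f : X ⟶ Y) (g : X' ⟶ Y') :
    (f ⊗ₘ g) ≫ (braidingIso Y Y').hom = (braidingIso X X').hom ≫ (g ⊗ₘ f) := by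
  refine hom_ext ?_ ?_
  · rw [comp_map, comp_map, braidingIso_map, braidingIso_map, braidingIso_elt]
    have h1 : permPush (K.perm _ (K.swap Y.n Y'.n)) (f.map.sum g.map) =
        (OrdMap.cast (Nat.add_comm Y'.n Y.n)).comp
        ((g.map.sum f.map).comp (OrdMap.cast (Nat.add_comm X.n X'.n))) := by
      rw [K.perm_swap]
      exact (perm_swap_aux f.map g.map).1
    have h2 := permPush_cast (Nat.add_comm X.n X'.n) (K.perm _ (K.sum g.elt f.elt))
    exact (congrArg (fun t => (OrdMap.cast (Nat.add_comm Y.n Y'.n)).comp t) h1).trans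
      (congrArg (fun t => (g.map.sum f.map).comp t) h2).symm
  · rw [comp_elt, comp_elt, braidingIso_map, braidingIso_elt, braidingIso_elt, tensorHom_map,
      tensorHom_elt, tensorHom_elt, K.pull_swap, K.swap_mul_sum]

theorem isCast_braidingIso (X Y : K.Obj) : IsCast (braidingIso X Y).hom.map := by
  rw [braidingIso_map]
  exact isCast_cast _

theorem isCast_associator (X Y Z : K.Obj) : IsCast (α_ X Y Z).hom.map :=
  isCast_eqToHom (Obj.ext (Nat.add_assoc _ _ _))

theorem isCast_associator_inv (X Y Z : K.Obj) : IsCast (α_ X Y Z).inv.map :=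
  isCast_eqToHom (Obj.ext (Nat.add_assoc _ _ _).symm)

theorem associator_hom_elt (X Y Z : K.Obj) : (α_ X Y Z).hom.elt = 1 :=
  eqToHom_elt (Obj.ext (Nat.add_assoc _ _ _))

theorem associator_inv_elt (X Y Z : K.Obj) : (α_ X Y Z).inv.elt = 1 :=
  eqToHom_elt (Obj.ext (Nat.add_assoc _ _ _).symm)

theorem isCast_whiskerLeft {X Y Z : K.Obj} (f : X ⟶ Y) (hf : IsCast f.map) :
    IsCast (Z ◁ f).map := IsCast.sum rfl (isCast_cast rfl) hf

theorem isCast_whiskerRight {X Y Z : K.Obj} (f : X ⟶ Y) (h : X.n = Y.n) (hf : IsCast f.map) :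
    IsCast (f ▷ Z).map := IsCast.sum h hf (isCast_cast rfl)

instance : BraidedCategory K.Obj where
  braiding := braidingIso
  braiding_naturality_right X _ _ f := braidingIso_naturality (𝟙 X) f
  braiding_naturality_left f Z := braidingIso_naturality f (𝟙 Z)
  hexagon_forward X Y Z := by
    have h1 := isCast_associator X Y Z
    have h2 := isCast_braidingIso X (Y ⊗ Z)
    have h3 := isCast_associator Y Z X
    have h4 := isCast_whiskerRight (Z := Z) _ (Nat.add_comm _ _) (isCast_braidingIso X Y)
    have h5 := isCast_associator Y X Z
    have h6 := isCast_whiskerLeft (Z := Y) _ (isCast_braidingIso X Z)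
    refine hom_ext ?_ ?_
    · exact IsCast.eq (IsCast.hcomp (Nat.add_assoc _ _ _) h1 (IsCast.hcomp (Nat.add_comm _ _) h2 h3))
        (IsCast.hcomp (congrArg (· + Z.n) (Nat.add_comm X.n Y.n)) h4
          (IsCast.hcomp (Nat.add_assoc _ _ _) h5 h6))
    · simp only [comp_elt, associator_hom_elt, K.pull_one, one_mul, mul_one, braidingIso_elt]
      rw [← K.pull_comp, h1.eq (isCast_cast (Nat.add_assoc X.n Y.n Z.n)),
        (h5.comp h4).eq (isCast_cast (by simp only [tensorObj_n]; omega))]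
      have e1 : ((braidingIso X Y).hom ▷ Z).elt = K.sum (K.swap X.n Y.n) 1 :=
        congrArg (fun t => K.sum t 1) (braidingIso_elt X Y)
      have e2 : (Y ◁ (braidingIso X Z).hom).elt = K.sum 1 (K.swap X.n Z.n) :=
        congrArg (fun t => K.sum 1 t) (braidingIso_elt X Z)
      rw [e1, e2]
      exact K.swap_hexagon_forward _ _ _
  hexagon_reverse X Y Z := by
    have h1 := isCast_associator_inv X Y Z
    have h2 := isCast_braidingIso (X ⊗ Y) Z
    have h3 := isCast_associator_inv Z X Y
    have h4 := isCast_whiskerLeft (Z := X) _ (isCast_braidingIso Y Z)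
    have h5 := isCast_associator_inv X Z Y
    have h6 := isCast_whiskerRight (Z := Y) _ (Nat.add_comm _ _) (isCast_braidingIso X Z)
    refine hom_ext ?_ ?_
    · exact IsCast.eq
        (IsCast.hcomp (Nat.add_assoc _ _ _).symm h1 (IsCast.hcomp (Nat.add_comm _ _) h2 h3))
        (IsCast.hcomp (congrArg (X.n + ·) (Nat.add_comm Y.n Z.n)) h4
          (IsCast.hcomp (Nat.add_assoc _ _ _).symm h5 h6))
    · simp only [comp_elt, associator_inv_elt, K.pull_one, one_mul, mul_one, braidingIso_elt]
      rw [← K.pull_comp, h1.eq (isCast_cast (Nat.add_assoc X.n Y.n Z.n).symm),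
        (h5.comp h4).eq (isCast_cast (by simp only [tensorObj_n]; omega))]
      have e1 : (X ◁ (braidingIso Y Z).hom).elt = K.sum 1 (K.swap Y.n Z.n) :=
        congrArg (fun t => K.sum 1 t) (braidingIso_elt Y Z)
      have e2 : ((braidingIso X Z).hom ▷ Y).elt = K.sum (K.swap X.n Z.n) 1 :=
        congrArg (fun t => K.sum t 1) (braidingIso_elt X Z)
      rw [e1, e2]
      have h := congrArg (K.pull (OrdMap.cast (Nat.add_assoc X.n Y.n Z.n).symm))
        (K.swap_hexagon_reverse X.n Y.n Z.n)
      refine h.trans ?_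
      rw [K.pull_mul, permPush_cast, ← K.pull_comp, ← K.pull_comp]
      congr 1
      exact K.pull_id _

/-- The braiding of `𝔻 ⊗ 𝕁` is a symmetry if the block crossings are involutive. -/
@[reducible]
def symmetricCategory (h : ∀ a b : ℕ,
    K.pull (OrdMap.cast (Nat.add_comm a b)) (K.swap b a) * K.swap a b = 1) :
    SymmetricCategory K.Obj where
  symmetry X Y := by
    refine hom_ext ?_ ?_
    · exact IsCast.eq (IsCast.hcomp (Nat.add_comm _ _) (isCast_braidingIso X Y)
        (isCast_braidingIso Y X)) (isCast_cast rfl)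
    · rw [comp_elt]
      change K.pull (braidingIso X Y).hom.map (braidingIso Y X).hom.elt *
        (braidingIso X Y).hom.elt = 1
      rw [braidingIso_elt, braidingIso_elt, braidingIso_map]
      exact h _ _

/-- The symmetric groups. -/
def symmetricGroups : CrossedGroups.{0} where
  J n := Equiv.Perm (Fin n)
  perm _ := MonoidHom.id _
  pull φ σ := permPull φ σ
  sum σ τ := permSum σ τ
  swap a b := permSwap a b
  perm_pull _ _ := rfl
  pull_id := permPull_id
  pull_comp φ ψ σ := permPull_comp σ φ ψ
  pull_mul φ σ τ := permPull_mul σ τ φ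
  perm_sum _ _ := rfl
  sum_mul := permSum_mul
  pull_sum φ ψ σ τ := permPull_sum σ τ φ ψ
  sum_assoc := permSum_assoc
  sum_zero_left := permSum_zero_left
  sum_zero_right := permSum_zero_right
  perm_swap _ _ := rfl
  pull_swap φ ψ := (perm_swap_aux φ ψ).2
  swap_mul_sum := permSwap_mul_permSum
  swap_hexagon_forward := permSwap_hexagon_forward
  swap_hexagon_reverse := permSwap_hexagon_reverse

end CrossedGroups
theorem permPull_inv {n m : ℕ} (σ : Equiv.Perm (Fin m)) (φ : OrdMap n m) :
    (permPull (permPush σ⁻¹ φ) σ)⁻¹ = permPull φ σ⁻¹ := by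
  rw [inv_eq_iff_mul_eq_one, ← permPull_mul, mul_inv_cancel, permPull_one]

theorem permSum_inv {a b : ℕ} (σ : Equiv.Perm (Fin a)) (τ : Equiv.Perm (Fin b)) :
    (permSum σ τ)⁻¹ = permSum σ⁻¹ τ⁻¹ := by
  rw [inv_eq_iff_mul_eq_one, ← permSum_mul, mul_inv_cancel, mul_inv_cancel]
  ext x
  induction x using Fin.addCases <;> simp

/-- The Artin relations in the free group on `n - 1` generators. -/
def braidRels (n : ℕ) : Set (FreeGroup (Fin (n - 1))) :=
  {r | ∃ i j : Fin (n - 1), (i : ℕ) + 1 < j ∧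
    r = FreeGroup.of i * FreeGroup.of j * (FreeGroup.of j * FreeGroup.of i)⁻¹} ∪
  {r | ∃ i j : Fin (n - 1), (i : ℕ) + 1 = j ∧
    r = FreeGroup.of i * FreeGroup.of j * FreeGroup.of i *
      (FreeGroup.of j * FreeGroup.of i * FreeGroup.of j)⁻¹}

/-- Artin's braid group `B_n` on `n` strands. -/
abbrev BraidGroup (n : ℕ) := PresentedGroup (braidRels n)

namespace BraidGroup

/-- The generator `σ_i`: the strands in the positions `i` and `i + 1` cross. -/
def gen {n : ℕ} (i : ℕ) (h : i + 1 < n) : BraidGroup n :=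
  PresentedGroup.of (⟨i, by omega⟩ : Fin (n - 1))

theorem gen_comm {n i j : ℕ} (hi : i + 1 < n) (hj : j + 1 < n) (h : i + 1 < j) :
    gen i hi * gen j hj = gen j hj * gen i hi :=
  PresentedGroup.mk_eq_mk_of_mul_inv_mem (Or.inl ⟨_, _, h, rfl⟩)

theorem gen_braid {n i : ℕ} (hi : i + 1 < n) (hj : i + 1 + 1 < n) :
    gen i hi * gen (i + 1) hj * gen i hi = gen (i + 1) hj * gen i hi * gen (i + 1) hj :=
  PresentedGroup.mk_eq_mk_of_mul_inv_mem (Or.inr ⟨_, _, rfl, rfl⟩)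

/-- The universal property of the braid group. -/
def lift {n : ℕ} {H : Type*} [Group H] (f : ∀ i, i + 1 < n → H)
    (h₁ : ∀ i j hi hj, i + 1 < j → f i hi * f j hj = f j hj * f i hi)
    (h₂ : ∀ i hi hj, f i hi * f (i + 1) hj * f i hi = f (i + 1) hj * f i hi * f (i + 1) hj) :
    BraidGroup n →* H :=
  PresentedGroup.toGroup (f := fun i : Fin (n - 1) => f i (by omega)) (by
    rintro r (⟨i, j, hij, rfl⟩ | ⟨⟨i, hi⟩, ⟨j, hj⟩, hij, rfl⟩)
    · simp only [map_mul, map_inv, FreeGroup.lift_apply_of]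
      rw [mul_inv_eq_one]
      exact h₁ _ _ _ _ hij
    · simp only [map_mul, map_inv, FreeGroup.lift_apply_of]
      rw [mul_inv_eq_one]
      simp only at hij
      subst hij
      exact h₂ _ _ _)

theorem lift_gen {n : ℕ} {H : Type*} [Group H] (f : ∀ i, i + 1 < n → H) (h₁) (h₂) (i : ℕ)
    (hi : i + 1 < n) : lift f h₁ h₂ (gen i hi) = f i hi :=
  PresentedGroup.toGroup.of _

theorem hom_ext {n : ℕ} {H : Type*} [Group H] {f g : BraidGroup n →* H}
    (h : ∀ i hi, f (gen i hi) = g (gen i hi)) : f = g :=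
  PresentedGroup.ext (fun i => h i (by omega))

theorem induction {n : ℕ} {p : BraidGroup n → Prop} (hg : ∀ i hi, p (gen i hi)) (h1 : p 1)
    (hm : ∀ x y, p x → p y → p (x * y)) (hi : ∀ x, p x → p x⁻¹) (x : BraidGroup n) : p x := by
  have hx : x ∈ Subgroup.closure (Set.range (PresentedGroup.of (rels := braidRels n))) := by
    rw [PresentedGroup.closure_range_of]
    trivial
  induction hx using Subgroup.closure_induction with
  | mem y hy =>
    obtain ⟨i, rfl⟩ := hy
    exact hg i (by omega)
  | one => exact h1
  | mul x y _ _ hx hy => exact hm x y hx hy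
  | inv x _ hx => exact hi x hx

/-- The transposition of `i` and `i + 1`. -/
def transp {n : ℕ} (i : ℕ) (h : i + 1 < n) : Equiv.Perm (Fin n) :=
  Equiv.swap ⟨i, by omega⟩ ⟨i + 1, h⟩

theorem val_transp {n i : ℕ} (h : i + 1 < n) (x : Fin n) :
    (transp i h x : ℕ) = if (x : ℕ) = i then i + 1 else if (x : ℕ) = i + 1 then i else x := by
  unfold transp
  rw [Equiv.swap_apply_def]
  simp only [Fin.ext_iff]
  split_ifs <;> rfl

theorem transp_mul_self {n i : ℕ} (h : i + 1 < n) : transp i h * transp i h = 1 :=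
  Equiv.swap_mul_self _ _

theorem transp_comm {n i j : ℕ} (hi : i + 1 < n) (hj : j + 1 < n) (h : i + 1 < j) :
    transp i hi * transp j hj = transp j hj * transp i hi := by
  ext x
  simp only [Equiv.Perm.mul_apply, val_transp]
  split_ifs <;> omega

theorem transp_braid {n i : ℕ} (hi : i + 1 < n) (hj : i + 1 + 1 < n) :
    transp i hi * transp (i + 1) hj * transp i hi =
      transp (i + 1) hj * transp i hi * transp (i + 1) hj := by
  ext x
  simp only [Equiv.Perm.mul_apply, val_transp]
  split_ifs <;> omega

theorem transp_lt {n i : ℕ} (h : i + 1 < n) {x y : Fin n} (hxy : x < y)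
    (hne : ¬ ((x : ℕ) = i ∧ (y : ℕ) = i + 1)) : transp i h x < transp i h y := by
  rw [Fin.lt_def] at hxy ⊢
  rw [val_transp, val_transp]
  split_ifs <;> omega

/-- The underlying permutation of a braid. -/
def perm (n : ℕ) : BraidGroup n →* Equiv.Perm (Fin n) :=
  lift (fun i h => transp i h) (fun _ _ hi hj h => transp_comm hi hj h)
    (fun _ hi hj => transp_braid hi hj)

theorem perm_gen {n i : ℕ} (h : i + 1 < n) : perm n (gen i h) = transp i h := lift_gen _ _ _ _ _

/-- The position `i` is a descent of the permutation `w`. -/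
def Desc {n : ℕ} (w : Equiv.Perm (Fin n)) (i : ℕ) (h : i + 1 < n) : Prop :=
  w ⟨i + 1, h⟩ < w ⟨i, by omega⟩

/-- The set of inversions of a permutation. -/
def inversions {n : ℕ} (w : Equiv.Perm (Fin n)) : Finset (Fin n × Fin n) :=
  Finset.univ.filter (fun p => p.1 < p.2 ∧ w p.2 < w p.1)

theorem mul_transp_apply_left {n i : ℕ} (w : Equiv.Perm (Fin n)) (h : i + 1 < n) :
    (w * transp i h) ⟨i, by omega⟩ = w ⟨i + 1, h⟩ := by
  simp [transp]

theorem mul_transp_apply_right {n i : ℕ} (w : Equiv.Perm (Fin n)) (h : i + 1 < n) :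
    (w * transp i h) ⟨i + 1, h⟩ = w ⟨i, by omega⟩ := by
  simp [transp]

theorem card_inversions_mul_transp_lt {n i : ℕ} (w : Equiv.Perm (Fin n)) (h : i + 1 < n)
    (hd : Desc w i h) : (inversions (w * transp i h)).card < (inversions w).card := by
  rw [← Finset.card_image_of_injective (inversions (w * transp i h))
    ((transp i h).injective.prodMap (transp i h).injective)]
  refine Finset.card_lt_card ⟨?_, ?_⟩
  · intro p hp
    obtain ⟨⟨x, y⟩, hq, rfl⟩ := Finset.mem_image.1 hp
    simp only [inversions, Finset.mem_filter, Finset.mem_univ, true_and, Prod.map] at hq ⊢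
    refine ⟨transp_lt h hq.1 ?_, hq.2⟩
    rintro ⟨h1, h2⟩
    have ex : x = ⟨i, Nat.lt_of_succ_lt h⟩ := Fin.ext h1
    have ey : y = ⟨i + 1, h⟩ := Fin.ext h2
    have := hq.2
    rw [ex, ey, mul_transp_apply_left, mul_transp_apply_right] at this
    exact absurd hd (not_lt.2 this.le)
  · intro hsub
    have hm : ((⟨i, by omega⟩ : Fin n), (⟨i + 1, h⟩ : Fin n)) ∈ inversions w := by
      simp only [inversions, Finset.mem_filter, Finset.mem_univ, true_and]
      exact ⟨Nat.lt_succ_self i, hd⟩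
    obtain ⟨⟨x, y⟩, hq, he⟩ := Finset.mem_image.1 (hsub hm)
    simp only [inversions, Finset.mem_filter, Finset.mem_univ, true_and, Prod.map,
      Prod.mk.injEq] at hq he
    have h1 := congrArg Fin.val he.1
    have h2 := congrArg Fin.val he.2
    rw [val_transp] at h1 h2
    have h3 := Fin.lt_def.1 hq.1
    simp only at h1 h2
    split_ifs at h1 h2 <;> omega

theorem eq_one_of_no_desc {n : ℕ} (w : Equiv.Perm (Fin n)) (h : ∀ i hi, ¬ Desc w i hi) :
    w = 1 := by
  rw [← Equiv.Perm.monotone_iff]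
  have key : ∀ (d a : ℕ) (ha : a + d < n), w ⟨a, by omega⟩ ≤ w ⟨a + d, ha⟩ := by
    intro d
    induction d with
    | zero => intro a ha; exact le_rfl
    | succ d ih => intro a ha; exact (ih a (by omega)).trans (not_lt.1 (h (a + d) ha))
  intro x y hxy
  obtain ⟨d, hd⟩ := Nat.exists_eq_add_of_le (Fin.le_def.1 hxy)
  have := key d x (by omega)
  have e : (⟨(x : ℕ) + d, by omega⟩ : Fin n) = y := Fin.ext hd.symm
  rwa [e] at this

theorem mul_transp_cancel {n i : ℕ} (w : Equiv.Perm (Fin n)) (h : i + 1 < n) :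
    w * transp i h * transp i h = w := by
  rw [mul_assoc, transp_mul_self, mul_one]

/-- Induction on reduced words. -/
theorem perm_induction {n : ℕ} {p : Equiv.Perm (Fin n) → Prop} (h1 : p 1)
    (hs : ∀ w i hi, Desc w i hi → p (w * transp i hi) → p w) (w : Equiv.Perm (Fin n)) : p w := by
  induction hk : (inversions w).card using Nat.strong_induction_on generalizing w with
  | _ k ih =>
    by_cases h : ∀ i hi, ¬ Desc w i hi
    · rw [eq_one_of_no_desc w h]
      exact h1
    · push Not at h
      obtain ⟨i, hi, hd⟩ := h
      exact hs w i hi hd (ih _ (hk ▸ card_inversions_mul_transp_lt w hi hd) _ rfl)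

open Classical in
/-- The positive permutation braid of `w`: the braid in which any two strands cross at most once,
positively, and whose underlying permutation is `w`. -/
noncomputable def posBraid {n : ℕ} (w : Equiv.Perm (Fin n)) : BraidGroup n :=
  if h : ∃ i, ∃ hi : i + 1 < n, Desc w i hi then
    posBraid (w * transp h.choose h.choose_spec.choose) * gen h.choose h.choose_spec.choose
  else 1
termination_by (inversions w).card
decreasing_by exact card_inversions_mul_transp_lt w _ h.choose_spec.choose_spec

theorem posBraid_one (n : ℕ) : posBraid (1 : Equiv.Perm (Fin n)) = 1 := by
  rw [posBraid, dif_neg]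
  rintro ⟨i, hi, hd⟩
  exact absurd hd (not_lt.2 (Nat.le_succ i))

theorem posBraid_exists {n : ℕ} (w : Equiv.Perm (Fin n)) {i : ℕ} {hi : i + 1 < n}
    (hd : Desc w i hi) : ∃ j, ∃ hj : j + 1 < n, Desc w j hj ∧
      posBraid w = posBraid (w * transp j hj) * gen j hj := by
  have h : ∃ i, ∃ hi : i + 1 < n, Desc w i hi := ⟨i, hi, hd⟩
  refine ⟨h.choose, h.choose_spec.choose, h.choose_spec.choose_spec, ?_⟩
  rw [posBraid, dif_pos h]

theorem desc_mul_transp_iff {n i j : ℕ} (w : Equiv.Perm (Fin n)) (hi : i + 1 < n)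
    (hj : j + 1 < n) : Desc (w * transp i hi) j hj ↔
      w (transp i hi ⟨j + 1, hj⟩) < w (transp i hi ⟨j, by omega⟩) := Iff.rfl

theorem transp_mk {n i : ℕ} (hi : i + 1 < n) {j k : ℕ} (hj : j < n) (hk : k < n)
    (h : (if j = i then i + 1 else if j = i + 1 then i else j) = k) :
    transp i hi ⟨j, hj⟩ = ⟨k, hk⟩ := Fin.ext ((val_transp hi _).trans h)

/-- The positive permutation braid does not depend on the choice of a descent. -/
theorem posBraid_desc {n : ℕ} (w : Equiv.Perm (Fin n)) {i : ℕ} (hi : i + 1 < n)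
    (hd : Desc w i hi) : posBraid w = posBraid (w * transp i hi) * gen i hi := by
  induction hk : (inversions w).card using Nat.strong_induction_on generalizing w i with
  | _ k ih =>
    have IH : ∀ (v : Equiv.Perm (Fin n)) (a : ℕ) (ha : a + 1 < n),
        (inversions v).card < (inversions w).card → Desc v a ha →
        posBraid v = posBraid (v * transp a ha) * gen a ha :=
      fun v a ha hv hva => ih _ (hk ▸ hv) v ha hva rfl
    obtain ⟨j, hj, hdj, hw⟩ := posBraid_exists w hd
    have lti := card_inversions_mul_transp_lt w hi hd
    have ltj := card_inversions_mul_transp_lt w hj hdj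
    -- commuting descents
    have far : ∀ (a b : ℕ) (ha : a + 1 < n) (hb : b + 1 < n), a + 1 < b → Desc w a ha →
        Desc w b hb → posBraid (w * transp a ha) * gen a ha =
          posBraid (w * transp b hb) * gen b hb := by
      intro a b ha hb hab hda hdb
      have d1 : Desc (w * transp a ha) b hb := by
        rw [desc_mul_transp_iff, transp_mk ha _ hb (by split_ifs <;> omega),
          transp_mk ha _ (by omega : b < n) (by split_ifs <;> omega)]
        exact hdb
      have d2 : Desc (w * transp b hb) a ha := by
        rw [desc_mul_transp_iff, transp_mk hb _ ha (by split_ifs <;> omega),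
          transp_mk hb _ (by omega : a < n) (by split_ifs <;> omega)]
        exact hda
      rw [IH _ b hb (card_inversions_mul_transp_lt w ha hda) d1,
        IH _ a ha (card_inversions_mul_transp_lt w hb hdb) d2, mul_assoc w, mul_assoc w,
        transp_comm ha hb hab, mul_assoc, mul_assoc, gen_comm ha hb hab]
    -- adjacent descents
    have near : ∀ (a : ℕ) (ha : a + 1 < n) (hb : a + 1 + 1 < n), Desc w a ha →
        Desc w (a + 1) hb → posBraid (w * transp a ha) * gen a ha =
          posBraid (w * transp (a + 1) hb) * gen (a + 1) hb := by
      intro a ha hb hda hdb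
      have la := card_inversions_mul_transp_lt w ha hda
      have lb := card_inversions_mul_transp_lt w hb hdb
      have d1 : Desc (w * transp a ha) (a + 1) hb := by
        rw [desc_mul_transp_iff, transp_mk ha _ hb (by split_ifs <;> omega),
          transp_mk ha _ (by omega : a < n) (by split_ifs <;> omega)]
        exact lt_trans hdb hda
      have d2 : Desc (w * transp a ha * transp (a + 1) hb) a ha := by
        rw [desc_mul_transp_iff, transp_mk hb _ hb (by split_ifs <;> omega),
          transp_mk hb _ (by omega : a < n) (by split_ifs <;> omega), Equiv.Perm.mul_apply,
          Equiv.Perm.mul_apply, transp_mk ha _ hb (by split_ifs <;> omega),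
          transp_mk ha _ ha (by split_ifs <;> omega)]
        exact hdb
      have d3 : Desc (w * transp (a + 1) hb) a ha := by
        rw [desc_mul_transp_iff, transp_mk hb _ hb (by split_ifs <;> omega),
          transp_mk hb _ (by omega : a < n) (by split_ifs <;> omega)]
        exact lt_trans hdb hda
      have d4 : Desc (w * transp (a + 1) hb * transp a ha) (a + 1) hb := by
        rw [desc_mul_transp_iff, transp_mk ha _ hb (by split_ifs <;> omega),
          transp_mk ha _ (by omega : a < n) (by split_ifs <;> omega), Equiv.Perm.mul_apply,
          Equiv.Perm.mul_apply, transp_mk hb _ ha (by split_ifs <;> omega),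
          transp_mk hb _ (by omega : a < n) (by split_ifs <;> omega)]
        exact hda
      have l1 := card_inversions_mul_transp_lt _ hb d1
      have l2 := card_inversions_mul_transp_lt _ ha d3
      rw [IH _ _ hb la d1, IH _ _ ha (l1.trans la) d2, IH _ _ ha lb d3, IH _ _ hb (l2.trans lb) d4]
      have e := transp_braid ha hb
      have g := gen_braid ha hb
      simp only [mul_assoc] at e g ⊢
      rw [e, g]
    rw [hw]
    rcases lt_trichotomy i j with hij | hij | hij
    · rcases (Nat.succ_le_of_lt hij).lt_or_eq with h' | h'
      · exact (far i j hi hj h' hd hdj).symm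
      · subst h'
        exact (near i hi hj hd hdj).symm
    · subst hij
      rfl
    · rcases (Nat.succ_le_of_lt hij).lt_or_eq with h' | h'
      · exact far j i hj hi h' hdj hd
      · subst h'
        exact near j hj hi hdj hd

/-- In the product `u * v` no inversion of `v` is undone by `u`, that is, the number of inversions
is additive. -/
def Additive {n : ℕ} (u v : Equiv.Perm (Fin n)) : Prop :=
  ∀ x y, x < y → v y < v x → u (v y) < u (v x)

theorem posBraid_mul {n : ℕ} (u v : Equiv.Perm (Fin n)) (h : Additive u v) :
    posBraid (u * v) = posBraid u * posBraid v := by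
  revert h
  refine perm_induction (p := fun v => Additive u v → posBraid (u * v) = posBraid u * posBraid v)
    ?_ ?_ v
  · intro _
    rw [mul_one, posBraid_one, mul_one]
  · intro v i hi hd ih h
    have hd' : Desc (u * v) i hi := h _ _ (Nat.lt_succ_self i) hd
    rw [posBraid_desc _ hi hd', posBraid_desc _ hi hd, mul_assoc u, ih, mul_assoc]
    intro x y hxy hv
    refine h _ _ (transp_lt hi hxy ?_) hv
    rintro ⟨h1, h2⟩
    have ex : x = ⟨i, Nat.lt_of_succ_lt hi⟩ := Fin.ext h1
    have ey : y = ⟨i + 1, hi⟩ := Fin.ext h2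
    rw [ex, ey, mul_transp_apply_left, mul_transp_apply_right] at hv
    exact absurd hd (not_lt.2 hv.le)

theorem posBraid_transp {n i : ℕ} (h : i + 1 < n) : posBraid (transp i h) = gen i h := by
  have hd : Desc (transp i h) i h := by
    simp [Desc, transp, Fin.lt_def]
  rw [posBraid_desc _ h hd, transp_mul_self, posBraid_one, one_mul]

theorem perm_posBraid {n : ℕ} (w : Equiv.Perm (Fin n)) : perm n (posBraid w) = w := by
  refine perm_induction (p := fun w => perm n (posBraid w) = w) ?_ ?_ w
  · rw [posBraid_one, map_one]
  · intro w i hi hd ih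
    rw [posBraid_desc _ hi hd, map_mul, ih, perm_gen, mul_transp_cancel]

theorem additive_transp {n i : ℕ} (u : Equiv.Perm (Fin n)) (hi : i + 1 < n)
    (h : u ⟨i, by omega⟩ < u ⟨i + 1, hi⟩) : Additive u (transp i hi) := by
  intro x y hxy ht
  by_cases hne : (x : ℕ) = i ∧ (y : ℕ) = i + 1
  · have ex : x = ⟨i, Nat.lt_of_succ_lt hi⟩ := Fin.ext hne.1
    have ey : y = ⟨i + 1, hi⟩ := Fin.ext hne.2
    rw [ex, ey, transp_mk hi _ (by omega : i < n) (by split_ifs <;> omega),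
      transp_mk hi _ hi (by split_ifs <;> omega)]
    exact h
  · exact absurd (transp_lt hi hxy hne) (not_lt.2 ht.le)

/-- Cabling preserves the absence of undone inversions. -/
theorem Additive.pull {n m : ℕ} {u v : Equiv.Perm (Fin m)} (h : Additive u v) (φ : OrdMap n m) :
    Additive (permPull (permPush v φ) u) (permPull φ v) := by
  intro x y hxy hv
  rw [permPull_lt_iff] at hv ⊢
  rw [permPush_permPull, permPush_permPull]
  rcases hv with hv | ⟨_, hv⟩
  · refine Or.inl (h _ _ ((φ.monotone hxy.le).lt_of_ne ?_) hv)
    intro he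
    rw [he] at hv
    exact lt_irrefl _ hv
  · exact absurd hxy (not_lt.2 hv.le)

/-- The action of permutations on order-preserving maps. -/
def pushPerm (n m : ℕ) : Equiv.Perm (Fin m) →* Equiv.Perm (OrdMap n m) where
  toFun σ :=
    { toFun := permPush σ
      invFun := permPush σ⁻¹
      left_inv := fun φ => by rw [← permPush_mul, inv_mul_cancel, permPush_one]
      right_inv := fun φ => by rw [← permPush_mul, mul_inv_cancel, permPush_one] }
  map_one' := Equiv.ext (fun φ => permPush_one φ)
  map_mul' σ τ := Equiv.ext (fun φ => permPush_mul σ τ φ)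

/-- The group of pairs of a permutation of the set of order-preserving maps and a family of braids
indexed by this set. -/
abbrev CablingGroup (n m : ℕ) :=
  (OrdMap n m → BraidGroup n) ⋊[mulAutArrow] (Equiv.Perm (OrdMap n m))

/-- The cablings of the positive permutation braid of `w`. -/
noncomputable def cablingOf (n m : ℕ) (w : Equiv.Perm (Fin m)) : CablingGroup n m :=
  ⟨fun ψ => posBraid (permPull (permPush w⁻¹ ψ) w), pushPerm n m w⟩

theorem cablingOf_mul (n m : ℕ) (u v : Equiv.Perm (Fin m)) (h : Additive u v) :
    cablingOf n m (u * v) = cablingOf n m u * cablingOf n m v := by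
  refine SemidirectProduct.ext ?_ ?_
  · funext ψ
    change posBraid (permPull (permPush (u * v)⁻¹ ψ) (u * v)) =
      posBraid (permPull (permPush u⁻¹ ψ) u) *
        posBraid (permPull (permPush v⁻¹ (permPush u⁻¹ ψ)) v)
    rw [← permPush_mul v⁻¹, ← mul_inv_rev, permPull_mul, posBraid_mul _ _ (h.pull _),
      ← permPush_mul v, mul_inv_rev, mul_inv_cancel_left]
  · exact map_mul (pushPerm n m) u v

/-- The cablings of all the braids on `m` strands by order-preserving maps from `n`. -/
noncomputable def cabling (n m : ℕ) : BraidGroup m →* CablingGroup n m :=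
  lift (fun i h => cablingOf n m (transp i h))
    (fun i j hi hj h => by
      rw [← cablingOf_mul, ← cablingOf_mul, transp_comm hi hj h]
      · refine additive_transp _ hi ?_
        exact transp_lt hj (Nat.lt_succ_self i) (by simp only; omega)
      · refine additive_transp _ hj ?_
        exact transp_lt hi (Nat.lt_succ_self j) (by simp only; omega))
    (fun i hi hj => by
      have e1 : Additive (transp i hi) (transp (i + 1) hj) :=
        additive_transp _ hj (transp_lt hi (Nat.lt_succ_self _) (by simp only; omega))
      have e2 : Additive (transp (i + 1) hj) (transp i hi) :=
        additive_transp _ hi (transp_lt hj (Nat.lt_succ_self _) (by simp only; omega))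
      rw [← cablingOf_mul _ _ _ _ e1, ← cablingOf_mul _ _ _ _ e2, ← cablingOf_mul,
        ← cablingOf_mul, transp_braid]
      · refine additive_transp _ hj ?_
        simp only [Equiv.Perm.mul_apply, Fin.lt_def, val_transp]
        split_ifs <;> omega
      · refine additive_transp _ hi ?_
        simp only [Equiv.Perm.mul_apply, Fin.lt_def, val_transp]
        split_ifs <;> omega)

/-- The braid `φ^⋆(b)`: the `k`-th strand of `b` is replaced by as many parallel strands as there
are elements of the fibre of `φ` over `k`. -/
noncomputable def pull {n m : ℕ} (φ : OrdMap n m) (b : BraidGroup m) : BraidGroup n :=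
  (cabling n m b).left (permPush (perm m b) φ)

theorem cabling_right {n m : ℕ} (b : BraidGroup m) :
    (cabling n m b).right = pushPerm n m (perm m b) := by
  have : SemidirectProduct.rightHom.comp (cabling n m) = (pushPerm n m).comp (perm m) := by
    refine hom_ext (fun i hi => ?_)
    simp only [MonoidHom.comp_apply, cabling, lift_gen, perm_gen]
    rfl
  exact DFunLike.congr_fun this b

theorem pull_mul {n m : ℕ} (φ : OrdMap n m) (a b : BraidGroup m) :
    pull φ (a * b) = pull (permPush (perm m b) φ) a * pull φ b := by
  unfold pull
  rw [map_mul, map_mul, permPush_mul]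
  change (cabling n m a).left _ *
    (cabling n m b).left ((cabling n m a).right⁻¹ (permPush (perm m a) (permPush (perm m b) φ))) = _
  rw [cabling_right]
  exact congrArg (fun t => (cabling n m a).left _ * (cabling n m b).left t)
    ((pushPerm n m (perm m a)).symm_apply_apply _)

theorem pull_one {n m : ℕ} (φ : OrdMap n m) : pull φ (1 : BraidGroup m) = 1 := by
  have h := pull_mul φ 1 1
  rw [mul_one, map_one, permPush_one] at h
  exact left_eq_mul.1 h

theorem pull_inv {n m : ℕ} (φ : OrdMap n m) (b : BraidGroup m) :
    pull φ b⁻¹ = (pull (permPush (perm m b⁻¹) φ) b)⁻¹ := by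
  refine eq_inv_of_mul_eq_one_right ?_
  rw [← pull_mul, mul_inv_cancel, pull_one]

theorem pull_gen {n m i : ℕ} (φ : OrdMap n m) (h : i + 1 < m) :
    pull φ (gen i h) = posBraid (permPull φ (transp i h)) := by
  unfold pull
  rw [cabling, lift_gen, perm_gen]
  change posBraid (permPull (permPush (transp i h)⁻¹ (permPush (transp i h) φ)) _) = _
  rw [← permPush_mul, inv_mul_cancel, permPush_one]

theorem desc_additive {n i : ℕ} {w : Equiv.Perm (Fin n)} {hi : i + 1 < n} (hd : Desc w i hi) :
    Additive (w * transp i hi) (transp i hi) := by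
  refine additive_transp _ hi ?_
  rw [mul_transp_apply_left, mul_transp_apply_right]
  exact hd

theorem pull_posBraid {n m : ℕ} (φ : OrdMap n m) (w : Equiv.Perm (Fin m)) :
    pull φ (posBraid w) = posBraid (permPull φ w) := by
  revert φ
  refine perm_induction
    (p := fun w => ∀ φ : OrdMap n m, pull φ (posBraid w) = posBraid (permPull φ w)) ?_ ?_ w
  · intro φ
    rw [posBraid_one, pull_one, permPull_one, posBraid_one]
  · intro w i hi hd ih φ
    rw [posBraid_desc w hi hd, pull_mul, ih, pull_gen, perm_gen,
      ← posBraid_mul _ _ ((desc_additive hd).pull φ), ← permPull_mul, mul_transp_cancel]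

theorem perm_pull {n m : ℕ} (φ : OrdMap n m) (b : BraidGroup m) :
    perm n (pull φ b) = permPull φ (perm m b) := by
  revert φ
  refine induction (p := fun b => ∀ φ : OrdMap n m, perm n (pull φ b) = permPull φ (perm m b))
    ?_ ?_ ?_ ?_ b
  · intro i hi φ
    rw [pull_gen, perm_posBraid, perm_gen]
  · intro φ
    rw [pull_one, map_one, map_one, permPull_one]
  · intro x y hx hy φ
    rw [pull_mul, map_mul, hx, hy, map_mul, permPull_mul]
  · intro x hx φ
    rw [pull_inv, map_inv, hx, map_inv, inv_eq_iff_mul_eq_one, ← permPull_mul, mul_inv_cancel,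
      permPull_one]

theorem pull_id {n : ℕ} (b : BraidGroup n) : pull OrderHom.id b = b := by
  refine induction (p := fun b => pull OrderHom.id b = b) ?_ ?_ ?_ ?_ b
  · intro i hi
    rw [pull_gen, permPull_id, posBraid_transp]
  · exact pull_one _
  · intro x y hx hy
    rw [pull_mul, CrossedGroups.permPush_id, hx, hy]
  · intro x hx
    rw [pull_inv, CrossedGroups.permPush_id, hx]

theorem pull_comp {k n m : ℕ} (φ : OrdMap n m) (ψ : OrdMap k n) (b : BraidGroup m) :
    pull (φ.comp ψ) b = pull ψ (pull φ b) := by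
  revert φ ψ
  refine induction (p := fun b => ∀ (φ : OrdMap n m) (ψ : OrdMap k n),
    pull (φ.comp ψ) b = pull ψ (pull φ b)) ?_ ?_ ?_ ?_ b
  · intro i hi φ ψ
    rw [pull_gen, pull_gen, pull_posBraid, permPull_comp]
  · intro φ ψ
    rw [pull_one, pull_one, pull_one]
  · intro x y hx hy φ ψ
    rw [pull_mul, pull_mul, pull_mul, permPush_comp, hx, hy, perm_pull]
  · intro x hx φ ψ
    rw [pull_inv, permPush_comp, hx, pull_inv φ, pull_inv ψ, map_inv (perm n), perm_pull,
      map_inv (perm m), permPull_inv]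

end BraidGroup
namespace BraidGroup

/-- Addition of `b` trivial strands on the right. -/
def inl (a b : ℕ) : BraidGroup a →* BraidGroup (a + b) :=
  lift (fun i h => gen i (by omega)) (fun _ _ _ _ h => gen_comm _ _ h)
    (fun _ _ _ => gen_braid _ _)

/-- Addition of `a` trivial strands on the left. -/
def inr (a b : ℕ) : BraidGroup b →* BraidGroup (a + b) :=
  lift (fun i h => gen (a + i) (by omega)) (fun _ _ _ _ h => gen_comm _ _ (by omega))
    (fun _ _ _ => gen_braid (i := a + _) _ _)

theorem inl_gen (a b : ℕ) {i : ℕ} (h : i + 1 < a) :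
    inl a b (gen i h) = gen i (by omega) := lift_gen _ _ _ _ _

theorem inr_gen (a b : ℕ) {i : ℕ} (h : i + 1 < b) :
    inr a b (gen i h) = gen (a + i) (by omega) := lift_gen _ _ _ _ _

theorem inl_inr_comm {a b : ℕ} (x : BraidGroup a) (y : BraidGroup b) :
    Commute (inl a b x) (inr a b y) := by
  refine induction (p := fun x => Commute (inl a b x) (inr a b y)) ?_ ?_ ?_ ?_ x
  · intro i hi
    refine induction (p := fun y => Commute (inl a b (gen i hi)) (inr a b y)) ?_ ?_ ?_ ?_ y
    · intro j hj
      rw [inl_gen, inr_gen]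
      exact gen_comm _ _ (by omega)
    · rw [map_one]
      exact Commute.one_right _
    · intro x y hx hy
      rw [map_mul]
      exact hx.mul_right hy
    · intro x hx
      rw [map_inv]
      exact hx.inv_right
  · rw [map_one]
    exact Commute.one_left _
  · intro x y hx hy
    rw [map_mul]
    exact hx.mul_left hy
  · intro x hx
    rw [map_inv]
    exact hx.inv_left

/-- Addition of braids: the braids are placed side by side. -/
def sum {a b : ℕ} (x : BraidGroup a) (y : BraidGroup b) : BraidGroup (a + b) :=
  inl a b x * inr a b y

theorem permSum_transp_left {a : ℕ} (b : ℕ) {i : ℕ} (h : i + 1 < a) :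
    permSum (transp i h) (1 : Equiv.Perm (Fin b)) = transp i (by omega) := by
  ext x
  rw [val_transp]
  induction x using Fin.addCases with
  | left x =>
    rw [permSum_castAdd]
    simp only [Fin.val_castAdd, val_transp]
  | right x =>
    rw [permSum_natAdd]
    simp only [Fin.val_natAdd, Equiv.Perm.one_apply]
    split_ifs <;> omega

theorem permSum_transp_right (a : ℕ) {b i : ℕ} (h : i + 1 < b) :
    permSum (1 : Equiv.Perm (Fin a)) (transp i h) = transp (a + i) (by omega) := by
  ext x
  rw [val_transp]
  induction x using Fin.addCases with
  | left x =>
    rw [permSum_castAdd]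
    simp only [Fin.val_castAdd, Equiv.Perm.one_apply]
    split_ifs <;> omega
  | right x =>
    rw [permSum_natAdd]
    simp only [Fin.val_natAdd, val_transp]
    split_ifs <;> omega

theorem Additive.permSum {a b : ℕ} {u v : Equiv.Perm (Fin a)} {u' v' : Equiv.Perm (Fin b)}
    (h : Additive u v) (h' : Additive u' v') : Additive (permSum u u') (permSum v v') := by
  intro x y
  induction x using Fin.addCases with
  | left i =>
    induction y using Fin.addCases with
    | left j =>
      intro hxy hv
      rw [permSum_castAdd, permSum_castAdd] at hv ⊢
      rw [permSum_castAdd, permSum_castAdd]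
      exact h i j hxy hv
    | right j =>
      intro hxy hv
      rw [permSum_castAdd, permSum_natAdd, Fin.lt_def, Fin.val_castAdd, Fin.val_natAdd] at hv
      have := (v i).isLt
      omega
  | right i =>
    induction y using Fin.addCases with
    | left j =>
      intro hxy hv
      rw [Fin.lt_def, Fin.val_castAdd, Fin.val_natAdd] at hxy
      have := j.isLt
      omega
    | right j =>
      intro hxy hv
      rw [permSum_natAdd, permSum_natAdd] at hv ⊢
      rw [permSum_natAdd, permSum_natAdd]
      exact Nat.add_lt_add_left
        (h' i j (Nat.lt_of_add_lt_add_left hxy) (Nat.lt_of_add_lt_add_left hv)) a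

theorem additive_one_left {n : ℕ} (v : Equiv.Perm (Fin n)) : Additive v 1 :=
  fun _ _ hxy hv => absurd hxy (not_lt.2 hv.le)

theorem additive_one_right {n : ℕ} (v : Equiv.Perm (Fin n)) : Additive 1 v :=
  fun _ _ _ hv => hv

theorem permSum_one_one (a b : ℕ) :
    permSum (1 : Equiv.Perm (Fin a)) (1 : Equiv.Perm (Fin b)) = 1 := by
  ext x
  induction x using Fin.addCases <;> simp

theorem inl_posBraid {a : ℕ} (b : ℕ) (w : Equiv.Perm (Fin a)) :
    inl a b (posBraid w) = posBraid (permSum w 1) := by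
  refine perm_induction (p := fun w => inl a b (posBraid w) = posBraid (permSum w 1)) ?_ ?_ w
  · rw [posBraid_one, map_one, permSum_one_one, posBraid_one]
  · intro w i hi hd ih
    rw [posBraid_desc w hi hd, map_mul, ih, inl_gen, ← posBraid_transp, ← permSum_transp_left b hi,
      ← posBraid_mul _ _ ((desc_additive hd).permSum (additive_one_left 1)), ← permSum_mul,
      mul_transp_cancel, mul_one]

theorem inr_posBraid (a : ℕ) {b : ℕ} (w : Equiv.Perm (Fin b)) :
    inr a b (posBraid w) = posBraid (permSum 1 w) := by
  refine perm_induction (p := fun w => inr a b (posBraid w) = posBraid (permSum 1 w)) ?_ ?_ w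
  · rw [posBraid_one, map_one, permSum_one_one, posBraid_one]
  · intro w i hi hd ih
    rw [posBraid_desc w hi hd, map_mul, ih, inr_gen, ← posBraid_transp, ← permSum_transp_right a hi,
      ← posBraid_mul _ _ ((additive_one_left 1).permSum (desc_additive hd)), ← permSum_mul,
      mul_transp_cancel, mul_one]

theorem perm_inl {a : ℕ} (b : ℕ) (x : BraidGroup a) :
    perm (a + b) (inl a b x) = permSum (perm a x) 1 := by
  refine induction (p := fun x => perm (a + b) (inl a b x) = permSum (perm a x) 1) ?_ ?_ ?_ ?_ x
  · intro i hi
    rw [inl_gen, perm_gen, perm_gen, permSum_transp_left]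
  · rw [map_one, map_one, map_one, permSum_one_one]
  · intro x y hx hy
    rw [map_mul, map_mul, hx, hy, map_mul, ← permSum_mul, mul_one]
  · intro x hx
    rw [map_inv, map_inv, hx, map_inv, inv_eq_iff_mul_eq_one, ← permSum_mul, mul_inv_cancel,
      mul_one, permSum_one_one]

theorem perm_inr (a : ℕ) {b : ℕ} (x : BraidGroup b) :
    perm (a + b) (inr a b x) = permSum 1 (perm b x) := by
  refine induction (p := fun x => perm (a + b) (inr a b x) = permSum 1 (perm b x)) ?_ ?_ ?_ ?_ x
  · intro i hi
    rw [inr_gen, perm_gen, perm_gen, permSum_transp_right]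
  · rw [map_one, map_one, map_one, permSum_one_one]
  · intro x y hx hy
    rw [map_mul, map_mul, hx, hy, map_mul, ← permSum_mul, mul_one]
  · intro x hx
    rw [map_inv, map_inv, hx, map_inv, inv_eq_iff_mul_eq_one, ← permSum_mul, mul_inv_cancel,
      mul_one, permSum_one_one]

theorem perm_sum {a b : ℕ} (x : BraidGroup a) (y : BraidGroup b) :
    perm (a + b) (sum x y) = permSum (perm a x) (perm b y) := by
  rw [sum, map_mul, perm_inl, perm_inr, ← permSum_mul, mul_one, one_mul]

theorem sum_mul {a b : ℕ} (x x' : BraidGroup a) (y y' : BraidGroup b) :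
    sum (x * x') (y * y') = sum x y * sum x' y' := by
  unfold sum
  rw [map_mul, map_mul, mul_assoc, mul_assoc, ← mul_assoc (inl a b x'),
    (inl_inr_comm x' y).eq, mul_assoc]

theorem pull_inl {a b c d : ℕ} (φ : OrdMap a c) (ψ : OrdMap b d) (x : BraidGroup c) :
    pull (φ.sum ψ) (inl c d x) = inl a b (pull φ x) := by
  revert φ
  refine induction (p := fun x => ∀ φ : OrdMap a c,
    pull (φ.sum ψ) (inl c d x) = inl a b (pull φ x)) ?_ ?_ ?_ ?_ x
  · intro i hi φ
    rw [inl_gen, pull_gen, pull_gen, ← permSum_transp_left d hi, permPull_sum, permPull_one,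
      inl_posBraid]
  · intro φ
    rw [map_one, pull_one, pull_one, map_one]
  · intro x y hx hy φ
    rw [map_mul, pull_mul, pull_mul, map_mul, hy, perm_inl, permPush_sum, permPush_one, hx]
  · intro x hx φ
    rw [map_inv (inl c d), pull_inv, pull_inv, map_inv (inl a b), map_inv (perm _), perm_inl,
      permSum_inv, permPush_sum, inv_one, permPush_one, hx, map_inv (perm _)]

theorem pull_inr {a b c d : ℕ} (φ : OrdMap a c) (ψ : OrdMap b d) (y : BraidGroup d) :
    pull (φ.sum ψ) (inr c d y) = inr a b (pull ψ y) := by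
  revert ψ
  refine induction (p := fun y => ∀ ψ : OrdMap b d,
    pull (φ.sum ψ) (inr c d y) = inr a b (pull ψ y)) ?_ ?_ ?_ ?_ y
  · intro i hi ψ
    rw [inr_gen, pull_gen, pull_gen, ← permSum_transp_right c hi, permPull_sum, permPull_one,
      inr_posBraid]
  · intro ψ
    rw [map_one, pull_one, pull_one, map_one]
  · intro x y hx hy ψ
    rw [map_mul, pull_mul, pull_mul, map_mul, hy, perm_inr, permPush_sum, permPush_one, hx]
  · intro x hx ψ
    rw [map_inv (inr c d), pull_inv, pull_inv, map_inv (inr a b), map_inv (perm _), perm_inr,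
      permSum_inv, permPush_sum, inv_one, permPush_one, hx, map_inv (perm _)]

theorem pull_sum {a b c d : ℕ} (φ : OrdMap a c) (ψ : OrdMap b d) (x : BraidGroup c)
    (y : BraidGroup d) : pull (φ.sum ψ) (sum x y) = sum (pull φ x) (pull ψ y) := by
  rw [sum, pull_mul, perm_inr, permPush_sum, permPush_one, pull_inl, pull_inr, sum]

/-- Transport along an equality of numbers of strands. -/
noncomputable def castHom {n m : ℕ} (h : n = m) : BraidGroup m →* BraidGroup n where
  toFun := pull (OrdMap.cast h)
  map_one' := pull_one _
  map_mul' x y := by rw [pull_mul, permPush_cast]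

theorem castHom_apply {n m : ℕ} (h : n = m) (x : BraidGroup m) :
    castHom h x = pull (OrdMap.cast h) x := rfl

theorem castHom_gen {n m : ℕ} (h : n = m) {i : ℕ} (hi : i + 1 < m) :
    castHom h (gen i hi) = gen i (by omega) := by
  subst h
  rw [castHom_apply]
  exact pull_id (gen i hi)

theorem gen_congr {n i j : ℕ} (hi : i + 1 < n) (hj : j + 1 < n) (h : i = j) :
    gen i hi = gen j hj := by
  subst h
  rfl

theorem sum_assoc {a b c : ℕ} (x : BraidGroup a) (y : BraidGroup b) (z : BraidGroup c) :
    pull (OrdMap.cast (Nat.add_assoc a b c)) (sum x (sum y z)) = sum (sum x y) z := by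
  have h1 : (castHom (Nat.add_assoc a b c)).comp (inl a (b + c)) =
      (inl (a + b) c).comp (inl a b) := hom_ext (fun i hi => by
    simp only [MonoidHom.comp_apply, inl_gen, castHom_gen])
  have h2 : ((castHom (Nat.add_assoc a b c)).comp (inr a (b + c))).comp (inl b c) =
      (inl (a + b) c).comp (inr a b) := hom_ext (fun i hi => by
    simp only [MonoidHom.comp_apply, inl_gen, inr_gen, castHom_gen])
  have h3 : ((castHom (Nat.add_assoc a b c)).comp (inr a (b + c))).comp (inr b c) =
      inr (a + b) c := hom_ext (fun i hi => by
    simp only [MonoidHom.comp_apply, inr_gen, castHom_gen]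
    exact gen_congr _ _ (Nat.add_assoc a b i).symm)
  rw [← castHom_apply]
  unfold sum
  rw [map_mul, map_mul, map_mul, map_mul, ← mul_assoc]
  exact congrArg₂ _ (congrArg₂ _ (DFunLike.congr_fun h1 x) (DFunLike.congr_fun h2 y))
    (DFunLike.congr_fun h3 z)

theorem sum_zero_left {n : ℕ} (x : BraidGroup n) :
    sum (1 : BraidGroup 0) x = pull (OrdMap.cast (Nat.zero_add n)) x := by
  have h : inr 0 n = castHom (Nat.zero_add n) := hom_ext (fun i hi => by
    rw [inr_gen, castHom_gen]
    exact gen_congr _ _ (Nat.zero_add i))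
  rw [sum, map_one, one_mul, h]
  rfl

theorem sum_zero_right {n : ℕ} (x : BraidGroup n) :
    sum x (1 : BraidGroup 0) = pull (OrdMap.cast (Nat.add_zero n)) x := by
  have h : inl n 0 = castHom (Nat.add_zero n) := hom_ext (fun i hi => by
    rw [inl_gen, castHom_gen])
  rw [sum, map_one, mul_one, h]
  rfl

/-- The crossing of a block of `a` strands with a block of `b` strands. -/
noncomputable def blockSwap (a b : ℕ) : BraidGroup (a + b) := posBraid (permSwap a b)

theorem additive_permSwap_permSum {a b : ℕ} (σ : Equiv.Perm (Fin a)) (τ : Equiv.Perm (Fin b)) :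
    Additive (permSwap a b) (permSum σ τ) := by
  intro x y
  induction x using Fin.addCases with
  | left i =>
    induction y using Fin.addCases with
    | left j =>
      intro hxy hv
      rw [permSum_castAdd, permSum_castAdd] at hv ⊢
      rw [Fin.lt_def, val_permSwap_castAdd, val_permSwap_castAdd]
      exact Nat.add_lt_add_left hv b
    | right j =>
      intro hxy hv
      rw [permSum_castAdd, permSum_natAdd, Fin.lt_def, Fin.val_castAdd, Fin.val_natAdd] at hv
      have := (σ i).isLt
      omega
  | right i =>
    induction y using Fin.addCases with
    | left j =>
      intro hxy hv
      rw [Fin.lt_def, Fin.val_castAdd, Fin.val_natAdd] at hxy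
      have := j.isLt
      omega
    | right j =>
      intro hxy hv
      rw [permSum_natAdd, permSum_natAdd] at hv ⊢
      rw [Fin.lt_def, val_permSwap_natAdd, val_permSwap_natAdd]
      exact Nat.lt_of_add_lt_add_left hv

theorem additive_permSum_permSwap {a b : ℕ} (σ : Equiv.Perm (Fin a)) (τ : Equiv.Perm (Fin b)) :
    Additive (permPull (OrdMap.cast (Nat.add_comm a b)) (permSum τ σ)) (permSwap a b) := by
  intro x y
  induction x using Fin.addCases with
  | left i =>
    induction y using Fin.addCases with
    | left j =>
      intro hxy hv
      rw [Fin.lt_def, val_permSwap_castAdd, val_permSwap_castAdd] at hv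
      have := Fin.lt_def.1 hxy
      simp only [Fin.val_castAdd] at this
      omega
    | right j =>
      intro hxy hv
      have h1 : Fin.cast (Nat.add_comm a b) (permSwap a b (Fin.castAdd b i)) =
        Fin.natAdd b i := Fin.ext (by simp)
      have h2 : Fin.cast (Nat.add_comm a b) (permSwap a b (Fin.natAdd a j)) =
        Fin.castAdd a j := Fin.ext (by simp)
      rw [permPull_cast_apply, permPull_cast_apply, h1, h2, permSum_natAdd, permSum_castAdd,
        Fin.lt_def]
      simp only [Fin.val_cast, Fin.val_castAdd, Fin.val_natAdd]
      omega
  | right i =>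
    induction y using Fin.addCases with
    | left j =>
      intro hxy hv
      rw [Fin.lt_def, Fin.val_castAdd, Fin.val_natAdd] at hxy
      have := j.isLt
      omega
    | right j =>
      intro hxy hv
      rw [Fin.lt_def, val_permSwap_natAdd, val_permSwap_natAdd] at hv
      have := Fin.lt_def.1 hxy
      simp only [Fin.val_natAdd] at this
      omega

theorem sum_posBraid {a b : ℕ} (σ : Equiv.Perm (Fin a)) (τ : Equiv.Perm (Fin b)) :
    sum (posBraid σ) (posBraid τ) = posBraid (permSum σ τ) := by
  rw [sum, inl_posBraid, inr_posBraid,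
    ← posBraid_mul _ _ ((additive_one_left σ).permSum (additive_one_right τ)), ← permSum_mul,
    mul_one, one_mul]

theorem blockSwap_mul_sum_posBraid {a b : ℕ} (σ : Equiv.Perm (Fin a)) (τ : Equiv.Perm (Fin b)) :
    blockSwap a b * sum (posBraid σ) (posBraid τ) =
      castHom (Nat.add_comm a b) (sum (posBraid τ) (posBraid σ)) * blockSwap a b := by
  rw [sum_posBraid, sum_posBraid, castHom_apply, pull_posBraid, blockSwap,
    ← posBraid_mul _ _ (additive_permSwap_permSum σ τ),
    ← posBraid_mul _ _ (additive_permSum_permSwap σ τ), permSwap_mul_permSum]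

theorem blockSwap_inl {a b : ℕ} (x : BraidGroup a) :
    blockSwap a b * inl a b x = castHom (Nat.add_comm a b) (inr b a x) * blockSwap a b := by
  have h : (MulAut.conj (blockSwap a b)).toMonoidHom.comp (inl a b) =
      (castHom (Nat.add_comm a b)).comp (inr b a) := hom_ext (fun i hi => by
    have := blockSwap_mul_sum_posBraid (transp i hi) (1 : Equiv.Perm (Fin b))
    rw [posBraid_transp, posBraid_one, sum, sum, map_one, map_one, mul_one, one_mul] at this
    change blockSwap a b * _ * (blockSwap a b)⁻¹ = _
    rw [this, mul_inv_cancel_right]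
    rfl)
  rw [← mul_inv_eq_iff_eq_mul]
  exact DFunLike.congr_fun h x

theorem blockSwap_inr {a b : ℕ} (y : BraidGroup b) :
    blockSwap a b * inr a b y = castHom (Nat.add_comm a b) (inl b a y) * blockSwap a b := by
  have h : (MulAut.conj (blockSwap a b)).toMonoidHom.comp (inr a b) =
      (castHom (Nat.add_comm a b)).comp (inl b a) := hom_ext (fun i hi => by
    have := blockSwap_mul_sum_posBraid (1 : Equiv.Perm (Fin a)) (transp i hi)
    rw [posBraid_transp, posBraid_one, sum, sum, map_one, map_one, mul_one, one_mul] at this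
    change blockSwap a b * _ * (blockSwap a b)⁻¹ = _
    rw [this, mul_inv_cancel_right]
    rfl)
  rw [← mul_inv_eq_iff_eq_mul]
  exact DFunLike.congr_fun h y

theorem blockSwap_mul_sum {a b : ℕ} (x : BraidGroup a) (y : BraidGroup b) :
    blockSwap a b * sum x y = pull (OrdMap.cast (Nat.add_comm a b)) (sum y x) * blockSwap a b := by
  rw [← castHom_apply, sum, sum, ← mul_assoc, blockSwap_inl, mul_assoc, blockSwap_inr, ← mul_assoc,
    ← map_mul, (inl_inr_comm y x).eq]

theorem additive_of_val {n : ℕ} {u v : Equiv.Perm (Fin n)}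
    (h : ∀ x y : Fin n, (x : ℕ) < y → (v y : ℕ) < v x → (u (v y) : ℕ) < u (v x)) :
    Additive u v := h

theorem val_permSwap {a b : ℕ} (x : Fin (a + b)) :
    (permSwap a b x : ℕ) = if (x : ℕ) < a then b + x else x - a := by
  induction x using Fin.addCases with
  | left i => simp
  | right i => simp

theorem val_permSum_one_left {a b : ℕ} (σ : Equiv.Perm (Fin b)) (x : Fin (a + b)) :
    (permSum (1 : Equiv.Perm (Fin a)) σ x : ℕ) =
      if h : (x : ℕ) < a then (x : ℕ) else a + σ ⟨x - a, by omega⟩ := by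
  induction x using Fin.addCases with
  | left i => simp
  | right i => simp

theorem val_permSum_one_right {a b : ℕ} (σ : Equiv.Perm (Fin a)) (x : Fin (a + b)) :
    (permSum σ (1 : Equiv.Perm (Fin b)) x : ℕ) =
      if h : (x : ℕ) < a then (σ ⟨x, h⟩ : ℕ) else x := by
  induction x using Fin.addCases with
  | left i => simp
  | right i => simp

theorem blockSwap_hexagon_forward (a b c : ℕ) :
    pull (OrdMap.cast (Nat.add_assoc a b c)) (blockSwap a (b + c)) =
      pull (OrdMap.cast (by omega : a + b + c = b + (a + c)))
        (sum (1 : BraidGroup b) (blockSwap a c)) * sum (blockSwap a b) (1 : BraidGroup c) := by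
  rw [← posBraid_one b, ← posBraid_one c]
  unfold blockSwap
  rw [sum_posBraid, sum_posBraid, pull_posBraid, pull_posBraid, permSwap_hexagon_forward,
    posBraid_mul]
  refine additive_of_val (fun x y hxy hv => ?_)
  simp only [permPull_cast_apply, Fin.val_cast, val_permSum_one_left, val_permSum_one_right,
    val_permSwap] at hv ⊢
  split_ifs at hv ⊢ <;> omega

theorem blockSwap_hexagon_reverse (a b c : ℕ) :
    blockSwap (a + b) c =
      pull (OrdMap.cast (by omega : a + b + c = a + c + b))
        (sum (blockSwap a c) (1 : BraidGroup b)) *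
      pull (OrdMap.cast (Nat.add_assoc a b c)) (sum (1 : BraidGroup a) (blockSwap b c)) := by
  rw [← posBraid_one b, ← posBraid_one a]
  unfold blockSwap
  rw [sum_posBraid, sum_posBraid, pull_posBraid, pull_posBraid, permSwap_hexagon_reverse,
    posBraid_mul]
  refine additive_of_val (fun x y hxy hv => ?_)
  simp only [permPull_cast_apply, Fin.val_cast, val_permSum_one_left, val_permSum_one_right,
    val_permSwap] at hv ⊢
  split_ifs at hv ⊢ <;> omega

end BraidGroup

/-- The braid groups. -/
noncomputable def CrossedGroups.braidGroups : CrossedGroups.{0} where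
  J n := BraidGroup n
  perm n := BraidGroup.perm n
  pull φ x := BraidGroup.pull φ x
  sum x y := BraidGroup.sum x y
  swap a b := BraidGroup.blockSwap a b
  perm_pull := BraidGroup.perm_pull
  pull_id := BraidGroup.pull_id
  pull_comp := BraidGroup.pull_comp
  pull_mul := BraidGroup.pull_mul
  perm_sum := BraidGroup.perm_sum
  sum_mul := BraidGroup.sum_mul
  pull_sum := BraidGroup.pull_sum
  sum_assoc := BraidGroup.sum_assoc
  sum_zero_left := BraidGroup.sum_zero_left
  sum_zero_right := BraidGroup.sum_zero_right
  perm_swap _ _ := BraidGroup.perm_posBraid _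
  pull_swap φ ψ := by
    rw [BraidGroup.blockSwap, BraidGroup.pull_posBraid, (perm_swap_aux φ ψ).2,
      BraidGroup.blockSwap]
  swap_mul_sum := BraidGroup.blockSwap_mul_sum
  swap_hexagon_forward := BraidGroup.blockSwap_hexagon_forward
  swap_hexagon_reverse := BraidGroup.blockSwap_hexagon_reverse

namespace CrossedGroups

section Labelled

variable (K : CrossedGroups.{u}) (G : Type w) [Group G]

/-- The action of `J n` on `G ^ n` by the underlying permutations. -/
def labelAction (n : ℕ) : K.J n →* MulAut (Fin n → G) :=
  (mulAutArrow (G := Equiv.Perm (Fin n)) (A := Fin n) (M := G)).comp (K.perm n)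

theorem labelAction_apply {n : ℕ} (j : K.J n) (x : Fin n → G) (k : Fin n) :
    K.labelAction G n j x k = x ((K.perm n j)⁻¹ k) := rfl

/-- The semidirect product `G ^ n ⋊ J n`. Its element `(x, j)` is thought of as `x ∘ j`. -/
abbrev LabelledGroup (n : ℕ) := (Fin n → G) ⋊[K.labelAction G n] K.J n

variable {G}

/-- The map `φ^⋆` for labelled elements: the label of a strand is given to all the strands that
replace it. -/
def labelledPull {n m : ℕ} (φ : OrdMap n m) (p : K.LabelledGroup G m) : K.LabelledGroup G n :=
  ⟨fun k => p.left (permPush (K.perm m p.right) φ k), K.pull φ p.right⟩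

/-- Juxtaposition of labelled elements. -/
def labelledSum {a b : ℕ} (p : K.LabelledGroup G a) (q : K.LabelledGroup G b) :
    K.LabelledGroup G (a + b) :=
  ⟨Fin.append p.left q.left, K.sum p.right q.right⟩

theorem inv_permPush {n m : ℕ} (σ : Equiv.Perm (Fin m)) (φ : OrdMap n m) (k : Fin n) :
    σ⁻¹ (permPush σ φ k) = φ ((permPull φ σ)⁻¹ k) := by
  obtain ⟨l, rfl⟩ := (permPull φ σ).surjective k
  rw [permPush_permPull]
  simp

theorem labelledPull_mul {n m : ℕ} (φ : OrdMap n m) (p q : K.LabelledGroup G m) :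
    K.labelledPull φ (p * q) =
      K.labelledPull (permPush (K.perm m q.right) φ) p * K.labelledPull φ q := by
  refine SemidirectProduct.ext ?_ (K.pull_mul φ p.right q.right)
  funext k
  change p.left (permPush (K.perm m (p.right * q.right)) φ k) *
      q.left ((K.perm m p.right)⁻¹ (permPush (K.perm m (p.right * q.right)) φ k)) =
    p.left (permPush (K.perm m p.right) (permPush (K.perm m q.right) φ) k) *
      q.left (permPush (K.perm m q.right) φ
        ((K.perm n (K.pull (permPush (K.perm m q.right) φ) p.right))⁻¹ k))
  rw [map_mul, permPush_mul, inv_permPush, K.perm_pull]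

theorem labelledPull_inr {n m : ℕ} (φ : OrdMap n m) (j : K.J m) :
    K.labelledPull φ (SemidirectProduct.inr j : K.LabelledGroup G m) =
      SemidirectProduct.inr (K.pull φ j) := rfl

theorem labelledSum_inr {a b : ℕ} (i : K.J a) (j : K.J b) :
    K.labelledSum (SemidirectProduct.inr i : K.LabelledGroup G a) (SemidirectProduct.inr j) =
      SemidirectProduct.inr (K.sum i j) := by
  refine SemidirectProduct.ext ?_ rfl
  funext k
  change Fin.append (1 : Fin a → G) (1 : Fin b → G) k = 1
  induction k using Fin.addCases <;> simp

theorem labelledSum_mul {a b : ℕ} (p p' : K.LabelledGroup G a) (q q' : K.LabelledGroup G b) :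
    K.labelledSum (p * p') (q * q') = K.labelledSum p q * K.labelledSum p' q' := by
  refine SemidirectProduct.ext ?_ (K.sum_mul _ _ _ _)
  funext k
  change Fin.append (p * p').left (q * q').left k = Fin.append p.left q.left k *
    Fin.append p'.left q'.left ((K.perm _ (K.sum p.right q.right))⁻¹ k)
  rw [K.perm_sum, permSum_inv]
  induction k using Fin.addCases with
  | left i =>
    rw [Fin.append_left, Fin.append_left, permSum_castAdd, Fin.append_left]
    rfl
  | right i =>
    rw [Fin.append_right, Fin.append_right, permSum_natAdd, Fin.append_right]
    rfl

/-- The family of the groups `G ^ n ⋊ J n`; for the symmetric groups this gives `ℙ ⊗ 𝔾`, for the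
braid groups `𝔹 ⊗ 𝔾`. -/
def labelled (G : Type w) [Group G] : CrossedGroups.{max w u} where
  J n := K.LabelledGroup G n
  perm n := (K.perm n).comp SemidirectProduct.rightHom
  pull φ p := K.labelledPull φ p
  sum p q := K.labelledSum p q
  swap a b := SemidirectProduct.inr (K.swap a b)
  perm_pull φ p := K.perm_pull φ p.right
  pull_id p := by
    refine SemidirectProduct.ext ?_ (K.pull_id _)
    funext k
    change p.left (permPush _ OrderHom.id k) = _
    rw [permPush_id]
    rfl
  pull_comp φ ψ p := by
    refine SemidirectProduct.ext ?_ (K.pull_comp _ _ _)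
    funext k
    change p.left (permPush _ (φ.comp ψ) k) =
      p.left (permPush _ φ (permPush (K.perm _ (K.pull φ p.right)) ψ k))
    rw [permPush_comp, K.perm_pull]
    rfl
  pull_mul φ p q := K.labelledPull_mul φ p q
  perm_sum p q := K.perm_sum p.right q.right
  sum_mul := K.labelledSum_mul
  pull_sum {a b c d} φ ψ p q := by
    refine SemidirectProduct.ext ?_ (K.pull_sum _ _ _ _)
    funext k
    change Fin.append p.left q.left
        (permPush (K.perm _ (K.sum p.right q.right)) (φ.sum ψ) k) =
      Fin.append (K.labelledPull φ p).left (K.labelledPull ψ q).left k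
    rw [K.perm_sum, permPush_sum]
    induction k using Fin.addCases with
    | left i =>
      rw [OrdMap.sum_castAdd, Fin.append_left, Fin.append_left]
      rfl
    | right i =>
      rw [OrdMap.sum_natAdd, Fin.append_right, Fin.append_right]
      rfl
  sum_assoc {a b c} p q r := by
    refine SemidirectProduct.ext ?_ (K.sum_assoc _ _ _)
    change (fun k => Fin.append p.left (Fin.append q.left r.left) (permPush _ _ k)) =
      Fin.append (Fin.append p.left q.left) r.left
    rw [Fin.append_assoc]
    funext k
    rw [permPush_cast]
    rfl
  sum_zero_left {n} p := by
    refine SemidirectProduct.ext ?_ (K.sum_zero_left _)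
    change Fin.append (1 : Fin 0 → G) p.left = fun k => p.left (permPush _ _ k)
    funext k
    rw [permPush_cast]
    induction k using Fin.addCases with
    | left i => exact i.elim0
    | right i =>
      rw [Fin.append_right]
      exact congrArg p.left (Fin.ext (by simp))
  sum_zero_right {n} p := by
    refine SemidirectProduct.ext ?_ (K.sum_zero_right _)
    change Fin.append p.left (1 : Fin 0 → G) = fun k => p.left (permPush _ _ k)
    funext k
    rw [permPush_cast]
    induction k using Fin.addCases with
    | left i =>
      rw [Fin.append_left]
      rfl
    | right i => exact i.elim0
  perm_swap a b := K.perm_swap a b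
  pull_swap φ ψ := congrArg SemidirectProduct.inr (K.pull_swap φ ψ)
  swap_mul_sum {a b} p q := by
    refine SemidirectProduct.ext ?_ (K.swap_mul_sum _ _)
    change (1 : Fin (a + b) → G) *
        (fun k => Fin.append p.left q.left ((K.perm _ (K.swap a b))⁻¹ k)) =
      (fun k => Fin.append q.left p.left (permPush _ (OrdMap.cast (Nat.add_comm a b)) k)) *
        (fun _ => 1)
    funext k
    rw [K.perm_swap, permPush_cast]
    obtain ⟨l, rfl⟩ := (permSwap a b).surjective k
    simp only [Pi.mul_apply, Pi.one_apply, one_mul, mul_one, Equiv.Perm.coe_inv,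
      Equiv.symm_apply_apply]
    induction l using Fin.addCases with
    | left i =>
      have h : OrdMap.cast (Nat.add_comm a b) (permSwap a b (Fin.castAdd b i)) = Fin.natAdd b i :=
        Fin.ext (by simp)
      rw [h, Fin.append_left, Fin.append_right]
    | right i =>
      have h : OrdMap.cast (Nat.add_comm a b) (permSwap a b (Fin.natAdd a i)) = Fin.castAdd a i :=
        Fin.ext (by simp)
      rw [h, Fin.append_left, Fin.append_right]
  swap_hexagon_forward a b c := by
    have h := congrArg (SemidirectProduct.inr : K.J (a + b + c) →* K.LabelledGroup G (a + b + c))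
      (K.swap_hexagon_forward a b c)
    rw [map_mul, ← labelledPull_inr, ← labelledPull_inr, ← labelledSum_inr, ← labelledSum_inr] at h
    exact h
  swap_hexagon_reverse a b c := by
    have h := congrArg (SemidirectProduct.inr : K.J (a + b + c) →* K.LabelledGroup G (a + b + c))
      (K.swap_hexagon_reverse a b c)
    rw [map_mul, ← labelledPull_inr, ← labelledPull_inr, ← labelledSum_inr, ← labelledSum_inr] at h
    exact h

end Labelled

end CrossedGroups

/-- The PROP `𝔻 ⊗ ℙ ⊗ 𝔾`: the objects are the natural numbers, and a morphism `n ⟶ m` is a pair of an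
order-preserving map from `n` to `m` and an element of `G ^ n ⋊ Σ_n`. -/
abbrev PropDPG (G : Type w) [Group G] := (CrossedGroups.symmetricGroups.labelled G).Obj

/-- The PROB `𝔻 ⊗ 𝔹 ⊗ 𝔾`: the objects are the natural numbers, and a morphism `n ⟶ m` is a pair of an
order-preserving map from `n` to `m` and an element of `G ^ n ⋊ B_n`. -/
abbrev ProbDBG (G : Type w) [Group G] := (CrossedGroups.braidGroups.labelled G).Obj

instance (G : Type w) [Group G] : SymmetricCategory (PropDPG G) :=
  CrossedGroups.symmetricCategory (fun a b => by
    have h := congrArg (SemidirectProduct.inr :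
      CrossedGroups.symmetricGroups.J (a + b) →*
        CrossedGroups.symmetricGroups.LabelledGroup G (a + b))
      (show CrossedGroups.symmetricGroups.pull (OrdMap.cast (Nat.add_comm a b))
        (CrossedGroups.symmetricGroups.swap b a) * CrossedGroups.symmetricGroups.swap a b = 1 from
          permSwap_symm a b)
    rw [map_mul, map_one] at h
    exact h)

/-- A monoidal category is strict if the tensor product is associative and unital on objects and
the associators and unitors are identities. -/
class IsStrictMonoidal (C : Type u) [Category.{v} C] [MonoidalCategory C] : Prop where
  tensor_assoc : ∀ X Y Z : C, (X ⊗ Y) ⊗ Z = X ⊗ (Y ⊗ Z)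
  unit_tensor : ∀ X : C, 𝟙_ C ⊗ X = X
  tensor_unit : ∀ X : C, X ⊗ 𝟙_ C = X
  associator_eq : ∀ X Y Z : C, α_ X Y Z = eqToIso (tensor_assoc X Y Z)
  leftUnitor_eq : ∀ X : C, λ_ X = eqToIso (unit_tensor X)
  rightUnitor_eq : ∀ X : C, ρ_ X = eqToIso (tensor_unit X)

instance (K : CrossedGroups.{u}) : IsStrictMonoidal K.Obj where
  tensor_assoc X Y Z := CrossedGroups.Obj.ext (Nat.add_assoc X.n Y.n Z.n)
  unit_tensor X := CrossedGroups.Obj.ext (Nat.zero_add X.n)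
  tensor_unit X := CrossedGroups.Obj.ext (Nat.add_zero X.n)
  associator_eq _ _ _ := rfl
  leftUnitor_eq _ := rfl
  rightUnitor_eq _ := rfl

section Alg

universe v₁ u₁ v₂ u₂

variable (P : Type u₁) [Category.{v₁} P] [MonoidalCategory P] [BraidedCategory P]
  (C : Type u₂) [Category.{v₂} C] [MonoidalCategory C] [BraidedCategory C]

/-- An algebra of `P` in `C`: a braided (strong) monoidal functor from `P` to `C`. If `P` and `C` are
symmetric, this is the same as a symmetric monoidal functor. -/
structure Alg where
  /-- the functor -/
  functor : P ⥤ C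
  /-- the structure of a braided monoidal functor -/
  [braided : functor.Braided]

attribute [instance] Alg.braided

variable {P C}

namespace Alg

/-- A morphism of algebras: a monoidal natural transformation. -/
@[ext]
structure Hom (A B : Alg P C) where
  /-- the natural transformation -/
  natTrans : A.functor ⟶ B.functor
  isMonoidal : NatTrans.IsMonoidal natTrans

attribute [instance] Hom.isMonoidal

instance : Category (Alg P C) where
  Hom := Hom
  id A := ⟨𝟙 A.functor, inferInstance⟩
  comp f g := ⟨f.natTrans ≫ g.natTrans, inferInstance⟩

/-- The algebra is a strict monoidal functor. -/
structure IsStrict (A : Alg P C) : Prop where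
  unit_eq : 𝟙_ C = A.functor.obj (𝟙_ P)
  tensor_eq : ∀ X Y : P, A.functor.obj X ⊗ A.functor.obj Y = A.functor.obj (X ⊗ Y)
  ε_eq : Functor.LaxMonoidal.ε A.functor = eqToHom unit_eq
  μ_eq : ∀ X Y : P, Functor.LaxMonoidal.μ A.functor X Y = eqToHom (tensor_eq X Y)

end Alg

variable (P C)

/-- The category of strict algebras: braided strict monoidal functors and monoidal natural
transformations. -/
abbrev StrictAlg := ObjectProperty.FullSubcategory (fun A : Alg P C => A.IsStrict)

end Alg

/-- The category of `G`-monoids in `C`: functors from the one-object groupoid `G` to monoids. -/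
abbrev GMon (G : Type w) [Group G] (C : Type u) [Category.{v} C] [MonoidalCategory C] :=
  SingleObj G ⥤ Mon C

/-- The category of `G`-comonoids in `C`: functors from the one-object groupoid `G` to comonoids. -/
abbrev GComon (G : Type w) [Group G] (C : Type u) [Category.{v} C] [MonoidalCategory C] :=
  SingleObj G ⥤ Comon C

end EquivariantPROP

open EquivariantPROP

/-! The object `1` of `𝔻 ⊗ 𝕁 ⊗ 𝔾` is a `G`-monoid: the maps `0 → 1` and `2 → 1` are the unit and the
multiplication, and the labels in `G` act on it. A strong monoidal functor carries it to a
`G`-monoid, and the theorem says that this evaluation at `1` loses nothing and reaches everything.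
The argument is the same for symmetric and braid groups. It is written for any family `K` of crossed
groups that is generated by crossings of adjacent strands (`GeneratedBySwap`) and acts suitably on
tensor powers (`PowRep`).

Fully faithful. Every object is a tensor power of `1`, so a monoidal transformation is determined by
its component there (`eq_extend`), and every morphism `f` at `1` has a unique candidate extension
`extend f`. The morphisms for which this candidate is natural are closed under composition, tensor
products and inverses. They contain the unit, the multiplication, the labels and the braiding of `1`
with itself as soon as `f` is a morphism of `G`-monoids, and these generate everything
(`morphismProperty_eq_top`).

Essentially surjective. A `G`-monoid with object `X` gives the functor `n ↦ X ^ n`: order-preserving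
maps act by iterated multiplication on fibres (`PowMon.ord`), labels act factorwise, and group
elements act through the braiding. Since a morphism is a pair `(φ, j)`, functoriality comes down to
the rule `j ∘ φ = j_⋆(φ) ∘ φ^⋆(j)` on tensor powers. The elements `j` that satisfy it form a
subgroup containing the generators: it is stable under juxtaposition, and for a block crossing it is
naturality of the braiding (`PowRep.compat`). Braid groups act because the braiding satisfies
Yang-Baxter. In a symmetric category the generators act as involutions, so positive permutation
braids give an action of the symmetric groups (`map_posBraid_mul`).

Comonoids are handled by duality: algebras of `Pᵒᵖ` in `C` are, contravariantly, algebras of `P` in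
`Cᵒᵖ`, and `G`-comonoids in `C` are, contravariantly, `G`-monoids in `Cᵒᵖ`. When `C` is strict, the
constructed algebra is strict because its structure maps are composites of associators and unitors.
Hence every algebra is isomorphic to a strict one, and strict algebras form an equivalent category.
-/

namespace EquivariantPROP

universe w v u w' v' u'

/-! ### Tensor powers and their coherence isomorphisms. -/

section TensorPower

variable {C : Type u} [Category.{v} C] [MonoidalCategory C]

/-- The tensor power `X ^ n`, bracketed from the left. -/
def tpow (X : C) : ℕ → C
  | 0 => 𝟙_ C
  | n + 1 => tpow X n ⊗ X

/-- The canonical isomorphism `X ^ a ⊗ X ^ b ≅ X ^ (a + b)`. -/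
def tpowAdd (X : C) (a : ℕ) : ∀ b : ℕ, tpow X a ⊗ tpow X b ≅ tpow X (a + b)
  | 0 => ρ_ _
  | b + 1 => (α_ _ _ _).symm ≪≫ whiskerRightIso (tpowAdd X a b) X

/-- The isomorphism of tensor powers given by an equality of exponents. -/
def tcast (X : C) {a b : ℕ} (h : a = b) : tpow X a ⟶ tpow X b :=
  eqToHom (congrArg (tpow X) h)

@[simp] theorem tcast_refl (X : C) {a : ℕ} (h : a = a) : tcast X h = 𝟙 _ := rfl

theorem eqToHom_whiskerRight_self {A B : C} (h : A = B) (X : C) (h' : A ⊗ X = B ⊗ X) :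
    eqToHom h ▷ X = eqToHom h' := by
  subst h
  exact id_whiskerRight _ _

/-- Whiskering `h` with `X` and moving associators by naturality and the pentagon gives the result.
This is the inductive step of `tpowAdd_assoc`, stated for arbitrary objects so that no exponent
occurs in the types. -/
theorem whiskerRight_assoc_step {A B D X E F H H' : C} {p : A ⊗ B ⟶ E} {q : E ⊗ D ⟶ H}
    {e : H ⟶ H'} {r : B ⊗ D ⟶ F} {s : A ⊗ F ⟶ H'} {e' : H ⊗ X ⟶ H' ⊗ X} (he : e' = e ▷ X)
    (h : p ▷ D ≫ q ≫ e = (α_ A B D).hom ≫ A ◁ r ≫ s) :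
    p ▷ (D ⊗ X) ≫ ((α_ E D X).inv ≫ q ▷ X) ≫ e' =
      (α_ A B (D ⊗ X)).hom ≫ A ◁ ((α_ B D X).inv ≫ r ▷ X) ≫ (α_ A F X).inv ≫ s ▷ X := by
  have h' := congrArg (fun t => t ▷ X) h
  simp only [comp_whiskerRight] at h'
  rw [he, Category.assoc, associator_inv_naturality_left_assoc, h']
  simp

theorem whiskerRight_unit_step {B X E : C} {p : 𝟙_ C ⊗ B ⟶ E} {e : E ⟶ B}
    {e' : E ⊗ X ⟶ B ⊗ X} (he : e' = e ▷ X) (h : p ≫ e = (λ_ B).hom) :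
    ((α_ (𝟙_ C) B X).inv ≫ p ▷ X) ≫ e' = (λ_ (B ⊗ X)).hom := by
  rw [he, Category.assoc, ← comp_whiskerRight, h]
  simp

theorem tpowAdd_zero (X : C) (a : ℕ) : tpowAdd X a 0 = ρ_ (tpow X a) := rfl

theorem tpowAdd_succ (X : C) (a b : ℕ) : (tpowAdd X a (b + 1)).hom =
    (α_ (tpow X a) (tpow X b) X).inv ≫ (tpowAdd X a b).hom ▷ X := rfl

/-- With `zero_tpowAdd`, this is the coherence needed to make `n ↦ X ^ n` monoidal. Induction is on
the last exponent because both `tpow` and addition recurse there; the remaining mismatch of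
exponents is absorbed by `tcast`. -/
theorem tpowAdd_assoc (X : C) (a b c : ℕ) :
    (tpowAdd X a b).hom ▷ tpow X c ≫ (tpowAdd X (a + b) c).hom ≫ tcast X (Nat.add_assoc a b c) =
      (α_ _ _ _).hom ≫ tpow X a ◁ (tpowAdd X b c).hom ≫ (tpowAdd X a (b + c)).hom := by
  induction c with
  | zero =>
    change (tpowAdd X a b).hom ▷ 𝟙_ C ≫ (ρ_ _).hom ≫ 𝟙 _ =
      (α_ _ _ (𝟙_ C)).hom ≫ tpow X a ◁ (ρ_ _).hom ≫ (tpowAdd X a b).hom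
    simp
  | succ c ih =>
    exact whiskerRight_assoc_step (eqToHom_whiskerRight_self _ X _).symm ih

theorem zero_tpowAdd (X : C) (b : ℕ) :
    (tpowAdd X 0 b).hom ≫ tcast X (Nat.zero_add b) = (λ_ (tpow X b)).hom := by
  induction b with
  | zero =>
    change (ρ_ (𝟙_ C)).hom ≫ 𝟙 _ = (λ_ (𝟙_ C)).hom
    rw [Category.comp_id, unitors_equal]
  | succ b ih =>
    exact whiskerRight_unit_step (eqToHom_whiskerRight_self _ X _).symm ih

/-- With its converse `heq_tcast`, this passes between two forms of equality across equal exponents: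
`HEq`, which is a congruence for `≫` and `tens`, and equations with `tcast`, which can be rewritten.
-/
theorem tcast_heq (X : C) {a b a' b' : ℕ} {f : tpow X a ⟶ tpow X b} {g : tpow X a' ⟶ tpow X b'}
    (h : a = a') (h' : b = b') (e : f ≫ tcast X h' = tcast X h ≫ g) : HEq f g := by
  subst h h'
  simpa using e

theorem heq_tcast {X : C} {a b a' b' : ℕ} {f : tpow X a ⟶ tpow X b} {g : tpow X a' ⟶ tpow X b'}
    (e : HEq f g) (h : a = a') (h' : b = b') : f ≫ tcast X h' = tcast X h ≫ g := by
  subst h h'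
  simp [eq_of_heq e]

theorem tcast_comp_heq {X : C} {a b c : ℕ} (h : a = b) (f : tpow X b ⟶ tpow X c) :
    HEq (tcast X h ≫ f) f := by
  subst h
  simp

theorem comp_tcast_heq {X : C} {a b c : ℕ} (h : b = c) (f : tpow X a ⟶ tpow X b) :
    HEq (f ≫ tcast X h) f := by
  subst h
  simp

theorem comp_heq_comp {X : C} {a b c a' b' c' : ℕ} {f : tpow X a ⟶ tpow X b}
    {g : tpow X b ⟶ tpow X c} {f' : tpow X a' ⟶ tpow X b'} {g' : tpow X b' ⟶ tpow X c'}
    (ha : a = a') (hb : b = b') (hc : c = c') (hf : HEq f f') (hg : HEq g g') :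
    HEq (f ≫ g) (f' ≫ g') := by
  subst ha hb hc
  rw [eq_of_heq hf, eq_of_heq hg]

theorem id_heq_id (X : C) {a b : ℕ} (h : a = b) : HEq (𝟙 (tpow X a)) (𝟙 (tpow X b)) := by
  subst h
  rfl

/-- The tensor product of morphisms between tensor powers. -/
def tens {X : C} {a b c d : ℕ} (f : tpow X a ⟶ tpow X c) (g : tpow X b ⟶ tpow X d) :
    tpow X (a + b) ⟶ tpow X (c + d) :=
  (tpowAdd X a b).inv ≫ (f ⊗ₘ g) ≫ (tpowAdd X c d).hom

theorem tpowAdd_tens {X : C} {a b c d : ℕ} (f : tpow X a ⟶ tpow X c) (g : tpow X b ⟶ tpow X d) :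
    (tpowAdd X a b).hom ≫ tens f g = (f ⊗ₘ g) ≫ (tpowAdd X c d).hom := by
  simp [tens]

theorem tens_id (X : C) (a b : ℕ) : tens (𝟙 (tpow X a)) (𝟙 (tpow X b)) = 𝟙 _ := by
  simp [tens]

theorem tens_comp_tens {X : C} {a b c a' b' c' : ℕ} (f : tpow X a ⟶ tpow X b)
    (g : tpow X b ⟶ tpow X c) (f' : tpow X a' ⟶ tpow X b') (g' : tpow X b' ⟶ tpow X c') :
    tens f f' ≫ tens g g' = tens (f ≫ g) (f' ≫ g') := by
  simp [tens]

theorem tens_heq_tens {X : C} {a b c d a' b' c' d' : ℕ} {f : tpow X a ⟶ tpow X c}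
    {g : tpow X b ⟶ tpow X d} {f' : tpow X a' ⟶ tpow X c'} {g' : tpow X b' ⟶ tpow X d'}
    (ha : a = a') (hb : b = b') (hc : c = c') (hd : d = d') (hf : HEq f f') (hg : HEq g g') :
    HEq (tens f g) (tens f' g') := by
  subst ha hb hc hd
  rw [eq_of_heq hf, eq_of_heq hg]

/-- After precomposition with the isomorphisms from `(X ^ a ⊗ X ^ b) ⊗ X ^ c`, coherence of
`tpowAdd` reduces the claim to naturality of the associator. -/
theorem tens_assoc {X : C} {a b c a' b' c' : ℕ} (f : tpow X a ⟶ tpow X a')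
    (g : tpow X b ⟶ tpow X b') (h : tpow X c ⟶ tpow X c') :
    HEq (tens (tens f g) h) (tens f (tens g h)) := by
  refine tcast_heq X (Nat.add_assoc a b c) (Nat.add_assoc a' b' c') ?_
  rw [← cancel_epi (tpowAdd X (a + b) c).hom, ← cancel_epi ((tpowAdd X a b).hom ▷ tpow X c)]
  have h1 := tpowAdd_assoc X a b c
  have h2 := tpowAdd_assoc X a' b' c'
  calc (tpowAdd X a b).hom ▷ tpow X c ≫ (tpowAdd X (a + b) c).hom ≫ tens (tens f g) h ≫
        tcast X (Nat.add_assoc a' b' c')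
    _ = ((f ⊗ₘ g) ⊗ₘ h) ≫ (tpowAdd X a' b').hom ▷ tpow X c' ≫ (tpowAdd X (a' + b') c').hom ≫
        tcast X (Nat.add_assoc a' b' c') := by
        rw [reassoc_of% (tpowAdd_tens (tens f g) h), ← tensorHom_id, ← tensorHom_id,
          tensorHom_comp_tensorHom_assoc, tensorHom_comp_tensorHom_assoc, tpowAdd_tens,
          Category.id_comp, Category.comp_id]
    _ = (α_ _ _ _).hom ≫ (f ⊗ₘ (g ⊗ₘ h)) ≫ tpow X a' ◁ (tpowAdd X b' c').hom ≫
        (tpowAdd X a' (b' + c')).hom := by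
        rw [h2, associator_naturality_assoc]
    _ = (α_ _ _ _).hom ≫ tpow X a ◁ (tpowAdd X b c).hom ≫ (tpowAdd X a (b + c)).hom ≫
        tens f (tens g h) := by
        rw [tpowAdd_tens f (tens g h), ← id_tensorHom, ← id_tensorHom,
          tensorHom_comp_tensorHom_assoc, tensorHom_comp_tensorHom_assoc, tpowAdd_tens,
          Category.id_comp, Category.comp_id]
    _ = _ := by
        rw [← reassoc_of% h1]

theorem zero_tens {X : C} {a b : ℕ} (f : tpow X a ⟶ tpow X b) :
    HEq (tens (𝟙 (tpow X 0)) f) f := by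
  refine tcast_heq X (Nat.zero_add a) (Nat.zero_add b) ?_
  rw [← cancel_epi (tpowAdd X 0 a).hom, ← Category.assoc, tpowAdd_tens, Category.assoc,
    zero_tpowAdd, ← Category.assoc, zero_tpowAdd]
  rw [id_tensorHom]
  exact leftUnitor_naturality f

/-- A genuine equality, in contrast to `zero_tens`, because `a + 0` reduces to `a` while `0 + a`
does not. -/
theorem tens_zero {X : C} {a b : ℕ} (f : tpow X a ⟶ tpow X b) :
    tens f (𝟙 (tpow X 0)) = f := by
  rw [← cancel_epi (tpowAdd X a 0).hom, tpowAdd_tens]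
  rw [tensorHom_id]
  exact rightUnitor_naturality f

end TensorPower

/-! ### Braidings of tensor powers and the Yang-Baxter equation. -/

section TensorPower

variable {C : Type u} [Category.{v} C] [MonoidalCategory C]

theorem tcast_trans (X : C) {a b c : ℕ} (h : a = b) (h' : b = c) :
    tcast X h ≫ tcast X h' = tcast X (h.trans h') := by
  subst h h'
  simp

theorem tpowAdd_assoc_inv (X : C) (a b c : ℕ) :
    tpow X a ◁ (tpowAdd X b c).hom ≫ (tpowAdd X a (b + c)).hom ≫
        tcast X (Nat.add_assoc a b c).symm =
      (α_ _ _ _).inv ≫ (tpowAdd X a b).hom ▷ tpow X c ≫ (tpowAdd X (a + b) c).hom := by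
  rw [← cancel_epi (α_ _ _ _).hom, ← reassoc_of% (tpowAdd_assoc X a b c), tcast_trans]
  simp

variable [BraidedCategory C]

/-- The braiding of tensor powers. -/
def tbraid (X : C) (a b : ℕ) : tpow X (a + b) ⟶ tpow X (b + a) :=
  (tpowAdd X a b).inv ≫ (β_ (tpow X a) (tpow X b)).hom ≫ (tpowAdd X b a).hom

theorem tpowAdd_tbraid (X : C) (a b : ℕ) :
    (tpowAdd X a b).hom ≫ tbraid X a b = (β_ (tpow X a) (tpow X b)).hom ≫ (tpowAdd X b a).hom := by
  simp [tbraid]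

instance (X : C) (a b : ℕ) : IsIso (tbraid X a b) := by
  unfold tbraid
  infer_instance

theorem tens_tbraid {X : C} {a b c d : ℕ} (f : tpow X a ⟶ tpow X c) (g : tpow X b ⟶ tpow X d) :
    tens f g ≫ tbraid X c d = tbraid X a b ≫ tens g f := by
  simp [tens, tbraid]

/-- In a braided category the braiding with the unit object is a composite of unitors, and between
tensor powers unitors become changes of exponent. -/
theorem tbraid_zero_right (X : C) (a : ℕ) :
    tbraid X a 0 = tcast X (Nat.zero_add a).symm := by
  have h : tbraid X a 0 ≫ tcast X (Nat.zero_add a) = 𝟙 _ := by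
    rw [← cancel_epi (tpowAdd X a 0).hom, reassoc_of% (tpowAdd_tbraid X a 0), zero_tpowAdd]
    refine (congrArg (fun t => t ≫ (λ_ (tpow X a)).hom)
      (braiding_tensorUnit_right (tpow X a))).trans ?_
    simp [tpowAdd_zero]
  calc tbraid X a 0 = (tbraid X a 0 ≫ tcast X (Nat.zero_add a)) ≫ tcast X (Nat.zero_add a).symm := by
        rw [Category.assoc, tcast_trans, tcast_refl, Category.comp_id]
    _ = _ := by rw [h]; exact Category.id_comp _

theorem tbraid_zero_left (X : C) (a : ℕ) :
    tbraid X 0 a = tcast X (Nat.zero_add a) := by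
  rw [← cancel_epi (tpowAdd X 0 a).hom, zero_tpowAdd, tpowAdd_tbraid]
  refine (congrArg (fun t => t ≫ (tpowAdd X a 0).hom)
      (braiding_tensorUnit_left (tpow X a))).trans ?_
  rw [tpowAdd_zero]
  exact (Category.assoc _ _ _).trans ((congrArg (fun t => (λ_ (tpow X a)).hom ≫ t)
    (ρ_ (tpow X a)).inv_hom_id).trans (Category.comp_id _))

/-- The first hexagon axiom, transported to tensor powers; `tbraid_add_left` is the second. -/
theorem tbraid_add_right (X : C) (a b c : ℕ) :
    tcast X (Nat.add_assoc a b c) ≫ tbraid X a (b + c) ≫ tcast X (Nat.add_assoc b c a) =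
      tens (tbraid X a b) (𝟙 (tpow X c)) ≫ tcast X (Nat.add_assoc b a c) ≫
        tens (𝟙 (tpow X b)) (tbraid X a c) := by
  rw [← cancel_epi (tpowAdd X (a + b) c).hom, ← cancel_epi ((tpowAdd X a b).hom ▷ tpow X c)]
  rw [reassoc_of% (tpowAdd_assoc X a b c), reassoc_of% (tpowAdd_tbraid X a (b + c)),
    BraidedCategory.braiding_naturality_right_assoc, tpowAdd_assoc,
    reassoc_of% (tpowAdd_tens (tbraid X a b) (𝟙 (tpow X c))), tensorHom_id,
    ← comp_whiskerRight_assoc, tpowAdd_tbraid, comp_whiskerRight_assoc,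
    reassoc_of% (tpowAdd_assoc X b a c), tpowAdd_tens, id_tensorHom, ← whiskerLeft_comp_assoc,
    tpowAdd_tbraid, whiskerLeft_comp_assoc, BraidedCategory.hexagon_forward_assoc]

theorem tbraid_add_left (X : C) (a b c : ℕ) :
    tcast X (Nat.add_assoc a b c).symm ≫ tbraid X (a + b) c ≫ tcast X (Nat.add_assoc c a b).symm =
      tens (𝟙 (tpow X a)) (tbraid X b c) ≫ tcast X (Nat.add_assoc a c b).symm ≫
        tens (tbraid X a c) (𝟙 (tpow X b)) := by
  rw [← cancel_epi (tpowAdd X a (b + c)).hom, ← cancel_epi (tpow X a ◁ (tpowAdd X b c).hom)]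
  rw [reassoc_of% (tpowAdd_assoc_inv X a b c), reassoc_of% (tpowAdd_tbraid X (a + b) c),
    BraidedCategory.braiding_naturality_left_assoc, tpowAdd_assoc_inv,
    reassoc_of% (tpowAdd_tens (𝟙 (tpow X a)) (tbraid X b c)), id_tensorHom,
    ← whiskerLeft_comp_assoc, tpowAdd_tbraid, whiskerLeft_comp_assoc,
    reassoc_of% (tpowAdd_assoc_inv X a c b), tpowAdd_tens, tensorHom_id, ← comp_whiskerRight_assoc,
    tpowAdd_tbraid, comp_whiskerRight_assoc, BraidedCategory.hexagon_reverse_assoc]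

/-- By the hexagon, `s ≫ t` is the braiding of `X` with `X ^ 2`; naturality then slides the braiding
inside `X ^ 2` through it, turning `t` into `s`. Taking `s` and `t` as variables keeps the exponent
`3` fixed. -/
theorem tbraid_yang_baxter {X : C} {s t : tpow X 3 ⟶ tpow X 3}
    (hs : HEq s (tens (tbraid X 1 1) (𝟙 (tpow X 1))))
    (ht : HEq t (tens (𝟙 (tpow X 1)) (tbraid X 1 1))) : s ≫ t ≫ s = t ≫ s ≫ t := by
  have h : tbraid X 1 2 = s ≫ t := by
    refine Eq.trans ?_ ((tbraid_add_right X 1 1 1).trans ?_)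
    · exact ((Category.id_comp _).trans (Category.comp_id _)).symm
    · rw [eq_of_heq hs, eq_of_heq ht]
      exact congrArg (fun r => _ ≫ r) (Category.id_comp _)
  have h' : t ≫ tbraid X 1 2 = tbraid X 1 2 ≫ s := by
    rw [eq_of_heq hs, eq_of_heq ht]
    exact tens_tbraid (𝟙 (tpow X 1)) (tbraid X 1 1)
  rw [h, Category.assoc] at h'
  exact h'.symm

end TensorPower

/-! ### Decomposition of order-preserving maps. -/

namespace OrdMap

theorem heq_of_val {n m n' m' : ℕ} {φ : OrdMap n m} {ψ : OrdMap n' m'} (hn : n = n') (hm : m = m')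
    (h : ∀ x : Fin n, (φ x : ℕ) = ψ (Fin.cast hn x)) : HEq φ ψ := by
  subst hn hm
  refine heq_of_eq ?_
  ext x
  exact h x

theorem comp_cast_refl {n m : ℕ} (φ : OrdMap n m) (h : n = n) : φ.comp (OrdMap.cast h) = φ := rfl

theorem cast_refl {n : ℕ} (h : n = n) : OrdMap.cast h = OrderHom.id := rfl

instance {n : ℕ} : Subsingleton (OrdMap n 1) :=
  ⟨fun _ _ => OrderHom.ext _ _ (funext fun _ => Subsingleton.elim _ _)⟩

instance {m : ℕ} : Subsingleton (OrdMap 0 m) :=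
  ⟨fun _ _ => OrderHom.ext _ _ (funext fun x => x.elim0)⟩

theorem eq_zero {n : ℕ} (φ : OrdMap n 0) : n = 0 := by
  by_contra h
  exact (φ ⟨0, Nat.pos_of_ne_zero h⟩).elim0

/-- The unique map to a one-element set. -/
def toOne (n : ℕ) : OrdMap n 1 where
  toFun _ := 0
  monotone' _ _ _ := le_rfl

/-- The preimage of an initial segment under an order-preserving map is an initial segment. -/
theorem exists_threshold {n m : ℕ} (φ : OrdMap n m) (c : ℕ) :
    ∃ a, a ≤ n ∧ ∀ x : Fin n, (φ x : ℕ) < c ↔ (x : ℕ) < a := by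
  induction n with
  | zero => exact ⟨0, le_rfl, fun x => x.elim0⟩
  | succ n ih =>
    by_cases h : (φ (Fin.last n) : ℕ) < c
    · refine ⟨n + 1, le_rfl, fun x => ⟨fun _ => x.isLt, fun _ => lt_of_le_of_lt ?_ h⟩⟩
      exact φ.monotone (Fin.le_last x)
    · obtain ⟨a, ha, hx⟩ := ih ⟨fun x => φ x.castSucc, fun x y h => φ.monotone h⟩
      refine ⟨a, by omega, fun x => ?_⟩
      induction x using Fin.lastCases with
      | last => simp only [h, Fin.val_last, false_iff]; omega
      | cast x => exact hx x

/-- An order-preserving map to `{0, …, c + d - 1}` is a sum of order-preserving maps. -/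
theorem exists_eq_sum {n c d : ℕ} (φ : OrdMap n (c + d)) :
    ∃ (a b : ℕ) (h : n = a + b) (φ₁ : OrdMap a c) (φ₂ : OrdMap b d),
      φ = (φ₁.sum φ₂).comp (OrdMap.cast h) := by
  obtain ⟨a, ha, hx⟩ := exists_threshold φ c
  obtain ⟨b, rfl⟩ := Nat.exists_eq_add_of_le ha
  refine ⟨a, b, rfl, ⟨fun x => ⟨φ (Fin.castAdd b x), (hx _).2 x.isLt⟩, fun x y h => ?_⟩,
    ⟨fun y => ⟨φ (Fin.natAdd a y) - c, ?_⟩, fun x y h => ?_⟩, ?_⟩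
  · exact φ.monotone (show Fin.castAdd b x ≤ Fin.castAdd b y from h)
  · have h1 := (φ (Fin.natAdd a y)).isLt
    -- Past the threshold the values are at least `c`, so the truncated subtraction of `c` is exact.
    have h2 := (hx (Fin.natAdd a y)).not.2 (by simp)
    omega
  · exact Nat.sub_le_sub_right (φ.monotone (Nat.add_le_add_left h a)) c
  · ext x
    induction x using Fin.addCases with
    | left x => rw [comp_cast_refl, sum_castAdd]; rfl
    | right x =>
      rw [comp_cast_refl, sum_natAdd]
      have h2 := (hx (Fin.natAdd a x)).not.2 (by simp)
      change (φ (Fin.natAdd a x) : ℕ) = c + (φ (Fin.natAdd a x) - c)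
      omega

/-- The number `a` counts the elements mapped below `c`, so it depends on the map and not on its
decomposition. -/
theorem sum_left_unique {a b a' b' c d : ℕ} {φ₁ : OrdMap a c} {φ₂ : OrdMap b d}
    {ψ₁ : OrdMap a' c} {ψ₂ : OrdMap b' d} (h : a + b = a' + b')
    (e : φ₁.sum φ₂ = (ψ₁.sum ψ₂).comp (OrdMap.cast h)) : a = a' := by
  have key : ∀ {a b a' b' : ℕ} {φ₁ : OrdMap a c} {φ₂ : OrdMap b d}
      {ψ₁ : OrdMap a' c} {ψ₂ : OrdMap b' d} (h : a + b = a' + b'),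
      φ₁.sum φ₂ = (ψ₁.sum ψ₂).comp (OrdMap.cast h) → a ≤ a' := by
    intro a b a' b' φ₁ φ₂ ψ₁ ψ₂ h e
    by_contra hlt
    have hb : 0 < b' := by omega
    -- If `a' < a`, the element `a'` lies in the first block on the left and opens the second block
    -- on the right; its value would be both below `c` and at least `c`.
    have e1 := congrArg (fun f => (f (Fin.castAdd b ⟨a', by omega⟩) : ℕ)) e
    have e2 : OrdMap.cast h (Fin.castAdd b ⟨a', by omega⟩) = Fin.natAdd a' ⟨0, hb⟩ := rfl
    simp only [sum_castAdd, OrderHom.comp_coe, Function.comp_apply, e2, sum_natAdd,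
      Fin.val_castAdd, Fin.val_natAdd] at e1
    have := (φ₁ ⟨a', by omega⟩).isLt
    omega
  refine le_antisymm (key h e) (key h.symm (φ₁ := ψ₁) (φ₂ := ψ₂) (ψ₁ := φ₁) (ψ₂ := φ₂) ?_)
  rw [e]
  rfl

theorem sum_left_inj {a b c d : ℕ} {φ₁ ψ₁ : OrdMap a c} {φ₂ ψ₂ : OrdMap b d}
    (e : φ₁.sum φ₂ = ψ₁.sum ψ₂) : φ₁ = ψ₁ := by
  ext x
  have := congrArg (fun f => (f (Fin.castAdd b x) : ℕ)) e
  simpa using this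

theorem val_sum {a b c d : ℕ} (φ : OrdMap a c) (ψ : OrdMap b d) (x : Fin (a + b)) :
    (φ.sum ψ x : ℕ) = if h : (x : ℕ) < a then (φ ⟨x, h⟩ : ℕ) else c + ψ ⟨x - a, by omega⟩ := by
  induction x using Fin.addCases with
  | left x => simp
  | right x => simp

theorem sum_assoc {a b c a' b' c' : ℕ} (φ : OrdMap a a') (ψ : OrdMap b b') (χ : OrdMap c c') :
    HEq ((φ.sum ψ).sum χ) (φ.sum (ψ.sum χ)) := by
  refine heq_of_val (Nat.add_assoc _ _ _) (Nat.add_assoc _ _ _) (fun x => ?_)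
  simp only [val_sum, Fin.val_cast]
  split_ifs
  any_goals first | rfl | omega
  simp only [Nat.add_assoc, Nat.sub_sub]

theorem sum_zero {a b c : ℕ} (φ : OrdMap a c) (ψ : OrdMap b 0) (h : b = 0) :
    HEq (φ.sum ψ) φ := by
  subst h
  refine heq_of_eq ?_
  ext x
  rw [val_sum, dif_pos (show (x : ℕ) < a from x.isLt)]
  rfl

theorem zero_sum {b d : ℕ} (φ : OrdMap 0 0) (ψ : OrdMap b d) : HEq (φ.sum ψ) ψ := by
  refine heq_of_val (Nat.zero_add _) (Nat.zero_add _) (fun x => ?_)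
  rw [val_sum, dif_neg (by simp), Nat.zero_add]
  rfl

end OrdMap

/-! ### Iterated multiplication: monoids and order-preserving maps. -/

section TensorPower

variable {C : Type u} [Category.{v} C] [MonoidalCategory C]

/-- A monoid structure on the first tensor power. -/
structure PowMon (X : C) where
  one : tpow X 0 ⟶ tpow X 1
  mul : tpow X (1 + 1) ⟶ tpow X 1
  one_mul : HEq (tens one (𝟙 (tpow X 1)) ≫ mul) (𝟙 (tpow X 1))
  mul_one : HEq (tens (𝟙 (tpow X 1)) one ≫ mul) (𝟙 (tpow X 1))
  mul_assoc : HEq (tens mul (𝟙 (tpow X 1)) ≫ mul) (tens (𝟙 (tpow X 1)) mul ≫ mul)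

namespace PowMon

variable {X : C} (M : PowMon X)

/-- The iterated multiplication. -/
def mulN : ∀ n : ℕ, tpow X n ⟶ tpow X 1
  | 0 => M.one
  | n + 1 => tens (mulN n) (𝟙 (tpow X 1)) ≫ M.mul

theorem mulN_succ (n : ℕ) : M.mulN (n + 1) = tens (M.mulN n) (𝟙 (tpow X 1)) ≫ M.mul := rfl

/-- By definition `mulN 1` is the unit tensored with the identity, then multiplied, so this is the
left unit law. -/
theorem mulN_one : M.mulN 1 = 𝟙 _ := eq_of_heq M.one_mul

/-- General associativity: induction on `b`, with the right unit law as base and associativity as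
step. -/
theorem mulN_add (a b : ℕ) : M.mulN (a + b) = tens (M.mulN a) (M.mulN b) ≫ M.mul := by
  induction b with
  | zero =>
    have h : tens (M.mulN a) M.one = tens (M.mulN a) (𝟙 (tpow X 0)) ≫ tens (𝟙 (tpow X 1)) M.one := by
      rw [tens_comp_tens, Category.comp_id, Category.id_comp]
    change _ = tens (M.mulN a) M.one ≫ M.mul
    rw [h, tens_zero, Category.assoc]
    exact ((congrArg (fun t => M.mulN a ≫ t) (eq_of_heq M.mul_one)).trans (Category.comp_id _)).symm
  | succ b ih =>
    have h1 : tens (tens (M.mulN a) (M.mulN b) ≫ M.mul) (𝟙 (tpow X 1)) =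
        tens (tens (M.mulN a) (M.mulN b)) (𝟙 (tpow X 1)) ≫ tens M.mul (𝟙 (tpow X 1)) := by
      rw [tens_comp_tens, Category.id_comp]
    have h2 : tens (M.mulN a) (tens (M.mulN b) (𝟙 (tpow X 1)) ≫ M.mul) =
        tens (M.mulN a) (tens (M.mulN b) (𝟙 (tpow X 1))) ≫ tens (𝟙 (tpow X 1)) M.mul := by
      rw [tens_comp_tens, Category.comp_id]
    rw [mulN_succ M b, h2, Category.assoc]
    refine eq_of_heq (HEq.trans (heq_of_eq (M.mulN_succ (a + b))) ?_)
    rw [ih, h1, Category.assoc]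
    exact comp_heq_comp (Nat.add_assoc _ _ _) (Nat.add_assoc _ _ _) rfl (tens_assoc _ _ _)
      M.mul_assoc

/-- The action of the order-preserving maps on the tensor powers of a monoid. -/
noncomputable def ord : ∀ {m n : ℕ}, OrdMap n m → (tpow X n ⟶ tpow X m)
  | 0, _, φ => tcast X φ.eq_zero
  | m + 1, _, φ =>
    tcast X (OrdMap.exists_eq_sum (c := m) φ).choose_spec.choose_spec.choose ≫
      tens (ord (OrdMap.exists_eq_sum (c := m) φ).choose_spec.choose_spec.choose_spec.choose)
        (M.mulN (OrdMap.exists_eq_sum (c := m) φ).choose_spec.choose)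

theorem ord_heq {n m n' m' : ℕ} {φ : OrdMap n m} {ψ : OrdMap n' m'} (hn : n = n') (hm : m = m')
    (h : HEq φ ψ) : HEq (M.ord φ) (M.ord ψ) := by
  subst hn hm
  rw [eq_of_heq h]

/-- Shows that the decomposition chosen in `ord` is immaterial: the sizes of the blocks and the
first summand are unique, and the second summand enters only through its size. -/
theorem tens_ord_mulN_unique {a b a' b' m : ℕ} {φ : OrdMap a m} {ψ : OrdMap b 1}
    {φ' : OrdMap a' m} {ψ' : OrdMap b' 1} (h : a + b = a' + b')
    (e : φ.sum ψ = (φ'.sum ψ').comp (OrdMap.cast h)) :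
    tcast X h ≫ tens (M.ord φ') (M.mulN b') = tens (M.ord φ) (M.mulN b) := by
  obtain rfl := OrdMap.sum_left_unique _ e
  obtain rfl := Nat.add_left_cancel h
  rw [OrdMap.comp_cast_refl] at e
  rw [OrdMap.sum_left_inj e, tcast_refl, Category.id_comp]

theorem ord_sum_toOne {a b m : ℕ} (φ : OrdMap a m) (ψ : OrdMap b 1) :
    M.ord (φ.sum ψ) = tens (M.ord φ) (M.mulN b) := by
  rw [ord]
  exact M.tens_ord_mulN_unique _
    (OrdMap.exists_eq_sum (φ.sum ψ)).choose_spec.choose_spec.choose_spec.choose_spec.choose_spec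

theorem ord_zero {n : ℕ} (φ : OrdMap n 0) : M.ord φ = tcast X φ.eq_zero := by
  rw [ord]

theorem ord_comp_cast {n n' m : ℕ} (φ : OrdMap n m) (h : n' = n) :
    M.ord (φ.comp (OrdMap.cast h)) = tcast X h ≫ M.ord φ := by
  subst h
  rw [tcast_refl, Category.id_comp]
  rfl

/-- The map is read as a sum with the identity of `0`, to which `ord_sum_toOne` applies. -/
theorem ord_to_one {n : ℕ} (φ : OrdMap n 1) : M.ord φ = M.mulN n := by
  have h := M.ord_sum_toOne (OrderHom.id : OrdMap 0 0) φ
  rw [M.ord_zero, tcast_refl] at h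
  refine eq_of_heq ((M.ord_heq (Nat.zero_add n).symm rfl ?_).trans ((heq_of_eq h).trans ?_))
  · exact (OrdMap.zero_sum _ φ).symm
  · exact zero_tens _

/-- Induction on the target of `ψ`: its last fibre is split off and the sum is rebracketed on both
sides. -/
theorem ord_sum {a b c d : ℕ} (φ : OrdMap a c) (ψ : OrdMap b d) :
    M.ord (φ.sum ψ) = tens (M.ord φ) (M.ord ψ) := by
  induction d generalizing b with
  | zero =>
    obtain rfl := ψ.eq_zero
    rw [M.ord_zero ψ, tcast_refl, tens_zero]
    exact congrArg M.ord (eq_of_heq (OrdMap.sum_zero φ ψ rfl))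
  | succ d ih =>
    obtain ⟨k, l, rfl, ψ₁, ψ₂, rfl⟩ := ψ.exists_eq_sum
    rw [OrdMap.comp_cast_refl, M.ord_sum_toOne ψ₁]
    refine eq_of_heq ((M.ord_heq (Nat.add_assoc a k l).symm (Nat.add_assoc c d 1).symm
      (OrdMap.sum_assoc φ ψ₁ ψ₂).symm).trans ?_)
    rw [M.ord_sum_toOne (φ.sum ψ₁), ih]
    exact tens_assoc _ _ _

theorem ord_id (n : ℕ) : M.ord (OrderHom.id : OrdMap n n) = 𝟙 _ := by
  induction n with
  | zero => exact M.ord_zero _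
  | succ n ih =>
    have h : (OrderHom.id : OrdMap (n + 1) (n + 1)) =
      OrdMap.sum (OrderHom.id : OrdMap n n) (OrderHom.id : OrdMap 1 1) :=
        (CrossedGroups.sum_id n 1).symm
    rw [h, M.ord_sum_toOne, ih, mulN_one, tens_id]

theorem ord_cast {n m : ℕ} (h : n = m) : M.ord (OrdMap.cast h) = tcast X h := by
  subst h
  exact M.ord_id n

theorem ord_comp_mulN {l k : ℕ} (ψ : OrdMap l k) : M.ord ψ ≫ M.mulN k = M.mulN l := by
  induction k generalizing l with
  | zero =>
    obtain rfl := ψ.eq_zero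
    rw [M.ord_zero, tcast_refl, Category.id_comp]
  | succ k ih =>
    obtain ⟨a, b, rfl, ψ₁, ψ₂, rfl⟩ := ψ.exists_eq_sum
    rw [OrdMap.comp_cast_refl, M.ord_sum_toOne, mulN_succ, ← Category.assoc, tens_comp_tens, ih,
      Category.comp_id, mulN_add]

/-- Functoriality holds one fibre of `φ` at a time: the decomposition of `φ` induces one of `ψ`, and
over the last point the claim is `ord_comp_mulN`, that is, general associativity. -/
theorem ord_comp {l n m : ℕ} (φ : OrdMap n m) (ψ : OrdMap l n) :
    M.ord (φ.comp ψ) = M.ord ψ ≫ M.ord φ := by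
  induction m generalizing l n with
  | zero =>
    obtain rfl := φ.eq_zero
    obtain rfl := ψ.eq_zero
    rw [M.ord_zero, M.ord_zero, M.ord_zero, tcast_trans]
  | succ m ih =>
    obtain ⟨a, b, rfl, φ₁, φ₂, rfl⟩ := φ.exists_eq_sum
    obtain ⟨c, d, rfl, ψ₁, ψ₂, rfl⟩ := ψ.exists_eq_sum
    rw [OrdMap.comp_cast_refl, OrdMap.comp_cast_refl, ← CrossedGroups.sum_comp, M.ord_sum_toOne,
      M.ord_sum_toOne, M.ord_sum, tens_comp_tens, ih, M.ord_comp_mulN]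

end PowMon

end TensorPower

/-! ### The action of the labels. -/

section TensorPower

variable {C : Type u} [Category.{v} C] [MonoidalCategory C] {X : C}

section Labels

variable {G : Type w} [Group G] (γ : G →* End (tpow X 1))

/-- The action of `G ^ n` on the `n`-th tensor power. -/
def labels : ∀ {n : ℕ}, (Fin n → G) → (tpow X n ⟶ tpow X n)
  | 0, _ => 𝟙 _
  | n + 1, x => tens (labels (fun i : Fin n => x i.castSucc)) (γ (x (Fin.last n)))

theorem labels_succ {n : ℕ} (x : Fin (n + 1) → G) :
    labels γ x = tens (labels γ (fun i : Fin n => x i.castSucc)) (γ (x (Fin.last n))) := rfl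

theorem labels_one (n : ℕ) : labels γ (1 : Fin n → G) = 𝟙 _ := by
  induction n with
  | zero => rfl
  | succ n ih =>
    refine Eq.trans ?_ (tens_id X n 1)
    exact congrArg₂ tens ih (map_one γ)

/-- The order is reversed because multiplication in `End` follows the composition of functions, as
opposed to `≫`. -/
theorem labels_mul {n : ℕ} (x y : Fin n → G) :
    labels γ (x * y) = labels γ y ≫ labels γ x := by
  induction n with
  | zero => exact (Category.comp_id _).symm
  | succ n ih =>
    rw [labels_succ, labels_succ, labels_succ, tens_comp_tens, ← ih]
    exact congrArg (tens _) (map_mul γ _ _)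

theorem labels_heq {n m : ℕ} (h : n = m) {x : Fin n → G} {y : Fin m → G}
    (e : ∀ i, x i = y (Fin.cast h i)) : HEq (labels γ x) (labels γ y) := by
  subst h
  rw [show x = y from funext e]

theorem labels_append {a b : ℕ} (x : Fin a → G) (y : Fin b → G) :
    labels γ (Fin.append x y) = tens (labels γ x) (labels γ y) := by
  induction b with
  | zero =>
    have h : Fin.append x y = x := funext fun i => Fin.append_left x y i
    rw [h]
    exact (tens_zero _).symm
  | succ b ih =>
    rw [labels_succ γ y]
    refine eq_of_heq (HEq.trans ?_ (tens_assoc _ _ _))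
    rw [← ih]
    refine heq_of_eq ((labels_succ γ (n := a + b) _).trans ?_)
    congr 2
    · funext i
      induction i using Fin.addCases with
      | left i =>
        rw [Fin.append_left]
        exact Fin.append_left x y i
      | right i =>
        rw [Fin.append_right]
        exact Fin.append_right x y i.castSucc
    · exact Fin.append_right x y (Fin.last b)

end Labels

namespace PowMon

variable (M : PowMon X) {G : Type w} [Group G] (γ : G →* End (tpow X 1))

/-- The group acts by monoid homomorphisms. -/
structure IsEquivariant : Prop where
  one_comp : ∀ g, M.one ≫ γ g = M.one
  mul_comp : ∀ g, M.mul ≫ γ g = tens (γ g) (γ g) ≫ M.mul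

variable {M γ} (hM : M.IsEquivariant γ)

include hM

theorem IsEquivariant.mulN_comp (n : ℕ) (g : G) :
    M.mulN n ≫ γ g = labels γ (fun _ : Fin n => g) ≫ M.mulN n := by
  induction n with
  | zero => exact (hM.one_comp g).trans (Category.id_comp _).symm
  | succ n ih =>
    rw [mulN_succ, Category.assoc, hM.mul_comp, labels_succ, ← Category.assoc, tens_comp_tens, ih,
      ← Category.assoc, tens_comp_tens, Category.comp_id, Category.id_comp]

/-- The source of the rule that labels are copied along fibres: over each point the label is
constant, and `G` acts by monoid homomorphisms, so it passes through the iterated multiplication. -/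
theorem IsEquivariant.ord_comp {n m : ℕ} (φ : OrdMap n m) (x : Fin m → G) :
    M.ord φ ≫ labels γ x = labels γ (fun i => x (φ i)) ≫ M.ord φ := by
  induction m generalizing n with
  | zero =>
    obtain rfl := φ.eq_zero
    rfl
  | succ m ih =>
    obtain ⟨a, b, rfl, φ₁, φ₂, rfl⟩ := φ.exists_eq_sum
    have h : (fun i => x ((φ₁.sum φ₂).comp (OrdMap.cast rfl) i)) =
        Fin.append (fun i => x (φ₁ i).castSucc) (fun _ => x (Fin.last m)) := by
      funext i
      rw [OrdMap.comp_cast_refl]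
      induction i using Fin.addCases with
      | left i =>
        rw [OrdMap.sum_castAdd, Fin.append_left]
        rfl
      | right i =>
        rw [OrdMap.sum_natAdd, Fin.append_right, Subsingleton.elim (φ₂ i) 0]
        rfl
    rw [h, labels_append, OrdMap.comp_cast_refl, M.ord_sum_toOne, labels_succ, tens_comp_tens,
      tens_comp_tens, ih, hM.mulN_comp]

end PowMon

end TensorPower

/-! ### Group actions on tensor powers and their compatibility with monoids and labels. -/

/-- The groups are generated by the crossings of adjacent strands. -/
def CrossedGroups.GeneratedBySwap (K : CrossedGroups.{w}) : Prop :=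
  ∀ (n : ℕ) (H : Subgroup (K.J n)), (∀ (a b : ℕ) (h : n = a + (1 + 1) + b),
    K.pull (OrdMap.cast h) (K.sum (K.sum (1 : K.J a) (K.swap 1 1)) (1 : K.J b)) ∈ H) → H = ⊤

namespace CrossedGroups

variable (K : CrossedGroups.{w})

/-- This is not among the laws of `CrossedGroups`. It is read off from the braiding of `K.Obj` with
the unit object, which is a composite of unitors, and these have trivial group elements. -/
theorem swap_zero_right (a : ℕ) : K.swap a 0 = 1 := by
  have h := congrArg Hom.elt (braiding_tensorUnit_right (⟨a⟩ : K.Obj))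
  refine (braidingIso_elt (⟨a⟩ : K.Obj) ⟨0⟩).symm.trans (h.trans ?_)
  refine (comp_elt _ _).trans ?_
  rw [leftUnitor_eq, rightUnitor_eq, eqToIso.inv, eqToIso.hom, eqToHom_elt, eqToHom_elt,
    K.pull_one, one_mul]

theorem swap_zero_left (a : ℕ) : K.swap 0 a = 1 := by
  have h := congrArg Hom.elt (braiding_tensorUnit_left (⟨a⟩ : K.Obj))
  refine (braidingIso_elt (⟨0⟩ : K.Obj) ⟨a⟩).symm.trans (h.trans ?_)
  refine (comp_elt _ _).trans ?_
  rw [leftUnitor_eq, rightUnitor_eq, eqToIso.inv, eqToIso.hom, eqToHom_elt, eqToHom_elt,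
    K.pull_one, one_mul]

end CrossedGroups

section Rep

variable {C : Type u} [Category.{v} C] [MonoidalCategory C] [BraidedCategory C]

/-- An action of the groups `J n` on the tensor powers of an object. -/
structure PowRep (K : CrossedGroups.{w}) (X : C) where
  rep : ∀ n, K.J n →* End (tpow X n)
  rep_sum : ∀ {a b : ℕ} (i : K.J a) (j : K.J b),
    rep (a + b) (K.sum i j) = tens (rep a i) (rep b j)
  rep_swap_one : rep (1 + 1) (K.swap 1 1) = tbraid X 1 1

namespace PowRep

variable {K : CrossedGroups.{w}} {X : C} (R : PowRep K X)

theorem rep_one (n : ℕ) : R.rep n 1 = 𝟙 _ := map_one _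

theorem rep_mul {n : ℕ} (i j : K.J n) : R.rep n (i * j) = R.rep n j ≫ R.rep n i := map_mul _ _ _

theorem rep_cast {n m : ℕ} (h : n = m) (j : K.J m) :
    HEq (R.rep n (K.pull (OrdMap.cast h) j)) (R.rep m j) := by
  subst h
  exact heq_of_eq (congrArg _ (K.pull_id j))

/-- The block crossings and the braidings of tensor powers satisfy the same hexagon, so agreement
for two blocks gives agreement for their juxtaposition. -/
theorem rep_swap_add_right {a b c : ℕ} (hb : HEq (R.rep _ (K.swap a b)) (tbraid X a b))
    (hc : HEq (R.rep _ (K.swap a c)) (tbraid X a c)) :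
    HEq (R.rep _ (K.swap a (b + c))) (tbraid X a (b + c)) := by
  refine (R.rep_cast (Nat.add_assoc a b c) _).symm.trans ?_
  rw [K.swap_hexagon_forward, rep_mul, rep_sum, rep_one]
  have h := (tcast_comp_heq (Nat.add_assoc a b c)
    (tbraid X a (b + c) ≫ tcast X (Nat.add_assoc b c a))).trans (comp_tcast_heq _ _)
  refine HEq.trans ?_ ((heq_of_eq (tbraid_add_right X a b c).symm).trans h)
  refine comp_heq_comp rfl (by omega) (by omega)
    (tens_heq_tens rfl rfl (Nat.add_comm _ _) rfl hb HEq.rfl) ?_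
  refine (R.rep_cast _ _).trans (HEq.trans ?_ (tcast_comp_heq _ _).symm)
  rw [rep_sum, rep_one]
  exact tens_heq_tens rfl rfl rfl (Nat.add_comm _ _) HEq.rfl hc

theorem rep_swap_add_left {a b c : ℕ} (ha : HEq (R.rep _ (K.swap a c)) (tbraid X a c))
    (hb : HEq (R.rep _ (K.swap b c)) (tbraid X b c)) :
    HEq (R.rep _ (K.swap (a + b) c)) (tbraid X (a + b) c) := by
  rw [K.swap_hexagon_reverse, rep_mul]
  have h := (tcast_comp_heq (Nat.add_assoc a b c).symm
    (tbraid X (a + b) c ≫ tcast X (Nat.add_assoc c a b).symm)).trans (comp_tcast_heq _ _)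
  refine HEq.trans ?_ ((heq_of_eq (tbraid_add_left X a b c).symm).trans h)
  refine comp_heq_comp (Nat.add_assoc a b c) (by omega) (by omega) ?_ ?_
  · refine (R.rep_cast _ _).trans ?_
    rw [rep_sum, rep_one]
    exact tens_heq_tens rfl rfl rfl (Nat.add_comm _ _) HEq.rfl hb
  · refine (R.rep_cast _ _).trans (HEq.trans ?_ (tcast_comp_heq _ _).symm)
    rw [rep_sum, rep_one]
    exact tens_heq_tens rfl rfl (Nat.add_comm _ _) rfl ha HEq.rfl

/-- Only the crossing of two single strands is prescribed in `PowRep`. One hexagon extends the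
agreement to one strand against a block, the other to two blocks. -/
theorem rep_swap (a b : ℕ) : HEq (R.rep _ (K.swap a b)) (tbraid X a b) := by
  have h1 : ∀ b, HEq (R.rep _ (K.swap 1 b)) (tbraid X 1 b) := by
    intro b
    induction b with
    | zero =>
      rw [K.swap_zero_right, rep_one, tbraid_zero_right]
      rfl
    | succ b ih => exact R.rep_swap_add_right ih (heq_of_eq R.rep_swap_one)
  induction a with
  | zero =>
    rw [K.swap_zero_left, rep_one, tbraid_zero_left]
    exact HEq.symm ((heq_of_eq (Category.comp_id _).symm).trans (tcast_comp_heq _ _) |>.trans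
      (id_heq_id X (Nat.zero_add b).symm))
  | succ a ih => exact R.rep_swap_add_left ih (h1 b)

theorem rep_swap_comp_tcast (a b : ℕ) :
    (R.rep _ (K.swap a b) : tpow X (a + b) ⟶ tpow X (a + b)) ≫ tcast X (Nat.add_comm a b) =
      tbraid X a b :=
  (heq_tcast (R.rep_swap a b) rfl (Nat.add_comm a b)).trans (Category.id_comp _)

/-- The compatibility of a group element with the action of the order-preserving maps. -/
def Compat (M : PowMon X) {m : ℕ} (j : K.J m) : Prop :=
  ∀ {n : ℕ} (φ : OrdMap n m), M.ord φ ≫ R.rep m j =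
    R.rep n (K.pull φ j) ≫ M.ord (permPush (K.perm m j) φ)

theorem compat_one (M : PowMon X) (m : ℕ) : R.Compat M (1 : K.J m) := by
  intro n φ
  rw [K.pull_one, rep_one, rep_one, map_one, permPush_one, Category.comp_id, Category.id_comp]

variable {R} {M : PowMon X}

theorem Compat.mul {m : ℕ} {i j : K.J m} (hi : R.Compat M i) (hj : R.Compat M j) :
    R.Compat M (i * j) := by
  intro n φ
  rw [K.pull_mul, rep_mul, rep_mul, map_mul, permPush_mul, reassoc_of% hj φ, hi, Category.assoc]

theorem Compat.inv {m : ℕ} {i : K.J m} (hi : R.Compat M i) : R.Compat M i⁻¹ := by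
  intro n φ
  have h1 : R.rep m i⁻¹ ≫ R.rep m i = 𝟙 _ := by
    rw [← rep_mul, mul_inv_cancel, rep_one]
  have h2 : R.rep m i ≫ R.rep m i⁻¹ = 𝟙 _ := by
    rw [← rep_mul, inv_mul_cancel, rep_one]
  have h3 : R.rep n (K.pull φ i⁻¹) ≫ R.rep n (K.pull (permPush (K.perm m i⁻¹) φ) i) = 𝟙 _ := by
    rw [← rep_mul, ← K.pull_mul, mul_inv_cancel, K.pull_one, rep_one]
  -- The hypothesis is applied to the map pushed along `i⁻¹`, so that pushing along `i` gives back
  -- `φ`.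
  have h := hi (permPush (K.perm m i⁻¹) φ)
  rw [← permPush_mul, ← map_mul, mul_inv_cancel, map_one, permPush_one] at h
  calc M.ord φ ≫ R.rep m i⁻¹
    _ = (R.rep n (K.pull φ i⁻¹) ≫ R.rep n (K.pull (permPush (K.perm m i⁻¹) φ) i)) ≫
        M.ord φ ≫ R.rep m i⁻¹ := by rw [h3, Category.id_comp]
    _ = R.rep n (K.pull φ i⁻¹) ≫ (M.ord (permPush (K.perm m i⁻¹) φ) ≫ R.rep m i) ≫
        R.rep m i⁻¹ := by rw [h]; simp only [Category.assoc]
    _ = _ := by rw [Category.assoc, h2, Category.comp_id]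

/-- Every order-preserving map into `a + b` is itself a sum, so the two blocks can be treated
separately. -/
theorem Compat.sum {a b : ℕ} {i : K.J a} {j : K.J b} (hi : R.Compat M i) (hj : R.Compat M j) :
    R.Compat M (K.sum i j) := by
  intro n φ
  obtain ⟨k, l, rfl, φ₁, φ₂, rfl⟩ := φ.exists_eq_sum
  rw [OrdMap.comp_cast_refl, rep_sum, M.ord_sum, tens_comp_tens, hi, hj, K.pull_sum, rep_sum,
    K.perm_sum, permPush_sum, M.ord_sum, tens_comp_tens]

variable (R M)

/-- Block crossings act as braidings, so this is naturality of the braiding with respect to `M.ord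
φ₁` and `M.ord φ₂`; `perm_swap_aux` identifies the pushed map with their sum in the other order. -/
theorem compat_swap (a b : ℕ) : R.Compat M (K.swap a b) := by
  intro n φ
  obtain ⟨k, l, rfl, φ₁, φ₂, rfl⟩ := φ.exists_eq_sum
  have h := R.rep_swap_comp_tcast a b
  have h1 : (R.rep _ (K.swap a b) : tpow X (a + b) ⟶ tpow X (a + b)) =
      tbraid X a b ≫ tcast X (Nat.add_comm b a) := by
    rw [← h, Category.assoc, tcast_trans, tcast_refl, Category.comp_id]
  rw [OrdMap.comp_cast_refl, K.pull_swap, K.perm_swap, (perm_swap_aux φ₁ φ₂).1, M.ord_comp,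
    M.ord_cast, M.ord_comp_cast, M.ord_sum, h1, reassoc_of% (tens_tbraid (M.ord φ₁) (M.ord φ₂)),
    ← R.rep_swap_comp_tcast k l, M.ord_sum]
  simp only [Category.assoc]

variable {R M}

theorem Compat.cast {n m : ℕ} (h : n = m) {j : K.J m} (hj : R.Compat M j) :
    R.Compat M (K.pull (OrdMap.cast h) j) := by
  subst h
  rw [OrdMap.cast_refl, K.pull_id]
  exact @hj

variable (R M)

/-- The compatible elements form a subgroup, and by `Compat.sum` it contains the adjacent crossings
that generate. -/
theorem compat (hK : K.GeneratedBySwap) {m : ℕ} (j : K.J m) : R.Compat M j := by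
  let H : Subgroup (K.J m) :=
    { carrier := {j | R.Compat M j}
      mul_mem' := fun hi hj => hi.mul hj
      one_mem' := R.compat_one M m
      inv_mem' := fun hi => hi.inv }
  have h : H = ⊤ := hK m H (fun a b h =>
    Compat.cast h (Compat.sum (Compat.sum (R.compat_one M a) (R.compat_swap M 1 1))
      (R.compat_one M b)))
  have hj : j ∈ H := by
    rw [h]
    trivial
  exact @hj

section Labels

variable {G : Type w'} [Group G] (γ : G →* End (tpow X 1))

/-- The compatibility of a group element with the action of `G ^ m`. -/
def LabelCompat {m : ℕ} (j : K.J m) : Prop :=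
  ∀ x : Fin m → G, labels γ x ≫ R.rep m j = R.rep m j ≫ labels γ (fun k => x ((K.perm m j)⁻¹ k))

theorem labelCompat_one (m : ℕ) : R.LabelCompat γ (1 : K.J m) := by
  intro x
  rw [rep_one, map_one, Category.comp_id, Category.id_comp]
  rfl

variable {R γ}

theorem LabelCompat.mul {m : ℕ} {i j : K.J m} (hi : R.LabelCompat γ i) (hj : R.LabelCompat γ j) :
    R.LabelCompat γ (i * j) := by
  intro x
  rw [rep_mul, reassoc_of% hj x, hi, map_mul, mul_inv_rev, Category.assoc]
  rfl

theorem LabelCompat.inv {m : ℕ} {i : K.J m} (hi : R.LabelCompat γ i) : R.LabelCompat γ i⁻¹ := by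
  intro x
  have h1 : R.rep m i⁻¹ ≫ R.rep m i = 𝟙 _ := by
    rw [← rep_mul, mul_inv_cancel, rep_one]
  have h2 : R.rep m i ≫ R.rep m i⁻¹ = 𝟙 _ := by
    rw [← rep_mul, inv_mul_cancel, rep_one]
  have h := hi (fun k => x (K.perm m i k))
  have h3 : (fun k => x (K.perm m i ((K.perm m i)⁻¹ k))) = x := by
    funext k
    simp
  rw [h3] at h
  rw [map_inv (K.perm m), inv_inv]
  calc labels γ x ≫ R.rep m i⁻¹
    _ = (R.rep m i⁻¹ ≫ R.rep m i) ≫ labels γ x ≫ R.rep m i⁻¹ := by rw [h1, Category.id_comp]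
    _ = R.rep m i⁻¹ ≫ (labels γ (fun k => x (K.perm m i k)) ≫ R.rep m i) ≫ R.rep m i⁻¹ := by
        rw [h]; simp only [Category.assoc]
    _ = _ := by rw [Category.assoc, h2, Category.comp_id]

theorem LabelCompat.sum {a b : ℕ} {i : K.J a} {j : K.J b} (hi : R.LabelCompat γ i)
    (hj : R.LabelCompat γ j) : R.LabelCompat γ (K.sum i j) := by
  intro x
  have h : (fun k => x ((K.perm _ (K.sum i j))⁻¹ k)) =
      Fin.append (fun k => x (Fin.castAdd b ((K.perm a i)⁻¹ k)))
        (fun k => x (Fin.natAdd a ((K.perm b j)⁻¹ k))) := by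
    funext k
    rw [K.perm_sum, permSum_inv]
    induction k using Fin.addCases <;> simp
  have h' := hi (fun k => x (Fin.castAdd b k))
  have h'' := hj (fun k => x (Fin.natAdd a k))
  rw [h, labels_append, rep_sum, tens_comp_tens, ← h', ← h'', ← tens_comp_tens, ← labels_append,
    Fin.append_castAdd_natAdd]

variable (R γ)

/-- Again naturality of the braiding, now applied to the labels of the two blocks. -/
theorem labelCompat_swap (a b : ℕ) : R.LabelCompat γ (K.swap a b) := by
  intro x
  have h := R.rep_swap_comp_tcast a b
  have h1 : (R.rep _ (K.swap a b) : tpow X (a + b) ⟶ tpow X (a + b)) =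
      tbraid X a b ≫ tcast X (Nat.add_comm b a) := by
    rw [← h, Category.assoc, tcast_trans, tcast_refl, Category.comp_id]
  have hx : labels γ x = tens (labels γ (fun k => x (Fin.castAdd b k)))
      (labels γ (fun k => x (Fin.natAdd a k))) := by
    rw [← labels_append, Fin.append_castAdd_natAdd]
  have h2 : HEq (labels γ (fun k => x ((K.perm _ (K.swap a b))⁻¹ k)))
      (tens (labels γ (fun k => x (Fin.natAdd a k)))
        (labels γ (fun k => x (Fin.castAdd b k)))) := by
    rw [← labels_append]
    refine labels_heq γ (Nat.add_comm a b) (fun k => ?_)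
    rw [K.perm_swap]
    obtain ⟨l, rfl⟩ := (permSwap a b).surjective k
    rw [Equiv.Perm.coe_inv, Equiv.symm_apply_apply]
    induction l using Fin.addCases with
    | left i =>
      rw [show Fin.cast (Nat.add_comm a b) (permSwap a b (Fin.castAdd b i)) = Fin.natAdd b i from
        Fin.ext (by simp), Fin.append_right]
    | right i =>
      rw [show Fin.cast (Nat.add_comm a b) (permSwap a b (Fin.natAdd a i)) = Fin.castAdd a i from
        Fin.ext (by simp), Fin.append_left]
  have h3 := heq_tcast h2.symm (Nat.add_comm b a) (Nat.add_comm b a)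
  rw [h1, hx, reassoc_of% (tens_tbraid (labels γ (fun k => x (Fin.castAdd b k)))
    (labels γ (fun k => x (Fin.natAdd a k)))), h3, Category.assoc]

variable {R γ}

theorem LabelCompat.cast {n m : ℕ} (h : n = m) {j : K.J m} (hj : R.LabelCompat γ j) :
    R.LabelCompat γ (K.pull (OrdMap.cast h) j) := by
  subst h
  rw [OrdMap.cast_refl, K.pull_id]
  exact @hj

variable (R γ)

theorem labelCompat (hK : K.GeneratedBySwap) {m : ℕ} (j : K.J m) : R.LabelCompat γ j := by
  let H : Subgroup (K.J m) :=
    { carrier := {j | R.LabelCompat γ j}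
      mul_mem' := fun hi hj => hi.mul hj
      one_mem' := R.labelCompat_one γ m
      inv_mem' := fun hi => hi.inv }
  have h : H = ⊤ := hK m H (fun a b h =>
    (((R.labelCompat_one γ a).sum (R.labelCompat_swap γ 1 1)).sum (R.labelCompat_one γ b)).cast h)
  have hj : j ∈ H := by
    rw [h]
    trivial
  exact @hj

end Labels

end PowRep

end Rep

/-! ### The algebra given by a monoid with compatible group actions. -/

section Rep

variable {C : Type u} [Category.{v} C] [MonoidalCategory C] [BraidedCategory C]

namespace PowRep

section Functor

variable {K : CrossedGroups.{w}} {X : C} (R : PowRep K X) (M : PowMon X)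
  (hR : ∀ {m : ℕ} (j : K.J m), R.Compat M j)

include hR in
-- A morphism acts by its group element and then by its order-preserving map. In a composite the map
-- of `f` meets the element of `g`, and compatibility exchanges them exactly as the composition law
-- of `𝔻 ⊗ 𝕁` does.
theorem map_comp {Y Z W : K.Obj} (f : Y ⟶ Z) (g : Z ⟶ W) :
    (R.rep _ (f ≫ g).elt : tpow X Y.n ⟶ tpow X Y.n) ≫ M.ord (f ≫ g).map =
      ((R.rep _ f.elt : tpow X Y.n ⟶ tpow X Y.n) ≫ M.ord f.map) ≫
        (R.rep _ g.elt : tpow X Z.n ⟶ tpow X Z.n) ≫ M.ord g.map := by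
  rw [CrossedGroups.comp_elt, CrossedGroups.comp_map, rep_mul, M.ord_comp, Category.assoc,
    Category.assoc, reassoc_of% (hR g.elt f.map)]

/-- The functor given by a monoid and compatible actions of the groups on its tensor powers. -/
noncomputable def functor : K.Obj ⥤ C where
  obj Y := tpow X Y.n
  map {Y Z} f := (R.rep _ f.elt : tpow X Y.n ⟶ tpow X Y.n) ≫ M.ord f.map
  map_id Y := by
    change (R.rep _ 1 : tpow X Y.n ⟶ tpow X Y.n) ≫ M.ord OrderHom.id = _
    rw [rep_one, M.ord_id, Category.comp_id]
  map_comp := R.map_comp M hR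

theorem functor_map_tensorHom {Y Z Y' Z' : K.Obj} (f : Y ⟶ Z) (g : Y' ⟶ Z') :
    (R.functor M hR).map (f ⊗ₘ g) =
      tens ((R.functor M hR).map f) ((R.functor M hR).map g) := by
  change (R.rep _ (K.sum f.elt g.elt) : tpow X (Y.n + Y'.n) ⟶ _) ≫ M.ord (f.map.sum g.map) =
    tens ((R.rep _ f.elt : tpow X Y.n ⟶ tpow X Y.n) ≫ M.ord f.map)
      ((R.rep _ g.elt : tpow X Y'.n ⟶ tpow X Y'.n) ≫ M.ord g.map)
  rw [rep_sum, M.ord_sum, tens_comp_tens]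

theorem functor_map_eqToHom {Y Z : K.Obj} (h : Y = Z) :
    (R.functor M hR).map (eqToHom h) = tcast X (congrArg CrossedGroups.Obj.n h) := by
  subst h
  exact (R.functor M hR).map_id Y

/-- The monoidal structure of the functor. -/
noncomputable def coreMonoidal : (R.functor M hR).CoreMonoidal where
  εIso := Iso.refl _
  μIso Y Z := tpowAdd X Y.n Z.n
  μIso_hom_natural_left {Y Z} f W := by
    have h := R.functor_map_tensorHom M hR f (𝟙 W)
    rw [tensorHom_id, CategoryTheory.Functor.map_id] at h
    rw [h, ← tensorHom_id]
    exact (tpowAdd_tens _ _).symm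
  μIso_hom_natural_right {Y Z} W f := by
    have h := R.functor_map_tensorHom M hR (𝟙 W) f
    rw [id_tensorHom, CategoryTheory.Functor.map_id] at h
    rw [h, ← id_tensorHom]
    exact (tpowAdd_tens _ _).symm
  associativity Y Z W := by
    rw [CrossedGroups.associator_eq, eqToIso.hom, functor_map_eqToHom]
    exact tpowAdd_assoc X Y.n Z.n W.n
  left_unitality Y := by
    rw [CrossedGroups.leftUnitor_eq, eqToIso.hom, functor_map_eqToHom]
    refine (zero_tpowAdd X Y.n).symm.trans ?_
    refine (Category.id_comp _).symm.trans ?_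
    exact congrArg (fun t => t ≫ _) (id_whiskerRight _ _).symm
  right_unitality Y := by
    rw [CrossedGroups.rightUnitor_eq, eqToIso.hom, functor_map_eqToHom]
    refine (Category.comp_id _).symm.trans ?_
    refine (Category.id_comp _).symm.trans ?_
    exact congrArg (fun t => t ≫ _) (whiskerLeft_id _ _).symm

/-- The functor is monoidal. -/
noncomputable instance functorMonoidal : (R.functor M hR).Monoidal :=
  (R.coreMonoidal M hR).toMonoidal

/-- The functor is braided. -/
noncomputable instance functorBraided : (R.functor M hR).Braided where
  braided Y Z := by
    have h : (R.functor M hR).map (β_ Y Z).hom = tbraid X Y.n Z.n := by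
      change (R.rep _ (CrossedGroups.braidingIso Y Z).hom.elt : tpow X (Y.n + Z.n) ⟶ _) ≫
        M.ord (CrossedGroups.braidingIso Y Z).hom.map = _
      rw [CrossedGroups.braidingIso_elt, CrossedGroups.braidingIso_map, M.ord_cast]
      exact R.rep_swap_comp_tcast Y.n Z.n
    rw [h]
    exact tpowAdd_tbraid X Y.n Z.n

/-- The algebra given by a monoid and compatible actions of the groups on its tensor powers. -/
noncomputable def alg : Alg K.Obj C := ⟨R.functor M hR⟩

end Functor

section Labelled

variable {K : CrossedGroups.{w}} {X : C} (R : PowRep K X) (hK : K.GeneratedBySwap)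
  {G : Type w'} [Group G] (γ : G →* End (tpow X 1))

include hK in
-- Moving the labels of `q` past the group element of `p` permutes them; this is the twist in the
-- multiplication of the semidirect product.
theorem labelled_mul {n : ℕ} (p q : K.LabelledGroup G n) :
    (R.rep n (p * q).right : tpow X n ⟶ tpow X n) ≫ labels γ (p * q).left =
      ((R.rep n q.right : tpow X n ⟶ tpow X n) ≫ labels γ q.left) ≫
        (R.rep n p.right : tpow X n ⟶ tpow X n) ≫ labels γ p.left := by
  have h : (p * q).left = p.left * fun k => q.left ((K.perm n p.right)⁻¹ k) := rfl
  have h' := R.labelCompat γ hK p.right q.left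
  rw [SemidirectProduct.mul_right, h, rep_mul, labels_mul, Category.assoc, Category.assoc,
    reassoc_of% h']

/-- The action of the labelled groups. -/
def labelled : PowRep (K.labelled G) X where
  rep n :=
    { toFun := fun p => (R.rep n p.right : tpow X n ⟶ tpow X n) ≫ labels γ p.left
      map_one' := by
        change (R.rep n 1 : tpow X n ⟶ tpow X n) ≫ labels γ 1 = 𝟙 _
        rw [rep_one, labels_one, Category.comp_id]
      map_mul' := fun p q => by
        exact R.labelled_mul hK γ p q }
  rep_sum {a b} p q := by
    change (R.rep _ (K.sum p.right q.right) : tpow X (a + b) ⟶ _) ≫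
      labels γ (Fin.append p.left q.left) = tens ((R.rep a p.right : tpow X a ⟶ _) ≫ labels γ p.left)
        ((R.rep b q.right : tpow X b ⟶ _) ≫ labels γ q.left)
    rw [rep_sum, labels_append, tens_comp_tens]
  rep_swap_one := by
    change (R.rep (1 + 1) (K.swap 1 1) : tpow X (1 + 1) ⟶ _) ≫ labels γ 1 = _
    rw [labels_one, Category.comp_id, R.rep_swap_one]

theorem labelled_rep {n : ℕ} (p : K.LabelledGroup G n) : (R.labelled hK γ).rep n p =
    (R.rep n p.right : tpow X n ⟶ tpow X n) ≫ labels γ p.left := rfl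

/-- The group element is moved past `φ` by `compat`, and then the labels are copied along the fibres
of the pushed map by `ord_comp`. -/
theorem labelled_compat {M : PowMon X} (hM : M.IsEquivariant γ) {m : ℕ}
    (p : (K.labelled G).J m) : (R.labelled hK γ).Compat M p := by
  intro n φ
  change M.ord φ ≫ (R.rep m p.right : tpow X m ⟶ tpow X m) ≫ labels γ p.left =
    ((R.rep n (K.pull φ p.right) : tpow X n ⟶ tpow X n) ≫
      labels γ (fun k => p.left (permPush (K.perm m p.right) φ k))) ≫
      M.ord (permPush (K.perm m p.right) φ)
  rw [reassoc_of% (R.compat M hK p.right φ), hM.ord_comp, Category.assoc]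

end Labelled

end PowRep

end Rep

/-! ### Generation by adjacent crossings, and involutive representations of braid groups. -/

namespace BraidGroup

theorem blockSwap_one_one : blockSwap 1 1 = gen 0 (by omega : 0 + 1 < 1 + 1) := by
  rw [← posBraid_transp, blockSwap]
  congr 1
  ext x
  rw [val_permSwap, val_transp]
  split_ifs <;> omega

/-- Identifies the elements occurring in `GeneratedBySwap` with the Artin generators. -/
theorem pull_cast_sum_blockSwap {n : ℕ} (a b : ℕ) (h : n = a + (1 + 1) + b) :
    pull (OrdMap.cast h) (sum (sum (1 : BraidGroup a) (blockSwap 1 1)) (1 : BraidGroup b)) =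
      gen a (by omega) := by
  rw [sum, sum, map_one, map_one, one_mul, mul_one, blockSwap_one_one, inr_gen, inl_gen,
    ← castHom_apply, castHom_gen]
  exact gen_congr _ _ (Nat.add_zero a)

/-- Descends a representation with involutive generators to the symmetric group without a
presentation of that group: `w ↦ f (posBraid w)` becomes multiplicative although `posBraid` itself
is not. -/
theorem map_posBraid_mul {n : ℕ} {H : Type*} [Group H] (f : BraidGroup n →* H)
    (hf : ∀ i hi, f (gen i hi) * f (gen i hi) = 1) (u v : Equiv.Perm (Fin n)) :
    f (posBraid (u * v)) = f (posBraid u) * f (posBraid v) := by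
  have key : ∀ (u : Equiv.Perm (Fin n)) (i : ℕ) (hi : i + 1 < n),
      f (posBraid (u * transp i hi)) = f (posBraid u) * f (gen i hi) := by
    intro u i hi
    -- At a descent the last generator of `posBraid u` cancels against its square under `f`; at an
    -- ascent the product with the transposition is additive and `posBraid` already respects it.
    by_cases hd : Desc u i hi
    · rw [posBraid_desc u hi hd, map_mul, mul_assoc, hf, mul_one]
    · have hlt : u ⟨i, by omega⟩ < u ⟨i + 1, hi⟩ := by
        refine lt_of_le_of_ne (not_lt.1 hd) (fun h => ?_)
        have := congrArg Fin.val (u.injective h)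
        simp at this
      rw [posBraid_mul _ _ (additive_transp u hi hlt), map_mul, posBraid_transp]
  refine perm_induction
    (p := fun v => f (posBraid (u * v)) = f (posBraid u) * f (posBraid v)) ?_ ?_ v
  · rw [mul_one, posBraid_one, map_one, mul_one]
  · intro v i hi hd ih
    have h := key (u * (v * transp i hi)) i hi
    rw [mul_assoc u, mul_transp_cancel, ih] at h
    rw [h, posBraid_desc v hi hd, map_mul, mul_assoc]

end BraidGroup

namespace CrossedGroups

theorem braidGroups_generatedBySwap : braidGroups.GeneratedBySwap := by
  intro n H hH
  rw [eq_top_iff]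
  intro x _
  refine BraidGroup.induction (p := fun x => x ∈ H) (fun i hi => ?_) H.one_mem
    (fun _ _ => H.mul_mem) (fun _ => H.inv_mem) x
  obtain ⟨b, rfl⟩ := Nat.exists_eq_add_of_le (show i + (1 + 1) ≤ n by omega)
  have h := hH i b rfl
  exact (BraidGroup.pull_cast_sum_blockSwap i b rfl) ▸ h

theorem symmetricGroups_generatedBySwap : symmetricGroups.GeneratedBySwap := by
  intro n H hH
  have ht : ∀ i (hi : i + 1 < n), BraidGroup.transp i hi ∈ H := by
    intro i hi
    obtain ⟨b, rfl⟩ := Nat.exists_eq_add_of_le (show i + (1 + 1) ≤ n by omega)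
    -- The identity is inherited from the braid groups by taking underlying permutations.
    have e := congrArg (BraidGroup.perm _) (BraidGroup.pull_cast_sum_blockSwap i b rfl)
    rw [BraidGroup.perm_pull, BraidGroup.perm_sum, BraidGroup.perm_sum, map_one, map_one,
      BraidGroup.blockSwap, BraidGroup.perm_posBraid, BraidGroup.perm_gen] at e
    exact e ▸ hH i b rfl
  rw [eq_top_iff]
  intro x _
  refine BraidGroup.perm_induction (p := fun x => x ∈ H) H.one_mem (fun w i hi _ h => ?_) x
  rw [← BraidGroup.mul_transp_cancel w hi]
  exact H.mul_mem h (ht i hi)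

end CrossedGroups

/-! ### The action of the braid groups on tensor powers. -/

section Rep

variable {C : Type u} [Category.{v} C] [MonoidalCategory C]

/-- The universal property of the braid group needs a group as target. The action is therefore first
built with values in `Aut`, for which the pieces must be invertible. -/
instance (X : C) {a b : ℕ} (h : a = b) : IsIso (tcast X h) := by
  unfold tcast
  infer_instance

instance {X : C} {a b c d : ℕ} (f : tpow X a ⟶ tpow X c) (g : tpow X b ⟶ tpow X d) [IsIso f]
    [IsIso g] : IsIso (tens f g) := by
  unfold tens
  infer_instance

/-- The action of automorphisms of `X ^ a` on `X ^ (a + b)`. -/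
def tensAutLeft (X : C) (a b : ℕ) : Aut (tpow X a) →* Aut (tpow X (a + b)) where
  toFun f :=
    { hom := tens f.hom (𝟙 (tpow X b))
      inv := tens f.inv (𝟙 (tpow X b))
      hom_inv_id := by rw [tens_comp_tens, f.hom_inv_id, Category.id_comp, tens_id]
      inv_hom_id := by rw [tens_comp_tens, f.inv_hom_id, Category.id_comp, tens_id] }
  map_one' := Iso.ext (tens_id X a b)
  map_mul' f g := Iso.ext (by
    change tens (g.hom ≫ f.hom) _ = tens g.hom _ ≫ tens f.hom _
    rw [tens_comp_tens, Category.id_comp])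

/-- The action of automorphisms of `X ^ b` on `X ^ (a + b)`. -/
def tensAutRight (X : C) (a b : ℕ) : Aut (tpow X b) →* Aut (tpow X (a + b)) where
  toFun f :=
    { hom := tens (𝟙 (tpow X a)) f.hom
      inv := tens (𝟙 (tpow X a)) f.inv
      hom_inv_id := by rw [tens_comp_tens, f.hom_inv_id, Category.id_comp, tens_id]
      inv_hom_id := by rw [tens_comp_tens, f.inv_hom_id, Category.id_comp, tens_id] }
  map_one' := Iso.ext (tens_id X a b)
  map_mul' f g := Iso.ext (by
    change tens _ (g.hom ≫ f.hom) = tens _ g.hom ≫ tens _ f.hom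
    rw [tens_comp_tens, Category.id_comp])

variable [BraidedCategory C] (X : C)

/-- The braiding of the factors `i` and `i + 1` of a tensor power. -/
noncomputable def adjBraid {n : ℕ} (i : ℕ) (h : i + 1 < n) : Aut (tpow X n) :=
  asIso (tcast X (show n = i + (1 + 1) + (n - (i + (1 + 1))) by omega) ≫
    tens (tens (𝟙 (tpow X i)) (tbraid X 1 1)) (𝟙 (tpow X (n - (i + (1 + 1))))) ≫
      tcast X (show i + (1 + 1) + (n - (i + (1 + 1))) = n by omega))

/-- Replaces the truncated subtraction in the definition by any `b` with the right sum, which allows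
free rebracketing. -/
theorem adjBraid_heq {n i b : ℕ} (h : i + 1 < n) (hb : n = i + (1 + 1) + b) :
    HEq (adjBraid X i h).hom (tens (tens (𝟙 (tpow X i)) (tbraid X 1 1)) (𝟙 (tpow X b))) := by
  obtain rfl : b = n - (i + (1 + 1)) := by omega
  exact (tcast_comp_heq _ _).trans (comp_tcast_heq _ _)

theorem adjBraid_comm {n i j : ℕ} (hi : i + 1 < n) (hj : j + 1 < n) (h : i + 1 < j) :
    adjBraid X i hi * adjBraid X j hj = adjBraid X j hj * adjBraid X i hi := by
  -- With `c` factors between the two pairs and `d` after them, the two braidings act on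
  -- complementary tensor factors and so commute.
  obtain ⟨c, rfl⟩ := Nat.exists_eq_add_of_le (show i + (1 + 1) ≤ j by omega)
  obtain ⟨d, hd⟩ := Nat.exists_eq_add_of_le (show i + (1 + 1) + c + (1 + 1) ≤ n by omega)
  obtain rfl : n = i + (1 + 1) + c + (1 + 1 + d) := by omega
  have h1 : (adjBraid X i hi).hom =
      tens (tens (tens (𝟙 (tpow X i)) (tbraid X 1 1)) (𝟙 (tpow X c)))
        (𝟙 (tpow X (1 + 1 + d))) := by
    refine eq_of_heq ((adjBraid_heq X hi (Nat.add_assoc _ _ _)).trans ?_)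
    rw [← tens_id]
    exact (tens_assoc _ _ _).symm
  have h2 : (adjBraid X (i + (1 + 1) + c) hj).hom =
      tens (𝟙 (tpow X (i + (1 + 1) + c))) (tens (tbraid X 1 1) (𝟙 (tpow X d))) :=
    eq_of_heq ((adjBraid_heq X hj (Nat.add_assoc _ _ _).symm).trans (tens_assoc _ _ _))
  refine Iso.ext ?_
  change (adjBraid X (i + (1 + 1) + c) hj).hom ≫ (adjBraid X i hi).hom =
    (adjBraid X i hi).hom ≫ (adjBraid X (i + (1 + 1) + c) hj).hom
  rw [h1, h2, tens_comp_tens, tens_comp_tens]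
  simp only [Category.id_comp, Category.comp_id]

/-- Both automorphisms are identities outside three consecutive factors; on these the relation is
the Yang-Baxter equation. -/
theorem adjBraid_braid {n i : ℕ} (hi : i + 1 < n) (hj : i + 1 + 1 < n) :
    adjBraid X i hi * adjBraid X (i + 1) hj * adjBraid X i hi =
      adjBraid X (i + 1) hj * adjBraid X i hi * adjBraid X (i + 1) hj := by
  obtain ⟨d, rfl⟩ := Nat.exists_eq_add_of_le (show i + 3 ≤ n by omega)
  let s : tpow X 3 ⟶ tpow X 3 := (tens (tbraid X 1 1) (𝟙 (tpow X 1)) :)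
  let t : tpow X 3 ⟶ tpow X 3 := (tens (𝟙 (tpow X 1)) (tbraid X 1 1) :)
  have h1 : (adjBraid X i hi).hom = tens (tens (𝟙 (tpow X i)) s) (𝟙 (tpow X d)) := by
    refine eq_of_heq ((adjBraid_heq X hi (show _ = i + (1 + 1) + (1 + d) by omega)).trans ?_)
    rw [← tens_id]
    exact (tens_assoc _ _ _).symm.trans (tens_heq_tens rfl rfl rfl rfl (tens_assoc _ _ _) HEq.rfl)
  have h2 : (adjBraid X (i + 1) hj).hom = tens (tens (𝟙 (tpow X i)) t) (𝟙 (tpow X d)) := by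
    refine eq_of_heq ((adjBraid_heq X hj (show _ = i + 1 + (1 + 1) + d by omega)).trans ?_)
    rw [← tens_id X i 1]
    exact tens_heq_tens rfl rfl rfl rfl (tens_assoc _ _ _) HEq.rfl
  have h3 : s ≫ t ≫ s = t ≫ s ≫ t := tbraid_yang_baxter HEq.rfl HEq.rfl
  refine Iso.ext ?_
  change (adjBraid X i hi).hom ≫ (adjBraid X (i + 1) hj).hom ≫ (adjBraid X i hi).hom =
    (adjBraid X (i + 1) hj).hom ≫ (adjBraid X i hi).hom ≫ (adjBraid X (i + 1) hj).hom
  rw [h1, h2]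
  simp only [tens_comp_tens, Category.comp_id, h3]

/-- The action of the braid groups on the tensor powers of an object by automorphisms. -/
noncomputable def braidAut (n : ℕ) : BraidGroup n →* Aut (tpow X n) :=
  BraidGroup.lift (fun i h => adjBraid X i h) (fun _ _ hi hj h => adjBraid_comm X hi hj h)
    (fun _ hi hj => adjBraid_braid X hi hj)

theorem braidAut_gen {n i : ℕ} (h : i + 1 < n) :
    braidAut X n (BraidGroup.gen i h) = adjBraid X i h := BraidGroup.lift_gen _ _ _ _ _

/-- Both sides are homomorphisms in `x`, so it suffices to compare them on generators, where only
the bracketing of the identity factors differs. -/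
theorem braidAut_inl {a : ℕ} (b : ℕ) (x : BraidGroup a) :
    braidAut X (a + b) (BraidGroup.inl a b x) = tensAutLeft X a b (braidAut X a x) := by
  have h : (braidAut X (a + b)).comp (BraidGroup.inl a b) =
      (tensAutLeft X a b).comp (braidAut X a) := BraidGroup.hom_ext (fun i hi => by
    rw [MonoidHom.comp_apply, MonoidHom.comp_apply, BraidGroup.inl_gen, braidAut_gen,
      braidAut_gen]
    refine Iso.ext ?_
    obtain ⟨c, rfl⟩ := Nat.exists_eq_add_of_le (show i + (1 + 1) ≤ a by omega)
    have h1 := eq_of_heq (adjBraid_heq X hi rfl)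
    change _ = tens (adjBraid X i hi).hom (𝟙 (tpow X b))
    rw [h1]
    refine eq_of_heq ((adjBraid_heq X _ (Nat.add_assoc _ c b)).trans ?_)
    rw [← tens_id]
    exact (tens_assoc _ _ _).symm)
  exact DFunLike.congr_fun h x

theorem braidAut_inr (a : ℕ) {b : ℕ} (x : BraidGroup b) :
    braidAut X (a + b) (BraidGroup.inr a b x) = tensAutRight X a b (braidAut X b x) := by
  have h : (braidAut X (a + b)).comp (BraidGroup.inr a b) =
      (tensAutRight X a b).comp (braidAut X b) := BraidGroup.hom_ext (fun i hi => by
    rw [MonoidHom.comp_apply, MonoidHom.comp_apply, BraidGroup.inr_gen, braidAut_gen,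
      braidAut_gen]
    refine Iso.ext ?_
    obtain ⟨c, rfl⟩ := Nat.exists_eq_add_of_le (show i + (1 + 1) ≤ b by omega)
    have h1 := eq_of_heq (adjBraid_heq X hi rfl)
    change _ = tens (𝟙 (tpow X a)) (adjBraid X i hi).hom
    rw [h1]
    refine eq_of_heq ((adjBraid_heq X _
      (show _ = a + i + (1 + 1) + c by omega)).trans ?_)
    rw [← tens_id X a i]
    refine HEq.trans ?_ (tens_assoc _ _ _)
    exact tens_heq_tens (Nat.add_assoc _ _ _) rfl (Nat.add_assoc _ _ _) rfl (tens_assoc _ _ _)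
      HEq.rfl)
  exact DFunLike.congr_fun h x

theorem braidAut_sum {a b : ℕ} (x : BraidGroup a) (y : BraidGroup b) :
    (braidAut X (a + b) (BraidGroup.sum x y)).hom =
      tens (braidAut X a x).hom (braidAut X b y).hom := by
  rw [BraidGroup.sum, map_mul, braidAut_inl, braidAut_inr]
  change tens (𝟙 (tpow X a)) (braidAut X b y).hom ≫ tens (braidAut X a x).hom (𝟙 (tpow X b)) = _
  rw [tens_comp_tens, Category.id_comp, Category.comp_id]

theorem braidAut_blockSwap_one_one :
    (braidAut X (1 + 1) (BraidGroup.blockSwap 1 1)).hom = tbraid X 1 1 := by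
  rw [BraidGroup.blockSwap_one_one, braidAut_gen]
  refine eq_of_heq ((adjBraid_heq X _ (show 1 + 1 = 0 + (1 + 1) + 0 by rfl)).trans ?_)
  rw [tens_zero]
  exact zero_tens _

/-- The action of the braid groups on the tensor powers of an object. -/
noncomputable def braidRep : PowRep CrossedGroups.braidGroups X where
  rep n := (Aut.toEnd (tpow X n)).comp (braidAut X n)
  rep_sum x y := braidAut_sum X x y
  rep_swap_one := braidAut_blockSwap_one_one X

end Rep

/-! ### The action of the symmetric groups in a symmetric category. -/

section SymmetricRep

variable {C : Type u} [Category.{v} C] [MonoidalCategory C] [SymmetricCategory C] (X : C)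

theorem tbraid_symmetry (a b : ℕ) : tbraid X a b ≫ tbraid X b a = 𝟙 _ := by
  simp [tbraid]

theorem adjBraid_mul_self {n i : ℕ} (h : i + 1 < n) : adjBraid X i h * adjBraid X i h = 1 := by
  obtain ⟨b, rfl⟩ := Nat.exists_eq_add_of_le (show i + (1 + 1) ≤ n by omega)
  refine Iso.ext ?_
  change (adjBraid X i h).hom ≫ (adjBraid X i h).hom = 𝟙 _
  rw [eq_of_heq (adjBraid_heq X h rfl)]
  simp only [tens_comp_tens, Category.comp_id, tbraid_symmetry, tens_id]

/-- The action of the symmetric groups on the tensor powers of an object by automorphisms. -/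
noncomputable def symmAut (n : ℕ) : Equiv.Perm (Fin n) →* Aut (tpow X n) where
  toFun σ := braidAut X n (BraidGroup.posBraid σ)
  map_one' := by rw [BraidGroup.posBraid_one, map_one]
  -- The symmetry makes the adjacent braidings involutions, which is the hypothesis needed here.
  map_mul' σ τ := BraidGroup.map_posBraid_mul _
    (fun i hi => by rw [braidAut_gen, adjBraid_mul_self]) σ τ

/-- The action of the symmetric groups on the tensor powers of an object. -/
noncomputable def symmRep : PowRep CrossedGroups.symmetricGroups X where
  rep n := (Aut.toEnd (tpow X n)).comp (symmAut X n)
  rep_sum {a b} σ τ := by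
    refine (congrArg (fun t => (braidAut X (a + b) t).hom)
      (BraidGroup.sum_posBraid σ τ).symm).trans ?_
    exact braidAut_sum X _ _
  rep_swap_one := braidAut_blockSwap_one_one X

end SymmetricRep

/-! ### Generators of `𝔻 ⊗ 𝕁 ⊗ 𝔾` and the universal `G`-monoid. -/

namespace CrossedGroups

section Generators

variable {K : CrossedGroups.{w}}

/-- An order-preserving map as a morphism of `𝔻 ⊗ 𝕁`. -/
def ofMap {n m : ℕ} (φ : OrdMap n m) : (⟨n⟩ : K.Obj) ⟶ ⟨m⟩ := ⟨φ, 1⟩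

/-- A group element as a morphism of `𝔻 ⊗ 𝕁`. -/
def ofElt {n : ℕ} (j : K.J n) : (⟨n⟩ : K.Obj) ⟶ ⟨n⟩ := ⟨OrderHom.id, j⟩

theorem ofMap_comp {l n m : ℕ} (φ : OrdMap n m) (ψ : OrdMap l n) :
    (ofMap (φ.comp ψ) : (⟨l⟩ : K.Obj) ⟶ ⟨m⟩) = ofMap ψ ≫ ofMap φ := by
  refine hom_ext ?_ ?_
  · change φ.comp ψ = φ.comp (permPush (K.perm _ 1) ψ)
    rw [map_one, permPush_one]
  · change 1 = K.pull ψ 1 * 1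
    rw [K.pull_one, mul_one]

theorem ofMap_sum {a b c d : ℕ} (φ : OrdMap a c) (ψ : OrdMap b d) :
    (ofMap (φ.sum ψ) : (⟨a + b⟩ : K.Obj) ⟶ ⟨c + d⟩) = (ofMap φ ⊗ₘ ofMap ψ :) :=
  hom_ext rfl K.sum_one.symm

theorem ofElt_mul {n : ℕ} (i j : K.J n) : ofElt (i * j) = ofElt j ≫ ofElt i := by
  refine hom_ext ?_ ?_
  · exact (permPush_id _).symm
  · exact congrArg (· * j) (K.pull_id i).symm

theorem ofElt_sum {a b : ℕ} (i : K.J a) (j : K.J b) :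
    ofElt (K.sum i j) = (ofElt i ⊗ₘ ofElt j :) :=
  hom_ext (sum_id a b).symm rfl

theorem ofElt_comp_ofMap {n m : ℕ} (j : K.J n) (φ : OrdMap n m) :
    ofElt j ≫ ofMap φ = (⟨φ, j⟩ : Hom K ⟨n⟩ ⟨m⟩) := by
  refine hom_ext ?_ ?_
  · change φ.comp (permPush _ OrderHom.id) = φ
    rw [permPush_id]
    rfl
  · change K.pull _ 1 * j = j
    rw [K.pull_one, one_mul]

theorem braiding_one_one : (β_ (⟨1⟩ : K.Obj) ⟨1⟩).hom = (ofElt (K.swap 1 1) :) :=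
  hom_ext (braidingIso_map _ _) (braidingIso_elt _ _)

/-- There is only one map to a one-element set. Hence the axioms for the `G`-monoid `1` only have to
be checked on group elements. -/
theorem hom_one_ext {Y : K.Obj} {f g : Y ⟶ ⟨1⟩} (h : f.elt = g.elt) : f = g :=
  hom_ext (Subsingleton.elim (α := OrdMap Y.n 1) _ _) h

variable (K)

/-- The monoid `1` of `𝔻 ⊗ 𝕁`. -/
def ptMon : Mon K.Obj where
  X := ⟨1⟩
  mon :=
    { one := ofMap (OrdMap.toOne 0)
      mul := ofMap (OrdMap.toOne (1 + 1))
      one_mul := by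
        refine hom_one_ext ?_
        rw [comp_elt, leftUnitor_eq, eqToIso.hom, eqToHom_elt]
        change K.pull _ 1 * K.sum 1 1 = 1
        rw [K.pull_one, K.sum_one, one_mul]
      mul_one := by
        refine hom_one_ext ?_
        rw [comp_elt, rightUnitor_eq, eqToIso.hom, eqToHom_elt]
        change K.pull _ 1 * K.sum 1 1 = 1
        rw [K.pull_one, K.sum_one, one_mul]
      mul_assoc := by
        refine hom_one_ext ?_
        rw [comp_elt, comp_elt, comp_elt, associator_hom_elt]
        change K.pull _ 1 * K.sum 1 1 = K.pull _ (K.pull _ 1 * K.sum 1 1) * 1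
        rw [K.pull_one, K.sum_one, K.pull_one, one_mul, K.sum_one, one_mul, K.pull_one, mul_one] }

end Generators

section Labelled

variable {K : CrossedGroups.{w}} {G : Type w'} [Group G]

variable (K) in
/-- The element of `G ^ n ⋊ J n` given by a family of labels. -/
def ofLabels {n : ℕ} (x : Fin n → G) : (K.labelled G).J n :=
  (SemidirectProduct.inl x : K.LabelledGroup G n)

variable (K) in
theorem ofLabels_one (n : ℕ) : K.ofLabels (1 : Fin n → G) = 1 := rfl

theorem ofLabels_append {a b : ℕ} (x : Fin a → G) (y : Fin b → G) :
    K.ofLabels (Fin.append x y) = (K.labelled G).sum (K.ofLabels x) (K.ofLabels y) :=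
  SemidirectProduct.ext rfl K.sum_one.symm

theorem pull_ofLabels {n m : ℕ} (φ : OrdMap n m) (x : Fin m → G) :
    (K.labelled G).pull φ (K.ofLabels x) = K.ofLabels (fun k => x (φ k)) := by
  refine SemidirectProduct.ext ?_ (K.pull_one φ)
  funext k
  change x (permPush (K.perm m 1) φ k) = x (φ k)
  rw [map_one, permPush_one]

theorem ofLabels_mul {n : ℕ} (x y : Fin n → G) :
    K.ofLabels (x * y) = K.ofLabels x * K.ofLabels y :=
  map_mul (SemidirectProduct.inl : _ →* K.LabelledGroup G n) x y

/-- The label `g` as an endomorphism of the object `1`. -/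
def ofLabel (K : CrossedGroups.{w}) (g : G) : (⟨1⟩ : (K.labelled G).Obj) ⟶ ⟨1⟩ :=
  ofElt (K.ofLabels fun _ => g)

theorem ofMap_toOne_zero_comp_ofLabel (g : G) :
    ofMap (OrdMap.toOne 0) ≫ ofLabel K g = ofMap (OrdMap.toOne 0) := by
  refine hom_one_ext ?_
  rw [comp_elt]
  change (K.labelled G).pull _ (K.ofLabels _) * 1 = 1
  rw [pull_ofLabels, mul_one, ← ofLabels_one]
  exact congrArg _ (Subsingleton.elim _ _)

/-- Pulling the label `g` back along `2 → 1` copies it to both strands, so labels act by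
multiplicative maps. -/
theorem ofMap_toOne_two_comp_ofLabel (g : G) :
    ofMap (OrdMap.toOne (1 + 1)) ≫ ofLabel K g =
      ((ofLabel K g ⊗ₘ ofLabel K g) ≫ ofMap (OrdMap.toOne (1 + 1)) :) := by
  refine hom_one_ext ?_
  rw [comp_elt, comp_elt]
  change (K.labelled G).pull _ (K.ofLabels _) * 1 =
    (K.labelled G).pull _ 1 * (K.labelled G).sum (K.ofLabels _) (K.ofLabels _)
  rw [pull_ofLabels, mul_one, (K.labelled G).pull_one, one_mul, ← ofLabels_append]
  congr 1
  funext i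
  induction i using Fin.addCases with
  | left i => exact (Fin.append_left (fun _ => g) (fun _ => g) i).symm
  | right i => exact (Fin.append_right (fun _ => g) (fun _ => g) i).symm

/-- Every morphism is a group element followed by an order-preserving map, and a labelled group
element factors into a group element followed by labels. Each factor is built from the listed
generators by sums and composites, with inverses needed only for the subgroup generated by
crossings. -/
theorem morphismProperty_eq_top (hK : K.GeneratedBySwap)
    (Q : MorphismProperty (K.labelled G).Obj) [Q.IsMultiplicative]
    (tensor : ∀ {Y Z Y' Z' : (K.labelled G).Obj} (f : Y ⟶ Z) (g : Y' ⟶ Z'), Q f → Q g →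
      Q (f ⊗ₘ g))
    (inv : ∀ {Y Z : (K.labelled G).Obj} (e : Y ≅ Z), Q e.hom → Q e.inv)
    (braiding : Q (β_ (⟨1⟩ : (K.labelled G).Obj) ⟨1⟩).hom)
    (one : Q (ofMap (OrdMap.toOne 0))) (mul : Q (ofMap (OrdMap.toOne (1 + 1))))
    (label : ∀ g : G, Q (ofLabel K g)) {Y Z : (K.labelled G).Obj} (f : Y ⟶ Z) : Q f := by
  have h1 : ∀ {n m : ℕ} (φ : OrdMap n m), Q (ofMap φ) := by
    intro n m φ
    induction m generalizing n with
    | zero =>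
      obtain rfl := φ.eq_zero
      rw [Subsingleton.elim φ OrderHom.id]
      exact Q.id_mem _
    | succ m ih =>
      obtain ⟨a, k, rfl, φ₁, φ₂, rfl⟩ := φ.exists_eq_sum
      rw [OrdMap.comp_cast_refl, ofMap_sum]
      refine tensor _ _ (ih φ₁) ?_
      clear ih φ₁
      induction k with
      | zero =>
        rw [Subsingleton.elim φ₂ (OrdMap.toOne 0)]
        exact one
      | succ k ih =>
        -- A map `k + 1 → 1` multiplies the first `k` factors and then multiplies the result with
        -- the last one.
        rw [show φ₂ = (OrdMap.toOne (1 + 1)).comp ((OrdMap.toOne k).sum OrderHom.id) from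
          Subsingleton.elim _ _, ofMap_comp]
        refine Q.comp_mem _ _ ?_ mul
        rw [ofMap_sum]
        exact tensor _ _ (ih _) (Q.id_mem _)
  have h2 : ∀ {n : ℕ} (x : Fin n → G), Q (ofElt (K.ofLabels x)) := by
    intro n x
    induction n with
    | zero =>
      rw [Subsingleton.elim x 1, ofLabels_one]
      exact Q.id_mem _
    | succ n ih =>
      rw [← Fin.append_castAdd_natAdd (m := n) (n := 1) (f := x), ofLabels_append, ofElt_sum]
      refine tensor _ _ (ih _) ?_
      rw [show (fun i : Fin 1 => x (Fin.natAdd n i)) = fun _ => x (Fin.natAdd n 0) from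
        funext fun i => by rw [Subsingleton.elim i 0]]
      exact label _
  have h3 : ∀ {n : ℕ} (j : K.J n),
      Q (ofElt (K := K.labelled G) (SemidirectProduct.inr j : K.LabelledGroup G n)) := by
    intro n j
    -- The unlabelled elements with the property form a subgroup; it contains the adjacent crossings
    -- because these are tensor products of identities with the braiding of `1` and `1`.
    let H : Subgroup (K.J n) :=
      { carrier :=
          {j | Q (ofElt (K := K.labelled G) (SemidirectProduct.inr j : K.LabelledGroup G n))}
        mul_mem' := fun {i j} hi hj => by
          have h : (SemidirectProduct.inr (i * j) : K.LabelledGroup G n) =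
            SemidirectProduct.inr i * SemidirectProduct.inr j := map_mul _ _ _
          have h' := ofElt_mul (K := K.labelled G)
            (SemidirectProduct.inr i : K.LabelledGroup G n) (SemidirectProduct.inr j)
          change Q (ofElt _)
          rw [h]
          exact h' ▸ Q.comp_mem _ _ hj hi
        one_mem' := Q.id_mem _
        inv_mem' := fun {i} hi => by
          have h : (SemidirectProduct.inr i⁻¹ : K.LabelledGroup G n) =
            (SemidirectProduct.inr i)⁻¹ := map_inv _ _
          change Q (ofElt _)
          rw [h]
          exact inv (autIso (K := K.labelled G) n
            (SemidirectProduct.inr i : K.LabelledGroup G n)) hi }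
    have h : H = ⊤ := hK n H (fun a b h => by
      subst h
      change Q (ofElt _)
      rw [OrdMap.cast_refl, K.pull_id, ← labelledSum_inr, ← labelledSum_inr]
      have e1 := ofElt_sum (K := K.labelled G) (K.labelledSum
        (SemidirectProduct.inr (1 : K.J a) : K.LabelledGroup G a)
        (SemidirectProduct.inr (K.swap 1 1))) (SemidirectProduct.inr (1 : K.J b))
      have e2 := ofElt_sum (K := K.labelled G)
        (SemidirectProduct.inr (1 : K.J a) : K.LabelledGroup G a)
        (SemidirectProduct.inr (K.swap 1 1) : K.LabelledGroup G (1 + 1))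
      refine e1 ▸ tensor _ _ (e2 ▸ tensor _ _ (Q.id_mem _) ?_) (Q.id_mem _)
      exact (braiding_one_one (K := K.labelled G)) ▸ braiding)
    have hj : j ∈ H := by
      rw [h]
      trivial
    exact hj
  have h4 : ∀ {n : ℕ} (p : (K.labelled G).J n), Q (ofElt p) := by
    intro n p
    have e : ofElt (K := K.labelled G) p = ofElt (K := K.labelled G)
        (SemidirectProduct.inr p.right : K.LabelledGroup G n) ≫ ofElt (K.ofLabels p.left) :=
      (congrArg (ofElt (K := K.labelled G))
        (SemidirectProduct.inl_left_mul_inr_right (φ := K.labelAction G n) p).symm).trans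
        (ofElt_mul (K := K.labelled G) (K.ofLabels p.left) _)
    rw [e]
    exact Q.comp_mem _ _ (h3 _) (h2 _)
  have h := Q.comp_mem _ _ (h4 f.elt) (h1 f.map)
  rw [ofElt_comp_ofMap] at h
  exact h

variable (K G)

/-- The monoid `1` of `𝔻 ⊗ 𝕁 ⊗ 𝔾` with its action of `G`. -/
def labelMon : SingleObj G ⥤ Mon (K.labelled G).Obj where
  obj _ := (K.labelled G).ptMon
  map g :=
    { hom := ofLabel K g
      isMonHom_hom :=
        { one_hom := ofMap_toOne_zero_comp_ofLabel g
          mul_hom := ofMap_toOne_two_comp_ofLabel g } }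
  map_id _ := rfl
  map_comp g h := by
    refine Mon.Hom.ext ?_
    change ofLabel K (h * g) = ofLabel K g ≫ ofLabel K h
    rw [ofLabel, ofLabel, ofLabel, ← ofElt_mul, ← ofLabels_mul]
    rfl

end Labelled

end CrossedGroups

/-! ### Extension of a morphism at `1` to a monoidal transformation. -/

section Monoidal

open Functor.LaxMonoidal Functor.OplaxMonoidal

variable {P : Type u'} [Category.{v'} P] [MonoidalCategory P]
  {C : Type u} [Category.{v} C] [MonoidalCategory C]
  {F F' : P ⥤ C} [F.Monoidal] [F'.Monoidal]

/-- The inductive step of `μ_extend_add`. After precomposition with the invertible `μ F Z W`,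
associativity of the two monoidal structures turns the claim at `(Y, Z ⊗ W)` into the one at `(Y ⊗
Z, W)`. The components are separate variables since no natural transformation is available yet. -/
theorem compat_tensor_of_associator {Y Z W : P} {tY : F.obj Y ⟶ F'.obj Y} {tZ : F.obj Z ⟶ F'.obj Z}
    {tW : F.obj W ⟶ F'.obj W} {tYZ : F.obj (Y ⊗ Z) ⟶ F'.obj (Y ⊗ Z)}
    {tZW : F.obj (Z ⊗ W) ⟶ F'.obj (Z ⊗ W)} {t : F.obj ((Y ⊗ Z) ⊗ W) ⟶ F'.obj ((Y ⊗ Z) ⊗ W)}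
    {t' : F.obj (Y ⊗ Z ⊗ W) ⟶ F'.obj (Y ⊗ Z ⊗ W)}
    (hYZ : μ F Y Z ≫ tYZ = (tY ⊗ₘ tZ) ≫ μ F' Y Z)
    (h : μ F (Y ⊗ Z) W ≫ t = (tYZ ⊗ₘ tW) ≫ μ F' (Y ⊗ Z) W)
    (hZW : μ F Z W ≫ tZW = (tZ ⊗ₘ tW) ≫ μ F' Z W)
    (hα : F.map (α_ Y Z W).hom ≫ t' = t ≫ F'.map (α_ Y Z W).hom) :
    μ F Y (Z ⊗ W) ≫ t' = (tY ⊗ₘ tZW) ≫ μ F' Y (Z ⊗ W) := by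
  rw [← cancel_epi (F.obj Y ◁ μ F Z W), ← cancel_epi (α_ (F.obj Y) (F.obj Z) (F.obj W)).hom]
  have e1 : F.obj Y ◁ μ F Z W ≫ (tY ⊗ₘ tZW) ≫ μ F' Y (Z ⊗ W) =
      (tY ⊗ₘ (tZ ⊗ₘ tW)) ≫ F'.obj Y ◁ μ F' Z W ≫ μ F' Y (Z ⊗ W) := by
    rw [← Category.assoc, ← Category.assoc, ← id_tensorHom, ← id_tensorHom,
      tensorHom_comp_tensorHom, tensorHom_comp_tensorHom, hZW, Category.id_comp, Category.comp_id]
  have e2 : μ F Y Z ▷ F.obj W ≫ (tYZ ⊗ₘ tW) = ((tY ⊗ₘ tZ) ⊗ₘ tW) ≫ μ F' Y Z ▷ F'.obj W := by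
    rw [← tensorHom_id, ← tensorHom_id, tensorHom_comp_tensorHom, tensorHom_comp_tensorHom, hYZ,
      Category.id_comp, Category.comp_id]
  rw [e1, ← Functor.LaxMonoidal.associativity_assoc, hα, reassoc_of% h, reassoc_of% e2,
    Functor.LaxMonoidal.associativity,
    associator_naturality_assoc]

theorem compat_tensor_of_rightUnitor {Y : P} {tY : F.obj Y ⟶ F'.obj Y}
    {t₀ : F.obj (𝟙_ P) ⟶ F'.obj (𝟙_ P)} {t : F.obj (Y ⊗ 𝟙_ P) ⟶ F'.obj (Y ⊗ 𝟙_ P)}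
    (h₀ : ε F ≫ t₀ = ε F') (hρ : F.map (ρ_ Y).hom ≫ tY = t ≫ F'.map (ρ_ Y).hom) :
    μ F Y (𝟙_ P) ≫ t = (tY ⊗ₘ t₀) ≫ μ F' Y (𝟙_ P) := by
  rw [← cancel_epi (F.obj Y ◁ ε F), ← cancel_mono (F'.map (ρ_ Y).hom)]
  have e : F.obj Y ◁ ε F ≫ (tY ⊗ₘ t₀) = tY ▷ 𝟙_ C ≫ F'.obj Y ◁ ε F' := by
    rw [← id_tensorHom, ← id_tensorHom, ← tensorHom_id, tensorHom_comp_tensorHom,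
      tensorHom_comp_tensorHom, h₀, Category.id_comp, Category.comp_id, Category.id_comp]
  rw [Category.assoc, Category.assoc, Category.assoc, Category.assoc, ← hρ,
    ← Functor.LaxMonoidal.right_unitality_assoc, reassoc_of% e,
    ← Functor.LaxMonoidal.right_unitality, rightUnitor_naturality]

theorem compat_leftUnitor {Y : P} (f : F.obj Y ⟶ F'.obj Y) :
    δ F (𝟙_ P) Y ≫ ((η F ≫ ε F') ⊗ₘ f) ≫ μ F' (𝟙_ P) Y ≫ F'.map (λ_ Y).hom =
      F.map (λ_ Y).hom ≫ f := by
  rw [← cancel_epi (μ F (𝟙_ P) Y), ← cancel_epi (ε F ▷ F.obj Y)]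
  have e : ε F ▷ F.obj Y ≫ ((η F ≫ ε F') ⊗ₘ f) = 𝟙_ C ◁ f ≫ ε F' ▷ F'.obj Y := by
    rw [← tensorHom_id, ← tensorHom_id, ← id_tensorHom, tensorHom_comp_tensorHom,
      tensorHom_comp_tensorHom, Category.id_comp, Category.comp_id, Category.id_comp,
      Functor.Monoidal.ε_η_assoc]
  rw [Functor.Monoidal.μ_δ_assoc, reassoc_of% e, ← Functor.LaxMonoidal.left_unitality,
    ← Functor.LaxMonoidal.left_unitality_assoc,
    leftUnitor_naturality]

/-- Both functors carry the braiding to the braiding, which is natural with respect to `tY ⊗ₘ tY`.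
-/
theorem compat_braiding [BraidedCategory P] [BraidedCategory C] {F F' : P ⥤ C} [F.Braided]
    [F'.Braided] {Y : P} {tY : F.obj Y ⟶ F'.obj Y} {t : F.obj (Y ⊗ Y) ⟶ F'.obj (Y ⊗ Y)}
    (h : μ F Y Y ≫ t = (tY ⊗ₘ tY) ≫ μ F' Y Y) :
    F.map (β_ Y Y).hom ≫ t = t ≫ F'.map (β_ Y Y).hom := by
  rw [← cancel_epi (μ F Y Y), reassoc_of% h, Functor.LaxBraided.braided,
    Functor.LaxBraided.braided_assoc, h, BraidedCategory.braiding_naturality_assoc]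

end Monoidal

namespace CrossedGroups

section Extend

open Functor.LaxMonoidal Functor.OplaxMonoidal

variable {K : CrossedGroups.{w}} {C : Type u} [Category.{v} C] [MonoidalCategory C]
  {F F' : K.Obj ⥤ C} [F.Monoidal] [F'.Monoidal]

/-- The family of morphisms between the values of two monoidal functors that is determined by its
component at the object `1`. -/
def extend (f : F.obj ⟨1⟩ ⟶ F'.obj ⟨1⟩) : ∀ n : ℕ, F.obj ⟨n⟩ ⟶ F'.obj ⟨n⟩
  | 0 => η F ≫ ε F'
  | n + 1 => δ F ⟨n⟩ ⟨1⟩ ≫ (extend f n ⊗ₘ f) ≫ μ F' ⟨n⟩ ⟨1⟩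

variable (f : F.obj ⟨1⟩ ⟶ F'.obj ⟨1⟩)

theorem ε_extend : ε F ≫ extend f 0 = ε F' := Functor.Monoidal.ε_η_assoc F _

theorem μ_extend_succ (n : ℕ) :
    μ F ⟨n⟩ ⟨1⟩ ≫ extend f (n + 1) = (extend f n ⊗ₘ f) ≫ μ F' ⟨n⟩ ⟨1⟩ :=
  Functor.Monoidal.μ_δ_assoc F _ _ _

/-- Follows from left unitality, as the left unitor at `1` is an identity: `0 + 1` reduces to `1`.
-/
theorem extend_one : extend f 1 = f := by
  have h := compat_leftUnitor (P := K.Obj) (Y := ⟨1⟩) f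
  have e : (λ_ (⟨1⟩ : K.Obj)).hom = 𝟙 (⟨1⟩ : K.Obj) := rfl
  have e1 : F'.map (λ_ (⟨1⟩ : K.Obj)).hom = 𝟙 (F'.obj ⟨1⟩) := F'.map_id _
  have e2 : F.map (λ_ (⟨1⟩ : K.Obj)).hom ≫ f = f :=
    (congrArg (· ≫ f) (F.map_id (⟨1⟩ : K.Obj))).trans (Category.id_comp f)
  refine Eq.trans ?_ (h.trans e2)
  exact congrArg (fun t => δ F (𝟙_ K.Obj) ⟨1⟩ ≫ ((η F ≫ ε F') ⊗ₘ f) ≫ t)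
    ((Category.comp_id _).symm.trans (congrArg (μ F' (𝟙_ K.Obj) ⟨1⟩ ≫ ·) e1.symm))

/-- The recursion makes `extend` compatible with adding one strand; induction on `b` gives all
tensor products. The associator at `(a, b, 1)` and the right unitor are identities by computation.
-/
theorem μ_extend_add (a b : ℕ) :
    μ F ⟨a⟩ ⟨b⟩ ≫ extend f (a + b) = (extend f a ⊗ₘ extend f b) ≫ μ F' ⟨a⟩ ⟨b⟩ := by
  induction b with
  | zero =>
    refine compat_tensor_of_rightUnitor (P := K.Obj) (Y := ⟨a⟩) (ε_extend f) ?_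
    have e1 : F'.map (ρ_ (⟨a⟩ : K.Obj)).hom = 𝟙 (F'.obj ⟨a⟩) := F'.map_id _
    have e2 : F.map (ρ_ (⟨a⟩ : K.Obj)).hom = 𝟙 (F.obj ⟨a⟩) := F.map_id _
    exact ((congrArg (· ≫ extend f a) e2).trans (Category.id_comp _)).trans
      ((congrArg (extend f a ≫ ·) e1).trans (Category.comp_id _)).symm
  | succ b ih =>
    have e1 : F'.map (α_ (⟨a⟩ : K.Obj) ⟨b⟩ ⟨1⟩).hom = 𝟙 (F'.obj ⟨a + b + 1⟩) := F'.map_id _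
    have e2 : F.map (α_ (⟨a⟩ : K.Obj) ⟨b⟩ ⟨1⟩).hom = 𝟙 (F.obj ⟨a + b + 1⟩) := F.map_id _
    refine compat_tensor_of_associator (P := K.Obj) (Y := ⟨a⟩) (Z := ⟨b⟩) (W := ⟨1⟩) ih
      (μ_extend_succ f (a + b)) (μ_extend_succ f b) ?_
    exact ((congrArg (· ≫ extend f (a + b + 1)) e2).trans (Category.id_comp _)).trans
      ((congrArg (extend f (a + b + 1) ≫ ·) e1).trans (Category.comp_id _)).symm

/-- Monoidality forces the unit component and the recursion step, so the component at `1` determines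
the rest; faithfulness of the evaluation follows. -/
theorem eq_extend (τ : F ⟶ F') [NatTrans.IsMonoidal τ] (n : ℕ) :
    τ.app ⟨n⟩ = extend (τ.app ⟨1⟩) n := by
  induction n with
  | zero =>
    rw [← cancel_epi (ε F), ε_extend]
    exact NatTrans.IsMonoidal.unit (τ := τ)
  | succ n ih =>
    rw [← cancel_epi (μ F ⟨n⟩ ⟨1⟩), μ_extend_succ, ← ih]
    exact NatTrans.IsMonoidal.tensor (τ := τ) (⟨n⟩ : K.Obj) ⟨1⟩

end Extend

section Natural

open Functor.LaxMonoidal Functor.OplaxMonoidal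

variable {K : CrossedGroups.{w}} {G : Type w'} [Group G] {C : Type u} [Category.{v} C]
  [MonoidalCategory C] [BraidedCategory C] {F F' : (K.labelled G).Obj ⥤ C} [F.Braided] [F'.Braided]

/-- The morphisms at which `extend f` is natural form a class to which `morphismProperty_eq_top`
applies. The braiding is automatic since the functors are braided; the other generators are the
hypotheses on `f`. -/
theorem extend_natural (hK : K.GeneratedBySwap) (f : F.obj ⟨1⟩ ⟶ F'.obj ⟨1⟩)
    (one : F.map (ofMap (OrdMap.toOne 0)) ≫ f = extend f 0 ≫ F'.map (ofMap (OrdMap.toOne 0)))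
    (mul : F.map (ofMap (OrdMap.toOne (1 + 1))) ≫ f =
      extend f (1 + 1) ≫ F'.map (ofMap (OrdMap.toOne (1 + 1))))
    (label : ∀ g : G, F.map (ofLabel K g) ≫ f = f ≫ F'.map (ofLabel K g))
    {Y Z : (K.labelled G).Obj} (h : Y ⟶ Z) :
    F.map h ≫ extend f Z.n = extend f Y.n ≫ F'.map h := by
  let Q : MorphismProperty (K.labelled G).Obj := fun Y Z h =>
    F.map h ≫ extend f Z.n = extend f Y.n ≫ F'.map h
  have : Q.IsMultiplicative :=
    { id_mem := fun Y => by
        change F.map (𝟙 Y) ≫ _ = _ ≫ F'.map (𝟙 Y)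
        rw [CategoryTheory.Functor.map_id, CategoryTheory.Functor.map_id]
        exact (Category.id_comp _).trans (Category.comp_id _).symm
      comp_mem := fun {X Y Z} a b ha hb => by
        have ha : F.map a ≫ extend f Y.n = extend f X.n ≫ F'.map a := ha
        have hb : F.map b ≫ extend f Z.n = extend f Y.n ≫ F'.map b := hb
        change F.map (a ≫ b) ≫ _ = _ ≫ F'.map (a ≫ b)
        rw [Functor.map_comp, Functor.map_comp, Category.assoc, hb, reassoc_of% ha] }
  refine morphismProperty_eq_top hK Q ?_ ?_ ?_ ?_ ?_ ?_ h
  · intro Y Z Y' Z' a b ha hb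
    have ha : F.map a ≫ extend f Z.n = extend f Y.n ≫ F'.map a := ha
    have hb : F.map b ≫ extend f Z'.n = extend f Y'.n ≫ F'.map b := hb
    have h1 : μ F Y Y' ≫ extend f (Y ⊗ Y').n = (extend f Y.n ⊗ₘ extend f Y'.n) ≫ μ F' Y Y' :=
      μ_extend_add f Y.n Y'.n
    have h2 : μ F Z Z' ≫ extend f (Z ⊗ Z').n = (extend f Z.n ⊗ₘ extend f Z'.n) ≫ μ F' Z Z' :=
      μ_extend_add f Z.n Z'.n
    change F.map (a ⊗ₘ b) ≫ extend f (Z ⊗ Z').n = extend f (Y ⊗ Y').n ≫ F'.map (a ⊗ₘ b)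
    rw [← cancel_epi (μ F Y Y'), reassoc_of% h1, ← μ_natural, ← μ_natural_assoc, h2,
      tensorHom_comp_tensorHom_assoc, tensorHom_comp_tensorHom_assoc, ha, hb]
  · intro Y Z e he
    have he : F.map e.hom ≫ extend f Z.n = extend f Y.n ≫ F'.map e.hom := he
    change F.map e.inv ≫ extend f Y.n = extend f Z.n ≫ F'.map e.inv
    refine (Iso.inv_comp_eq (F.mapIso e)).2 ?_
    rw [Functor.mapIso_hom, reassoc_of% he, ← F'.map_comp, e.hom_inv_id,
      CategoryTheory.Functor.map_id]
    exact (Category.comp_id _).symm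
  · have h1 : μ F (⟨1⟩ : (K.labelled G).Obj) ⟨1⟩ ≫ extend f (1 + 1) =
        (f ⊗ₘ f) ≫ μ F' (⟨1⟩ : (K.labelled G).Obj) ⟨1⟩ := by
      rw [μ_extend_add, extend_one]
    exact compat_braiding h1
  · exact (congrArg (F.map (ofMap (OrdMap.toOne 0)) ≫ ·) (extend_one f)).trans one
  · exact (congrArg (F.map (ofMap (OrdMap.toOne (1 + 1))) ≫ ·) (extend_one f)).trans mul
  · intro g
    exact ((congrArg (F.map (ofLabel K g) ≫ ·) (extend_one f)).trans (label g)).trans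
      (congrArg (· ≫ F'.map (ofLabel K g)) (extend_one f).symm)

end Natural

end CrossedGroups

/-! ### Evaluation at `1` is fully faithful. -/

namespace CrossedGroups

section Evaluation

variable (K : CrossedGroups.{w}) (G : Type w') [Group G] (C : Type u) [Category.{v} C]
  [MonoidalCategory C] [BraidedCategory C]

/-- The `G`-monoid given by the value of an algebra at the object `1`. -/
noncomputable def evaluation : Alg (K.labelled G).Obj C ⥤ GMon G C where
  obj A := K.labelMon G ⋙ A.functor.mapMon
  map f := Functor.whiskerLeft (K.labelMon G) (Functor.mapMonNatTrans f.natTrans)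
  map_id _ := rfl
  map_comp _ _ := rfl

variable {K G C}

instance evaluation_faithful : (K.evaluation G C).Faithful where
  map_injective {A B} f g h := by
    have h1 : f.natTrans.app ⟨1⟩ = g.natTrans.app ⟨1⟩ :=
      congrArg (fun t : (K.evaluation G C).obj A ⟶ (K.evaluation G C).obj B =>
        (t.app (SingleObj.star G)).hom) h
    refine Alg.Hom.ext (NatTrans.ext (funext fun Y => ?_))
    exact (eq_extend f.natTrans Y.n).trans
      ((congrArg (fun t => extend t Y.n) h1).trans (eq_extend g.natTrans Y.n).symm)

open Functor.LaxMonoidal Functor.OplaxMonoidal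

theorem evaluation_full (hK : K.GeneratedBySwap) : (K.evaluation G C).Full where
  map_surjective {A B} t := by
    let f : A.functor.obj ⟨1⟩ ⟶ B.functor.obj ⟨1⟩ := (t.app (SingleObj.star G)).hom
    have h1 : (ε A.functor ≫ A.functor.map (ofMap (OrdMap.toOne 0))) ≫ f =
        ε B.functor ≫ B.functor.map (ofMap (OrdMap.toOne 0)) :=
      (t.app (SingleObj.star G)).isMonHom_hom.one_hom
    have h2 : (μ A.functor ⟨1⟩ ⟨1⟩ ≫ A.functor.map (ofMap (OrdMap.toOne (1 + 1)))) ≫ f =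
        (f ⊗ₘ f) ≫ μ B.functor ⟨1⟩ ⟨1⟩ ≫ B.functor.map (ofMap (OrdMap.toOne (1 + 1))) :=
      (t.app (SingleObj.star G)).isMonHom_hom.mul_hom
    -- Being a morphism of monoids settles the unit and the multiplication; naturality of `t` over
    -- `G` settles the labels.
    have h3 : ∀ g : G, A.functor.map (ofLabel K g) ≫ f = f ≫ B.functor.map (ofLabel K g) :=
      fun g => congrArg (fun s => s.hom) (t.naturality (X := SingleObj.star G)
        (Y := SingleObj.star G) g)
    have nat : ∀ {Y Z : (K.labelled G).Obj} (h : Y ⟶ Z),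
        A.functor.map h ≫ extend f Z.n = extend f Y.n ≫ B.functor.map h := by
      refine extend_natural hK f ?_ ?_ h3
      · rw [← cancel_epi (ε A.functor), ← Category.assoc]
        refine h1.trans ?_
        refine Eq.trans ?_ (Category.assoc _ _ _)
        exact congrArg (· ≫ _) (ε_extend f).symm
      · have h4 := μ_extend_add f 1 1
        rw [extend_one] at h4
        rw [← cancel_epi (μ A.functor ⟨1⟩ ⟨1⟩), ← Category.assoc]
        refine h2.trans ?_
        refine (Category.assoc _ _ _).symm.trans (Eq.trans ?_ (Category.assoc _ _ _))
        exact congrArg (· ≫ _) h4.symm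
    let τ : A.functor ⟶ B.functor :=
      { app := fun Y => extend f Y.n
        naturality := fun _ _ h => nat h }
    have hτ : NatTrans.IsMonoidal τ :=
      { unit := ε_extend f
        tensor := fun Y Z => μ_extend_add f Y.n Z.n }
    refine ⟨⟨τ, hτ⟩, ?_⟩
    refine NatTrans.ext (funext fun x => ?_)
    exact Mon.Hom.ext (extend_one f)

end Evaluation

end CrossedGroups

/-! ### From a `G`-monoid to an algebra. -/

section Monoid

open MonObj

variable {C : Type u} [Category.{v} C] [MonoidalCategory C]

theorem one_mul_of_iso {X T : C} [MonObj X] (e : T ≅ X) :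
    (η[X] ≫ e.inv ⊗ₘ 𝟙 T) ≫ (e.hom ⊗ₘ e.hom) ≫ μ[X] ≫ e.inv = (λ_ T).hom := by
  rw [tensorHom_comp_tensorHom_assoc, Category.assoc, Iso.inv_hom_id, Category.comp_id,
    Category.id_comp, one_mul_hom_assoc, Iso.hom_inv_id, Category.comp_id]

theorem mul_one_of_iso {X T : C} [MonObj X] (e : T ≅ X) :
    (𝟙 T ⊗ₘ η[X] ≫ e.inv) ≫ (e.hom ⊗ₘ e.hom) ≫ μ[X] ≫ e.inv = (ρ_ T).hom := by
  rw [tensorHom_comp_tensorHom_assoc, Category.assoc, Iso.inv_hom_id, Category.comp_id,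
    Category.id_comp, mul_one_hom_assoc, Iso.hom_inv_id, Category.comp_id]

/-- Transport of associativity along `e`, with `p`, `q`, `r` standing for the isomorphisms
`tpowAdd`. It is needed because the first tensor power is `𝟙_ C ⊗ X` and not `X` itself. -/
theorem mul_assoc_of_iso {X T T₂ T₃ : C} [MonObj X] (e : T ≅ X) (p : T ⊗ T ≅ T₂)
    (q : T₂ ⊗ T ≅ T₃) (r : T ⊗ T₂ ≅ T₃)
    (h : p.hom ▷ T ≫ q.hom = (α_ T T T).hom ≫ T ◁ p.hom ≫ r.hom) {m : T₂ ⟶ T}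
    (hm : m = p.inv ≫ (e.hom ⊗ₘ e.hom) ≫ μ[X] ≫ e.inv) :
    (q.inv ≫ (m ⊗ₘ 𝟙 T) ≫ p.hom) ≫ m = (r.inv ≫ (𝟙 T ⊗ₘ m) ≫ p.hom) ≫ m := by
  have h1 : p.hom ≫ m = (e.hom ⊗ₘ e.hom) ≫ μ[X] ≫ e.inv := by
    rw [hm, Iso.hom_inv_id_assoc]
  have h2 : m ≫ e.hom = p.inv ≫ (e.hom ⊗ₘ e.hom) ≫ μ[X] := by
    rw [hm]
    simp
  rw [← cancel_epi q.hom, ← cancel_epi (p.hom ▷ T)]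
  have h3 : p.hom ▷ T ≫ q.hom ≫ (q.inv ≫ (m ⊗ₘ 𝟙 T) ≫ p.hom) ≫ m =
      ((e.hom ⊗ₘ e.hom) ⊗ₘ e.hom) ≫ μ[X] ▷ X ≫ μ[X] ≫ e.inv := by
    rw [Category.assoc, Category.assoc, Iso.hom_inv_id_assoc, h1, ← tensorHom_id, ← tensorHom_id,
      tensorHom_comp_tensorHom_assoc, tensorHom_comp_tensorHom_assoc,
      tensorHom_comp_tensorHom_assoc, Category.assoc p.hom m, h2, Iso.hom_inv_id_assoc, Category.id_comp,
      Category.id_comp, Category.comp_id]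
  have h4 : T ◁ p.hom ≫ r.hom ≫ (r.inv ≫ (𝟙 T ⊗ₘ m) ≫ p.hom) ≫ m =
      (e.hom ⊗ₘ (e.hom ⊗ₘ e.hom)) ≫ X ◁ μ[X] ≫ μ[X] ≫ e.inv := by
    rw [Category.assoc, Category.assoc, Iso.hom_inv_id_assoc, h1, ← id_tensorHom, ← id_tensorHom,
      tensorHom_comp_tensorHom_assoc, tensorHom_comp_tensorHom_assoc,
      tensorHom_comp_tensorHom_assoc, Category.assoc p.hom m, h2, Iso.hom_inv_id_assoc, Category.id_comp,
      Category.id_comp, Category.comp_id]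
  rw [h3, reassoc_of% h, h4, ← associator_naturality_assoc, MonObj.mul_assoc_assoc]

/-- The isomorphism between the first tensor power of an object and the object. -/
def tpowOne (X : C) : tpow X 1 ≅ X := λ_ X

/-- The monoid structure on the tensor powers of a monoid. -/
def PowMon.ofMonObj (X : C) [MonObj X] : PowMon X where
  one := η[X] ≫ (tpowOne X).inv
  mul := (tpowAdd X 1 1).inv ≫ ((tpowOne X).hom ⊗ₘ (tpowOne X).hom) ≫ μ[X] ≫ (tpowOne X).inv
  one_mul := by
    refine heq_of_eq ?_
    have h : (tpowAdd X 0 1).hom = (λ_ (tpow X 1)).hom :=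
      (Category.comp_id _).symm.trans (zero_tpowAdd X 1)
    rw [← cancel_epi (tpowAdd X 0 1).hom, ← Category.assoc, tpowAdd_tens, Category.assoc,
      Iso.hom_inv_id_assoc]
    exact (one_mul_of_iso (tpowOne X)).trans (h.symm.trans (Category.comp_id _).symm)
  mul_one := by
    refine heq_of_eq ?_
    rw [← cancel_epi (tpowAdd X 1 0).hom, ← Category.assoc, tpowAdd_tens, Category.assoc,
      Iso.hom_inv_id_assoc]
    exact (mul_one_of_iso (tpowOne X)).trans (Category.comp_id (ρ_ (tpow X 1)).hom).symm
  mul_assoc := by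
    refine heq_of_eq ?_
    have h : (tpowAdd X 1 1).hom ▷ tpow X 1 ≫ (tpowAdd X (1 + 1) 1).hom =
        (α_ _ _ _).hom ≫ tpow X 1 ◁ (tpowAdd X 1 1).hom ≫ (tpowAdd X 1 (1 + 1)).hom :=
      Eq.trans (congrArg (_ ≫ ·) (Category.comp_id _).symm) (tpowAdd_assoc X 1 1 1)
    exact mul_assoc_of_iso (tpowOne X) (tpowAdd X 1 1) (tpowAdd X (1 + 1) 1) (tpowAdd X 1 (1 + 1))
      h rfl

variable {G : Type w'} [Group G] (N : GMon G C)

/-- The object that underlies a `G`-monoid. -/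
abbrev GMon.pt : Mon C := N.obj (SingleObj.star G)

/-- The action of `g : G` on a `G`-monoid. -/
def GMon.act (g : G) : N.pt ⟶ N.pt := N.map (X := SingleObj.star G) (Y := SingleObj.star G) g

theorem GMon.act_one : N.act 1 = 𝟙 N.pt := N.map_id _

theorem GMon.act_mul (g h : G) : N.act (g * h) = N.act h ≫ N.act g :=
  N.map_comp (X := SingleObj.star G) (Y := SingleObj.star G) (Z := SingleObj.star G) h g

/-- The action of `G` on the first tensor power of a `G`-monoid. -/
def GMon.powAct : G →* End (tpow N.pt.X 1) where
  toFun g := (tpowOne N.pt.X).hom ≫ (N.act g).hom ≫ (tpowOne N.pt.X).inv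
  map_one' := by
    rw [N.act_one, Mon.id_hom', Category.id_comp, Iso.hom_inv_id]
    rfl
  map_mul' g h := by
    change _ = ((tpowOne N.pt.X).hom ≫ (N.act h).hom ≫ (tpowOne N.pt.X).inv) ≫
      (tpowOne N.pt.X).hom ≫ (N.act g).hom ≫ (tpowOne N.pt.X).inv
    rw [N.act_mul, Mon.comp_hom']
    simp

theorem GMon.powAct_apply (g : G) :
    N.powAct g = ((tpowOne N.pt.X).hom ≫ (N.act g).hom ≫ (tpowOne N.pt.X).inv :) := rfl

/-- Each `g` acts by a morphism of `Mon C`, and conjugation by `tpowOne` preserves this. -/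
theorem GMon.isEquivariant : (PowMon.ofMonObj N.pt.X).IsEquivariant N.powAct where
  one_comp g := by
    change (η[N.pt.X] ≫ (tpowOne N.pt.X).inv) ≫
      (tpowOne N.pt.X).hom ≫ (N.act g).hom ≫ (tpowOne N.pt.X).inv =
        η[N.pt.X] ≫ (tpowOne N.pt.X).inv
    rw [Category.assoc, Iso.inv_hom_id_assoc, IsMonHom.one_hom_assoc]
  mul_comp g := by
    change ((tpowAdd _ 1 1).inv ≫ ((tpowOne N.pt.X).hom ⊗ₘ (tpowOne N.pt.X).hom) ≫ μ[N.pt.X] ≫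
      (tpowOne N.pt.X).inv) ≫ (tpowOne N.pt.X).hom ≫ (N.act g).hom ≫ (tpowOne N.pt.X).inv =
      tens ((tpowOne N.pt.X).hom ≫ (N.act g).hom ≫ (tpowOne N.pt.X).inv)
        ((tpowOne N.pt.X).hom ≫ (N.act g).hom ≫ (tpowOne N.pt.X).inv) ≫ (tpowAdd _ 1 1).inv ≫
          ((tpowOne N.pt.X).hom ⊗ₘ (tpowOne N.pt.X).hom) ≫ μ[N.pt.X] ≫ (tpowOne N.pt.X).inv
    rw [tens]
    simp only [Category.assoc, Iso.hom_inv_id_assoc, Iso.inv_hom_id_assoc,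
      tensorHom_comp_tensorHom_assoc, Iso.inv_hom_id, Category.comp_id, IsMonHom.mul_hom_assoc]

end Monoid

section EssSurj

open MonObj

variable {C : Type u} [Category.{v} C] [MonoidalCategory C] [BraidedCategory C]
  {K : CrossedGroups.{w}} {G : Type w'} [Group G] (hK : K.GeneratedBySwap)
  (N : GMon G C) (R : PowRep K N.pt.X)

/-- The algebra given by a `G`-monoid. -/
noncomputable def GMon.alg : Alg (K.labelled G).Obj C :=
  (R.labelled hK N.powAct).alg (PowMon.ofMonObj N.pt.X)
    (R.labelled_compat hK N.powAct N.isEquivariant)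

theorem GMon.alg_map_ofMap {n m : ℕ} (φ : OrdMap n m) :
    (N.alg hK R).functor.map (CrossedGroups.ofMap φ) = ((PowMon.ofMonObj N.pt.X).ord φ :) := by
  refine Eq.trans ?_ (Category.id_comp _)
  exact congrArg (· ≫ (PowMon.ofMonObj N.pt.X).ord φ) ((R.labelled hK N.powAct).rep_one n)

theorem GMon.alg_map_ofLabel (g : G) :
    (N.alg hK R).functor.map (CrossedGroups.ofLabel K g) = (N.powAct g :) := by
  -- A single label acts as the tensor product of the identity of `X ^ 0` with the action of `g`.
  have h : labels N.powAct (fun _ : Fin 1 => g) = N.powAct g :=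
    eq_of_heq (zero_tens (N.powAct g))
  have h' : (R.labelled hK N.powAct).rep 1 (K.ofLabels fun _ => g) = (N.powAct g :) := by
    refine (R.labelled_rep hK N.powAct _).trans ?_
    change (R.rep 1 1 : tpow _ 1 ⟶ tpow _ 1) ≫ labels N.powAct (fun _ : Fin 1 => g) = _
    rw [R.rep_one, h]
    exact Category.id_comp _
  refine Eq.trans ?_ (Category.comp_id _)
  exact congrArg₂ (· ≫ ·) h' ((PowMon.ofMonObj N.pt.X).ord_id 1)

/-- With `alg_mul`, this makes `tpowOne` an isomorphism of monoids from the value of the algebra at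
`1` to the given monoid, as `evaluationAlgIso` requires. -/
theorem GMon.alg_one : (Functor.LaxMonoidal.ε (N.alg hK R).functor ≫
    (N.alg hK R).functor.map (CrossedGroups.ofMap (OrdMap.toOne 0))) ≫ (tpowOne N.pt.X).hom =
      η[N.pt.X] := by
  rw [N.alg_map_ofMap, PowMon.ord_to_one]
  change (𝟙 (𝟙_ C) ≫ η[N.pt.X] ≫ (tpowOne N.pt.X).inv) ≫ (tpowOne N.pt.X).hom = _
  simp

theorem GMon.alg_mul : (Functor.LaxMonoidal.μ (N.alg hK R).functor ⟨1⟩ ⟨1⟩ ≫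
    (N.alg hK R).functor.map (CrossedGroups.ofMap (OrdMap.toOne (1 + 1)))) ≫
      (tpowOne N.pt.X).hom =
      ((tpowOne N.pt.X).hom ⊗ₘ (tpowOne N.pt.X).hom) ≫ μ[N.pt.X] := by
  rw [N.alg_map_ofMap, PowMon.ord_to_one, PowMon.mulN_succ, PowMon.mulN_one, tens_id]
  change ((tpowAdd _ 1 1).hom ≫ 𝟙 _ ≫ (tpowAdd _ 1 1).inv ≫
    ((tpowOne N.pt.X).hom ⊗ₘ (tpowOne N.pt.X).hom) ≫ μ[N.pt.X] ≫
      (tpowOne N.pt.X).inv) ≫ (tpowOne N.pt.X).hom = _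
  simp

/-- The value at `1` of the algebra given by a `G`-monoid. -/
noncomputable def GMon.evaluationAlgIso : (K.evaluation G C).obj (N.alg hK R) ≅ N :=
  NatIso.ofComponents
    (fun _ => Mon.mkIso (M := (N.alg hK R).functor.mapMon.obj (K.labelled G).ptMon) (N := N.pt)
      (tpowOne N.pt.X) (N.alg_one hK R) (N.alg_mul hK R))
    (fun g => by
      refine Mon.Hom.ext ?_
      have h := N.alg_map_ofLabel hK R g
      refine (congrArg (· ≫ (tpowOne N.pt.X).hom) h).trans ?_
      rw [N.powAct_apply]
      change ((tpowOne N.pt.X).hom ≫ (N.act g).hom ≫ (tpowOne N.pt.X).inv) ≫ (tpowOne N.pt.X).hom =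
        (tpowOne N.pt.X).hom ≫ (N.act g).hom
      simp)

end EssSurj

/-! ### Strict algebras and the equivalence for monoids. -/

section Strict

variable {P : Type u'} [Category.{v'} P] [MonoidalCategory P] [BraidedCategory P]
  {C : Type u} [Category.{v} C] [MonoidalCategory C] [BraidedCategory C]

/-- If every algebra is isomorphic to a strict one, then the strict algebras form a category
equivalent to that of all algebras. -/
noncomputable def strictAlgEquivalence
    (h : ∀ A : Alg P C, ∃ B : Alg P C, B.IsStrict ∧ Nonempty (B ≅ A)) :
    StrictAlg P C ≌ Alg P C :=
  have : (ObjectProperty.ι fun A : Alg P C => A.IsStrict).EssSurj :=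
    ⟨fun A => let ⟨B, hB, e⟩ := h A; ⟨⟨B, hB⟩, e⟩⟩
  have : (ObjectProperty.ι fun A : Alg P C => A.IsStrict).IsEquivalence := { }
  (ObjectProperty.ι fun A : Alg P C => A.IsStrict).asEquivalence

end Strict

section StrictPowers

variable {C : Type u} [Category.{v} C] [MonoidalCategory C] [IsStrictMonoidal C]

theorem tpow_tensor (X : C) (a b : ℕ) : tpow X a ⊗ tpow X b = tpow X (a + b) := by
  induction b with
  | zero => exact IsStrictMonoidal.tensor_unit _
  | succ b ih =>
    exact (IsStrictMonoidal.tensor_assoc _ _ _).symm.trans (congrArg (· ⊗ X) ih)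

/-- The isomorphism is built from associators and unitors only, and these are identities in a strict
category. -/
theorem tpowAdd_eq_eqToHom (X : C) (a b : ℕ) :
    (tpowAdd X a b).hom = eqToHom (tpow_tensor X a b) := by
  induction b with
  | zero => exact congrArg Iso.hom (IsStrictMonoidal.rightUnitor_eq (tpow X a))
  | succ b ih =>
    rw [tpowAdd_succ, ih, IsStrictMonoidal.associator_eq, eqToIso.inv,
      eqToHom_whiskerRight_self _ X (congrArg (· ⊗ X) (tpow_tensor X a b)), eqToHom_trans]
    rfl

end StrictPowers

section Equivalence

variable {C : Type u} [Category.{v} C] [MonoidalCategory C] [BraidedCategory C]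
  {K : CrossedGroups.{w}} (G : Type w') [Group G] (hK : K.GeneratedBySwap)
  (R : ∀ X : C, PowRep K X)

/-- Algebras of `𝔻 ⊗ 𝕁 ⊗ 𝔾` are `G`-monoids. -/
noncomputable def algEquivalence : Alg (K.labelled G).Obj C ≌ GMon G C :=
  have := CrossedGroups.evaluation_full (G := G) (C := C) hK
  have : (K.evaluation G C).EssSurj :=
    ⟨fun N => ⟨N.alg hK (R _), ⟨N.evaluationAlgIso hK (R _)⟩⟩⟩
  have : (K.evaluation G C).IsEquivalence := { }
  (K.evaluation G C).asEquivalence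

variable {G}

theorem GMon.isStrict_alg [IsStrictMonoidal C] (N : GMon G C) (R : PowRep K N.pt.X) :
    (N.alg hK R).IsStrict where
  unit_eq := rfl
  tensor_eq Y Z := tpow_tensor _ Y.n Z.n
  ε_eq := rfl
  μ_eq Y Z := tpowAdd_eq_eqToHom _ Y.n Z.n

include hK R in
-- The strict algebra is the one built from the `G`-monoid of `A`. The two have isomorphic values at
-- `1`, and full faithfulness of the evaluation lifts this isomorphism to algebras.
theorem exists_isStrict_iso [IsStrictMonoidal C] (A : Alg (K.labelled G).Obj C) :
    ∃ B : Alg (K.labelled G).Obj C, B.IsStrict ∧ Nonempty (B ≅ A) := by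
  have := CrossedGroups.evaluation_full (G := G) (C := C) hK
  exact ⟨_, GMon.isStrict_alg hK ((K.evaluation G C).obj A) (R _),
    ⟨(K.evaluation G C).preimageIso (GMon.evaluationAlgIso hK _ (R _))⟩⟩

end Equivalence

/-- The structure maps of `F.leftOp` are the opposites of the inverses of those of `F`; this keeps
them identities when `F` is strict. -/
theorem unop_inv_eq_eqToHom {C : Type u} [Category.{v} C] {X Y : Cᵒᵖ} (e : X ≅ Y) (h : X = Y) (he : e.hom = eqToHom h) :
    e.inv.unop = eqToHom (congrArg Opposite.unop h) := by
  subst h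
  have : e.inv = 𝟙 X := by
    rw [← Category.id_comp e.inv]
    exact (congrArg (· ≫ e.inv) he.symm).trans e.hom_inv_id
  rw [this]
  rfl

/-! ### Algebras of opposite categories. -/

section Opposite

open Opposite

variable {P : Type u'} [Category.{v'} P] [MonoidalCategory P]
  {C : Type u} [Category.{v} C] [MonoidalCategory C]

/-- The monoidal structure of `F.rightOp`. -/
def rightOpCoreMonoidal (F : Pᵒᵖ ⥤ C) [F.Monoidal] : F.rightOp.CoreMonoidal where
  εIso := (Functor.Monoidal.εIso F).symm.op
  μIso X Y := (Functor.Monoidal.μIso F (op X) (op Y)).symm.op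
  μIso_hom_natural_left f X' := Quiver.Hom.unop_inj
    (Functor.OplaxMonoidal.δ_natural_left F f.op (op X'))
  μIso_hom_natural_right X' f := Quiver.Hom.unop_inj
    (Functor.OplaxMonoidal.δ_natural_right F (op X') f.op)
  associativity X Y Z := Quiver.Hom.unop_inj
    ((Category.assoc _ _ _).trans ((Functor.OplaxMonoidal.associativity_inv F
      (op X) (op Y) (op Z)).symm.trans (Category.assoc _ _ _).symm))
  left_unitality X := Quiver.Hom.unop_inj
    ((Functor.OplaxMonoidal.left_unitality F (op X)).trans (Category.assoc _ _ _).symm)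
  right_unitality X := Quiver.Hom.unop_inj
    ((Functor.OplaxMonoidal.right_unitality F (op X)).trans (Category.assoc _ _ _).symm)

/-- `F.rightOp` is monoidal. -/
instance rightOpMonoidal (F : Pᵒᵖ ⥤ C) [F.Monoidal] : F.rightOp.Monoidal :=
  (rightOpCoreMonoidal F).toMonoidal

/-- The monoidal structure of `F.leftOp`. -/
def leftOpCoreMonoidal (F : P ⥤ Cᵒᵖ) [F.Monoidal] : F.leftOp.CoreMonoidal where
  εIso := (Functor.Monoidal.εIso F).symm.unop
  μIso X Y := (Functor.Monoidal.μIso F (unop X) (unop Y)).symm.unop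
  μIso_hom_natural_left f X' := Quiver.Hom.op_inj
    (Functor.OplaxMonoidal.δ_natural_left F f.unop (unop X'))
  μIso_hom_natural_right X' f := Quiver.Hom.op_inj
    (Functor.OplaxMonoidal.δ_natural_right F (unop X') f.unop)
  associativity X Y Z := Quiver.Hom.op_inj
    ((Category.assoc _ _ _).trans ((Functor.OplaxMonoidal.associativity_inv F
      (unop X) (unop Y) (unop Z)).symm.trans (Category.assoc _ _ _).symm))
  left_unitality X := Quiver.Hom.op_inj
    ((Functor.OplaxMonoidal.left_unitality F (unop X)).trans (Category.assoc _ _ _).symm)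
  right_unitality X := Quiver.Hom.op_inj
    ((Functor.OplaxMonoidal.right_unitality F (unop X)).trans (Category.assoc _ _ _).symm)

/-- `F.leftOp` is monoidal. -/
instance leftOpMonoidal (F : P ⥤ Cᵒᵖ) [F.Monoidal] : F.leftOp.Monoidal :=
  (leftOpCoreMonoidal F).toMonoidal

section IsMonoidal

open Functor.LaxMonoidal Functor.OplaxMonoidal

variable {F F' : P ⥤ C} [F.Monoidal] [F'.Monoidal]

/-- In the opposite category `ε` and `μ` are replaced by their inverses `η` and `δ`, so monoidality
is needed in terms of these, here and in `comp_δ_of_isMonoidal`. -/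
theorem comp_η_of_isMonoidal (τ : F ⟶ F') [NatTrans.IsMonoidal τ] :
    τ.app (𝟙_ P) ≫ η F' = η F := by
  rw [← cancel_epi (ε F), NatTrans.IsMonoidal.unit_assoc, Functor.Monoidal.ε_η,
    Functor.Monoidal.ε_η]

theorem comp_δ_of_isMonoidal (τ : F ⟶ F') [NatTrans.IsMonoidal τ] (X Y : P) :
    τ.app (X ⊗ Y) ≫ δ F' X Y = δ F X Y ≫ (τ.app X ⊗ₘ τ.app Y) := by
  rw [← cancel_epi (μ F X Y), NatTrans.IsMonoidal.tensor_assoc, Functor.Monoidal.μ_δ,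
    Functor.Monoidal.μ_δ_assoc, Category.comp_id]

end IsMonoidal

instance isMonoidal_rightOp {F F' : Pᵒᵖ ⥤ C} [F.Monoidal] [F'.Monoidal] (τ : F ⟶ F')
    [NatTrans.IsMonoidal τ] : NatTrans.IsMonoidal (NatTrans.rightOp τ) where
  unit := Quiver.Hom.unop_inj (comp_η_of_isMonoidal τ)
  tensor X Y := Quiver.Hom.unop_inj (comp_δ_of_isMonoidal τ (op X) (op Y))

theorem isMonoidal_of_rightOp {F F' : Pᵒᵖ ⥤ C} [F.Monoidal] [F'.Monoidal]
    (τ : F'.rightOp ⟶ F.rightOp) [NatTrans.IsMonoidal τ] :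
    NatTrans.IsMonoidal (NatTrans.removeRightOp τ) where
  unit := Quiver.Hom.op_inj (comp_η_of_isMonoidal τ)
  tensor X Y := Quiver.Hom.op_inj (comp_δ_of_isMonoidal τ (unop X) (unop Y))

variable [BraidedCategory P] [BraidedCategory C]

theorem map_braiding_δ {F : P ⥤ C} [F.Braided] (X Y : P) :
    F.map (β_ X Y).hom ≫ Functor.OplaxMonoidal.δ F Y X =
      Functor.OplaxMonoidal.δ F X Y ≫ (β_ (F.obj X) (F.obj Y)).hom := by
  rw [← cancel_epi (Functor.LaxMonoidal.μ F X Y), Functor.LaxBraided.braided_assoc,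
    Functor.Monoidal.μ_δ, Functor.Monoidal.μ_δ_assoc, Category.comp_id]

/-- `F.rightOp` is braided. -/
instance rightOpBraided (F : Pᵒᵖ ⥤ C) [F.Braided] : F.rightOp.Braided where
  -- The arguments are exchanged because reversing arrows exchanges source and target of the
  -- braiding.
  braided X Y := Quiver.Hom.unop_inj (map_braiding_δ (F := F) (op Y) (op X))

/-- `F.leftOp` is braided. -/
instance leftOpBraided (F : P ⥤ Cᵒᵖ) [F.Braided] : F.leftOp.Braided where
  braided X Y := Quiver.Hom.op_inj (map_braiding_δ (F := F) (unop Y) (unop X))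

variable (P C) in
/-- Algebras of `Pᵒᵖ` in `C` as algebras of `P` in `Cᵒᵖ`. -/
def algOp : Alg Pᵒᵖ C ⥤ (Alg P Cᵒᵖ)ᵒᵖ where
  obj A := op ⟨A.functor.rightOp⟩
  map f := Quiver.Hom.op ⟨NatTrans.rightOp f.natTrans, inferInstance⟩
  map_id _ := rfl
  map_comp _ _ := rfl

/-- The algebra of `Pᵒᵖ` in `C` given by an algebra of `P` in `Cᵒᵖ`. -/
def Alg.leftOp (B : Alg P Cᵒᵖ) : Alg Pᵒᵖ C := ⟨B.functor.leftOp⟩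

/-- `B.leftOp` corresponds to `B`. -/
def algOpLeftOpIso (B : Alg P Cᵒᵖ) : (algOp P C).obj B.leftOp ≅ op B :=
  Iso.op
    { hom :=
      { natTrans := (Functor.leftOpRightOpIso B.functor).inv
        isMonoidal :=
          { unit := Category.comp_id _
            tensor := fun X Y => by
              refine (Category.comp_id _).trans ((Category.id_comp _).symm.trans ?_)
              exact congrArg (· ≫ _) (id_tensorHom_id _ _).symm } }
      inv :=
      { natTrans := (Functor.leftOpRightOpIso B.functor).hom
        isMonoidal :=
          { unit := Category.comp_id _
            tensor := fun X Y => by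
              refine (Category.comp_id _).trans ((Category.id_comp _).symm.trans ?_)
              exact congrArg (· ≫ _) (id_tensorHom_id _ _).symm } }
      hom_inv_id := Alg.Hom.ext (Iso.inv_hom_id _)
      inv_hom_id := Alg.Hom.ext (Iso.hom_inv_id _) }

instance algOp_faithful : (algOp P C).Faithful where
  map_injective {A B} f g h := by
    refine Alg.Hom.ext (NatTrans.ext (funext fun X => ?_))
    exact congrArg (fun t : (algOp P C).obj A ⟶ (algOp P C).obj B =>
      (t.unop.natTrans.app (unop X)).unop) h

instance algOp_full : (algOp P C).Full where
  map_surjective {A B} t := ⟨⟨NatTrans.removeRightOp t.unop.natTrans,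
    @isMonoidal_of_rightOp _ _ _ _ _ _ A.functor B.functor _ _ _ t.unop.isMonoidal⟩, rfl⟩

instance algOp_essSurj : (algOp P C).EssSurj where
  mem_essImage B := ⟨B.unop.leftOp, ⟨algOpLeftOpIso B.unop⟩⟩

instance algOp_isEquivalence : (algOp P C).IsEquivalence where

instance isStrictMonoidal_op [IsStrictMonoidal C] : IsStrictMonoidal Cᵒᵖ where
  tensor_assoc X Y Z :=
    congrArg op (IsStrictMonoidal.tensor_assoc X.unop Y.unop Z.unop)
  unit_tensor X := congrArg op (IsStrictMonoidal.unit_tensor X.unop)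
  tensor_unit X := congrArg op (IsStrictMonoidal.tensor_unit X.unop)
  associator_eq X Y Z := by
    refine Iso.ext ?_
    change (α_ X.unop Y.unop Z.unop).inv.op = _
    rw [IsStrictMonoidal.associator_eq, eqToIso.inv, eqToHom_op]
    rfl
  leftUnitor_eq X := by
    refine Iso.ext ?_
    change (λ_ X.unop).inv.op = _
    rw [IsStrictMonoidal.leftUnitor_eq, eqToIso.inv, eqToHom_op]
    rfl
  rightUnitor_eq X := by
    refine Iso.ext ?_
    change (ρ_ X.unop).inv.op = _
    rw [IsStrictMonoidal.rightUnitor_eq, eqToIso.inv, eqToHom_op]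
    rfl

theorem Alg.IsStrict.leftOp {B : Alg P Cᵒᵖ} (hB : B.IsStrict) : B.leftOp.IsStrict where
  unit_eq := congrArg unop hB.unit_eq
  tensor_eq X Y := congrArg unop (hB.tensor_eq X.unop Y.unop)
  ε_eq := unop_inv_eq_eqToHom (Functor.Monoidal.εIso B.functor) hB.unit_eq hB.ε_eq
  μ_eq X Y := unop_inv_eq_eqToHom (Functor.Monoidal.μIso B.functor X.unop Y.unop)
    (hB.tensor_eq X.unop Y.unop) (hB.μ_eq X.unop Y.unop)

/-- A strict representative over `Cᵒᵖ` is carried back by `leftOp`, and its isomorphism is lifted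
along the equivalence `algOp`. -/
theorem exists_isStrict_iso_op
    (h : ∀ A : Alg P Cᵒᵖ, ∃ B : Alg P Cᵒᵖ, B.IsStrict ∧ Nonempty (B ≅ A)) (A : Alg Pᵒᵖ C) :
    ∃ B : Alg Pᵒᵖ C, B.IsStrict ∧ Nonempty (B ≅ A) := by
  obtain ⟨B, hB, ⟨e⟩⟩ := h ((algOp P C).obj A).unop
  exact ⟨B.leftOp, hB.leftOp, ⟨(algOp P C).preimageIso ((algOpLeftOpIso B).trans e.symm.op)⟩⟩

end Opposite

/-! ### Comonoids as monoids in the opposite category. -/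

section Comonoids

variable (G : Type w') [Group G] (C : Type u) [Category.{v} C] [MonoidalCategory C]

/-- `G`-comonoids in `C` are `G`-monoids in `Cᵒᵖ`. -/
def gComonEquivalence : GComon G C ≌ (GMon G Cᵒᵖ)ᵒᵖ :=
  (Comon.Comon_EquivMon_OpOp C).congrRight.trans
    -- Taking opposites of functors would also replace `G` by its opposite; inversion in the group
    -- identifies the two beforehand.
    ((Groupoid.invEquivalence (SingleObj G)).congrLeft.trans
      (Functor.opUnopEquiv (SingleObj G) (Mon Cᵒᵖ)).symm)

end Comonoids

/-- The opposite of a symmetric category is symmetric. -/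
instance symmetricCategoryOp (S : Type u) [Category.{v} S] [MonoidalCategory S]
    [SymmetricCategory S] : SymmetricCategory Sᵒᵖ where
  symmetry X Y := Quiver.Hom.unop_inj (SymmetricCategory.symmetry X.unop Y.unop)

end EquivariantPROP

theorem mainTheorem4 {G : Type*} [Group G]
    {S : Type*} [Category* S] [MonoidalCategory S] [SymmetricCategory S]
    {B : Type*} [Category* B] [MonoidalCategory B] [BraidedCategory B] :
    (Nonempty (Alg (PropDPG G) S ≌ GMon G S) ∧
      Nonempty (Alg (ProbDBG G) B ≌ GMon G B) ∧
      Nonempty (Alg (PropDPG G)ᵒᵖ S ≌ GComon G S) ∧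
      Nonempty (Alg (ProbDBG G)ᵒᵖ B ≌ GComon G B)) ∧
    (IsStrictMonoidal S →
      Nonempty (StrictAlg (PropDPG G) S ≌ GMon G S) ∧
      Nonempty (StrictAlg (PropDPG G)ᵒᵖ S ≌ GComon G S)) ∧
    (IsStrictMonoidal B →
      Nonempty (StrictAlg (ProbDBG G) B ≌ GMon G B) ∧
      Nonempty (StrictAlg (ProbDBG G)ᵒᵖ B ≌ GComon G B)) := by
  have hP := CrossedGroups.symmetricGroups_generatedBySwap
  have hB := CrossedGroups.braidGroups_generatedBySwap
  have e₁ := algEquivalence G hP (symmRep : ∀ X : S, _)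
  have e₂ := algEquivalence G hB (braidRep : ∀ X : B, _)
  -- The monoid case is applied in `Sᵒᵖ`; the two passages to the opposite category cancel.
  have e₃ := (algOp (PropDPG G) S).asEquivalence.trans
    ((algEquivalence G hP (symmRep : ∀ X : Sᵒᵖ, _)).op.trans (gComonEquivalence G S).symm)
  have e₄ := (algOp (ProbDBG G) B).asEquivalence.trans
    ((algEquivalence G hB (braidRep : ∀ X : Bᵒᵖ, _)).op.trans (gComonEquivalence G B).symm)
  refine ⟨⟨⟨e₁⟩, ⟨e₂⟩, ⟨e₃⟩, ⟨e₄⟩⟩, fun _ => ⟨⟨?_⟩, ⟨?_⟩⟩, fun _ => ⟨⟨?_⟩, ⟨?_⟩⟩⟩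
  · exact (strictAlgEquivalence (exists_isStrict_iso hP symmRep)).trans e₁
  · exact (strictAlgEquivalence
      (exists_isStrict_iso_op (exists_isStrict_iso hP symmRep))).trans e₃
  · exact (strictAlgEquivalence (exists_isStrict_iso hB braidRep)).trans e₂
  · exact (strictAlgEquivalence
      (exists_isStrict_iso_op (exists_isStrict_iso hB braidRep))).trans e₄
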